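/- Let $0<\alpha<\frac12$, $r>0$, $T>0$. Let $W_1^{\alpha}(a,b)$ be the space of measurable $f:[a,b]\to\mathbb R$ with $$\|f\|_{\alpha,1(a,b)}=\sup_{u\in[a,b]}\Big(|f(u)|+\int_a^u\frac{|f(u)-f(v)|}{(u-v)^{\alpha+1}}\,dv\Big)<\infty ,$$ and $W_2^{1-\alpha}(0,T)$ the space of measurable $g:[0,T]\to\mathbb R$ with $$\|g\|_{1-\alpha,2}=\sup_{0\le u<v\le T}\Big(\frac{|g(v)-g(u)|}{(v-u)^{1-\alpha}}+\int_u^v\frac{|g(y)-g(u)|}{(y-u)^{2-\alpha}}\,dy\Big)<\infty .$$ Integrals $\int_a^b f\,dg$ are generalized Stieltjes integrals, $\int_a^b f\,dg=(-1)^\alpha\int_a^b D^\alpha_{a+}f(t)\,D^{1-\alpha}_{b-}g_{b-}(t)\,dt$ with $g_{b-}=g-g(b)$ and Weyl derivatives $D^\alpha_{a+}$, $D^{1-\alpha}_{b-}$ (and $\int_0^t f\,dg:=0$ if $t<0$); $f$ is called integrable on $(a,b)$ if it is measurable and $$N_{a,b}(f)=\int_a^b\Big(\frac{|f(t)|}{(t-a)^\alpha}+\int_a^t\frac{|f(t)-f(y)|}{(t-y)^{\alpha+1}}\,dy\Big)dt<\infty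 .$$ Let $b,\sigma\in C^2(\mathbb R)$ have bounded first and second derivatives, let $\eta:[-r,0]\to\mathbb R$, and let $g\mapsto\bar x^g$ be a continuously Fréchet differentiable map from $W_2^{1-\alpha}(0,T)$ to $W_1^{\alpha}(-r,T-r)$, with derivative $D_h\bar x^g$ in the direction $h$. For each $g\in W_2^{1-\alpha}(0,T)$ let $x^g$ be the solution of $$x^g_t=\eta_0+\int_0^t b(x^g_s)\,ds+\int_0^t\sigma(\bar x^g_{s-r})\,dg_s\quad(t\in[0,T]),\qquad x^g_t=\eta_t\quad(t\in[-r,0]).$$ Fix $g$, and let $D_s\bar x^g_t$ ($s\in[0,T]$, $t\in[-r,T-r]$) be a jointly measurable kernel with $D_s\bar x^g_t=0$ for $s>t$, such that $s\mapsto D_s\bar x_t^g$ is integrable on $(0,t)$ for every $t\in[0,T-r]$, $t\mapsto D_s\bar x_t^g$ is integrable on $(s,T-r)$ for every $s\in[0,T-r]$, and the double generalized Stieltjes integral converges absolutely: $$\int_0^{T-r}\Big(\frac{N_{0,T}(D_\cdot\bar x^g_t)}{t^\alpha}+\int_0^t\frac{N_{0,T}(D_\cdot\bar x^g_t-D_\cdot\bar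 x^g_v)}{(t-v)^{\alpha+1}}\,dv\Big)dt<\infty$$ (the outer integral is void if $T\le r$). Then there is a kernel $\Phi^g_t(s)$, $s,t\in[0,T]$, with $u\mapsto\Phi_u^g(s)$ Lebesgue integrable on $[s,T]$ for each $s$, unique on $[0,T]^2$, such that $$\Phi^g_t(s)=\int_s^t b'(x^g_u)\Phi^g_u(s)\,du+\sigma(\bar x^g_{s-r})+\int_s^t\sigma'(\bar x^g_{u-r})\,D_s\bar x^g_{u-r}\,dg_u\quad(s\le t),\qquad \Phi^g_t(s)=0\quad(s>t),$$ where the integrands $u\mapsto\sigma'(\bar x^g_{u-r})D_s\bar x^g_{u-r}$ and $s\mapsto\Phi^g_t(s)$ are integrable on $(s,t)$ and $(0,t)$ respectively. Moreover $x^{g'}|_{[0,T]}\in W_1^\alpha(0,T)$ for every $g'$, the map $g'\mapsto x^{g'}\in W_1^{\alpha}(0,T)$ is Fréchet differentiable at $g$, and for every $h\in W_2^{1-\alpha}(0,T)$ such that $$D_h\bar x^g_t=\int_0^t D_s\bar x^g_t\,dh_s\qquad(t\in[-r,T-r])$$ its derivative in the direction $h$ is $$D_hx^g_t=\int_0^t\Phi^g_t(s)\,dh_s\qquad(t\in[0,T]).$$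 -/

import Mathlib

open MeasureTheory Set Filter Topology
open scoped ENNReal

noncomputable section

namespace FracDelay

/-! ### The spaces `W_1^α(a,b)` and `W_2^{1-α}(0,T)`

A function on `[a,b]` is represented by its extension by zero to the real line. -/

/-- The norm `sup_{u ∈ [a,b]} ( |f(u)| + ∫_a^u |f(u)-f(v)| / (u-v)^{α+1} dv )`, with values in
`[0,∞]`. -/
def eNorm1 (α a b : ℝ) (f : ℝ → ℝ) : ℝ≥0∞ :=
  ⨆ u ∈ Icc a b, (ENNReal.ofReal |f u|
    + ∫⁻ v in Ioc a u, ENNReal.ofReal (|f u - f v| / (u - v) ^ (α + 1)))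

/-- The (semi)norm `sup_{0 ≤ u < v ≤ T} ( |g(v)-g(u)| / |v-u|^{1-α}
+ ∫_u^v |g(y)-g(u)| / (y-u)^{2-α} dy )`, with values in `[0,∞]`. -/
def eNorm2 (α T : ℝ) (g : ℝ → ℝ) : ℝ≥0∞ :=
  ⨆ u ∈ Icc (0 : ℝ) T, ⨆ v ∈ Ioc u T, (ENNReal.ofReal (|g v - g u| / |v - u| ^ (1 - α))
    + ∫⁻ y in Ioc u v, ENNReal.ofReal (|g y - g u| / (y - u) ^ (2 - α)))

lemma lintegral_ofReal_add_le {μ : Measure ℝ} {p q w : ℝ → ℝ} (hp : Measurable p)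
    (hw : Measurable w) (c d : ℝ) (hw0 : ∀ᵐ y ∂μ, 0 ≤ w y) :
    ∫⁻ y, ENNReal.ofReal (|(c + d) - (p y + q y)| / w y) ∂μ
      ≤ ∫⁻ y, ENNReal.ofReal (|c - p y| / w y) ∂μ + ∫⁻ y, ENNReal.ofReal (|d - q y| / w y) ∂μ := by
  rw [← lintegral_add_left (by fun_prop)]
  refine lintegral_mono_ae ?_
  filter_upwards [hw0] with y hy
  rw [← ENNReal.ofReal_add (by positivity) (by positivity), ← add_div]
  apply ENNReal.ofReal_le_ofReal
  gcongr
  rw [add_sub_add_comm]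
  exact abs_add_le _ _

lemma eNorm1_add_le (α a b : ℝ) {f g : ℝ → ℝ} (hf : Measurable f) :
    eNorm1 α a b (f + g) ≤ eNorm1 α a b f + eNorm1 α a b g := by
  refine iSup₂_le fun u hu => ?_
  refine le_trans ?_ (add_le_add (le_iSup₂ (f := fun u (_ : u ∈ Icc a b) =>
      (ENNReal.ofReal |f u| + ∫⁻ v in Ioc a u, ENNReal.ofReal (|f u - f v| / (u - v) ^ (α + 1))))
      u hu) (le_iSup₂ (f := fun u (_ : u ∈ Icc a b) =>
      (ENNReal.ofReal |g u| + ∫⁻ v in Ioc a u, ENNReal.ofReal (|g u - g v| / (u - v) ^ (α + 1))))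
      u hu))
  rw [add_add_add_comm]
  refine add_le_add ?_ ?_
  · rw [← ENNReal.ofReal_add (abs_nonneg _) (abs_nonneg _)]
    exact ENNReal.ofReal_le_ofReal (abs_add_le _ _)
  · refine lintegral_ofReal_add_le hf (by fun_prop) _ _ ?_
    filter_upwards [ae_restrict_mem measurableSet_Ioc] with y hy
    exact Real.rpow_nonneg (sub_nonneg.2 hy.2) _

lemma eNorm2_add_le (α T : ℝ) {f g : ℝ → ℝ} (hf : Measurable f) :
    eNorm2 α T (f + g) ≤ eNorm2 α T f + eNorm2 α T g := by
  refine iSup₂_le fun u hu => iSup₂_le fun v hv => ?_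
  have key : ∀ F : ℝ → ℝ, (ENNReal.ofReal (|F v - F u| / |v - u| ^ (1 - α))
      + ∫⁻ y in Ioc u v, ENNReal.ofReal (|F y - F u| / (y - u) ^ (2 - α))) ≤ eNorm2 α T F :=
    fun F => le_trans (le_iSup₂ (f := fun v (_ : v ∈ Ioc u T) =>
      (ENNReal.ofReal (|F v - F u| / |v - u| ^ (1 - α))
      + ∫⁻ y in Ioc u v, ENNReal.ofReal (|F y - F u| / (y - u) ^ (2 - α)))) v hv)
      (le_iSup₂ (f := fun u (_ : u ∈ Icc (0 : ℝ) T) => ⨆ v ∈ Ioc u T,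
      (ENNReal.ofReal (|F v - F u| / |v - u| ^ (1 - α))
      + ∫⁻ y in Ioc u v, ENNReal.ofReal (|F y - F u| / (y - u) ^ (2 - α)))) u hu)
  refine le_trans ?_ (add_le_add (key f) (key g))
  rw [add_add_add_comm]
  refine add_le_add ?_ ?_
  · rw [← ENNReal.ofReal_add (by positivity) (by positivity), ← add_div]
    apply ENNReal.ofReal_le_ofReal
    gcongr
    simp only [Pi.add_apply]
    rw [add_sub_add_comm]
    exact abs_add_le _ _
  · have := lintegral_ofReal_add_le (μ := volume.restrict (Ioc u v)) (p := f) (q := g)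
      (w := fun y => (y - u) ^ (2 - α)) hf (by fun_prop) (f u) (g u) (by
        filter_upwards [ae_restrict_mem measurableSet_Ioc] with y hy
        exact Real.rpow_nonneg (sub_nonneg.2 hy.1.le) _)
    simpa only [Pi.add_apply, abs_sub_comm] using this

lemma eNorm1_smul (α a b c : ℝ) (f : ℝ → ℝ) :
    eNorm1 α a b (c • f) = ENNReal.ofReal |c| * eNorm1 α a b f := by
  simp only [eNorm1, ENNReal.mul_iSup, mul_add, Pi.smul_apply, smul_eq_mul, ← mul_sub, abs_mul,
    mul_div_assoc, ENNReal.ofReal_mul (abs_nonneg c),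
    lintegral_const_mul' _ _ ENNReal.ofReal_ne_top]

lemma eNorm2_smul (α T c : ℝ) (f : ℝ → ℝ) :
    eNorm2 α T (c • f) = ENNReal.ofReal |c| * eNorm2 α T f := by
  simp only [eNorm2, ENNReal.mul_iSup, mul_add, Pi.smul_apply, smul_eq_mul, ← mul_sub, abs_mul,
    mul_div_assoc, ENNReal.ofReal_mul (abs_nonneg c),
    lintegral_const_mul' _ _ ENNReal.ofReal_ne_top]

lemma eNorm1_zero (α a b : ℝ) : eNorm1 α a b 0 = 0 := by simp [eNorm1]

lemma eNorm2_zero (α T : ℝ) : eNorm2 α T 0 = 0 := by simp [eNorm2]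

/-- The linear space underlying `W_1^α(a,b)`. -/
def submodule1 (α a b : ℝ) : Submodule ℝ (ℝ → ℝ) where
  carrier := {f | Measurable f ∧ (∀ t, t ∉ Icc a b → f t = 0) ∧ eNorm1 α a b f < ∞}
  add_mem' := by
    rintro f g ⟨hf, hf0, hf1⟩ ⟨hg, hg0, hg1⟩
    exact ⟨hf.add hg, fun t ht => by simp [hf0 t ht, hg0 t ht],
      (eNorm1_add_le α a b hf).trans_lt (ENNReal.add_lt_top.2 ⟨hf1, hg1⟩)⟩
  zero_mem' := ⟨measurable_const, fun _ _ => rfl, by simp [eNorm1_zero]⟩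
  smul_mem' := by
    rintro c f ⟨hf, hf0, hf1⟩
    refine ⟨hf.const_smul c, fun t ht => by simp [hf0 t ht], ?_⟩
    rw [eNorm1_smul]
    exact ENNReal.mul_lt_top ENNReal.ofReal_lt_top hf1

/-- The linear space underlying `W_2^{1-α}(0,T)`. -/
def submodule2 (α T : ℝ) : Submodule ℝ (ℝ → ℝ) where
  carrier := {f | Measurable f ∧ (∀ t, t ∉ Icc 0 T → f t = 0) ∧ eNorm2 α T f < ∞}
  add_mem' := by
    rintro f g ⟨hf, hf0, hf1⟩ ⟨hg, hg0, hg1⟩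
    exact ⟨hf.add hg, fun t ht => by simp [hf0 t ht, hg0 t ht],
      (eNorm2_add_le α T hf).trans_lt (ENNReal.add_lt_top.2 ⟨hf1, hg1⟩)⟩
  zero_mem' := ⟨measurable_const, fun _ _ => rfl, by simp [eNorm2_zero]⟩
  smul_mem' := by
    rintro c f ⟨hf, hf0, hf1⟩
    refine ⟨hf.const_smul c, fun t ht => by simp [hf0 t ht], ?_⟩
    rw [eNorm2_smul]
    exact ENNReal.mul_lt_top ENNReal.ofReal_lt_top hf1

/-- `W_1^α(a,b)`: measurable functions `f` on `[a,b]` with `‖f‖_{α,1(a,b)} < ∞`. -/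
def W1 (α a b : ℝ) : Type := submodule1 α a b

/-- `W_2^{1-α}(0,T)`: measurable functions `g` on `[0,T]` with `‖g‖_{1-α,2} < ∞`. -/
def W2 (α T : ℝ) : Type := submodule2 α T

instance (α a b : ℝ) : AddCommGroup (W1 α a b) := inferInstanceAs (AddCommGroup (submodule1 α a b))

instance (α a b : ℝ) : Module ℝ (W1 α a b) := inferInstanceAs (Module ℝ (submodule1 α a b))

instance (α a b : ℝ) : CoeFun (W1 α a b) (fun _ => ℝ → ℝ) := ⟨Subtype.val⟩

instance (α a b : ℝ) : Norm (W1 α a b) := ⟨fun f => (eNorm1 α a b f).toReal⟩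

instance (α T : ℝ) : AddCommGroup (W2 α T) := inferInstanceAs (AddCommGroup (submodule2 α T))

instance (α T : ℝ) : Module ℝ (W2 α T) := inferInstanceAs (Module ℝ (submodule2 α T))

instance (α T : ℝ) : CoeFun (W2 α T) (fun _ => ℝ → ℝ) := ⟨Subtype.val⟩

instance (α T : ℝ) : Norm (W2 α T) := ⟨fun f => (eNorm2 α T f).toReal⟩

lemma core1 (α a b : ℝ) : NormedSpace.Core ℝ (W1 α a b) where
  norm_nonneg f := ENNReal.toReal_nonneg
  norm_smul c f := by
    change (eNorm1 α a b (c • f.1)).toReal = |c| * (eNorm1 α a b f.1).toReal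
    rw [eNorm1_smul, ENNReal.toReal_mul, ENNReal.toReal_ofReal (abs_nonneg c)]
  norm_triangle f g := by
    change (eNorm1 α a b (f.1 + g.1)).toReal
      ≤ (eNorm1 α a b f.1).toReal + (eNorm1 α a b g.1).toReal
    rw [← ENNReal.toReal_add f.2.2.2.ne g.2.2.2.ne]
    exact ENNReal.toReal_mono (ENNReal.add_ne_top.2 ⟨f.2.2.2.ne, g.2.2.2.ne⟩)
      (eNorm1_add_le α a b f.2.1)
  norm_eq_zero_iff f := by
    change (eNorm1 α a b f.1).toReal = 0 ↔ f = 0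
    constructor
    · intro h
      have h0 : eNorm1 α a b f.1 = 0 :=
        ((ENNReal.toReal_eq_zero_iff _).1 h).resolve_right f.2.2.2.ne
      refine Subtype.ext (funext fun t => ?_)
      change f.1 t = 0
      by_cases ht : t ∈ Icc a b
      · simp only [eNorm1, ENNReal.iSup_eq_zero] at h0
        have := (add_eq_zero.1 (h0 t ht)).1
        simpa using this
      · exact f.2.2.1 t ht
    · rintro rfl
      change (eNorm1 α a b 0).toReal = 0
      simp [eNorm1_zero]

lemma core2 (α T : ℝ) : SeminormedSpace.Core ℝ (W2 α T) where
  norm_nonneg f := ENNReal.toReal_nonneg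
  norm_smul c f := by
    change (eNorm2 α T (c • f.1)).toReal = |c| * (eNorm2 α T f.1).toReal
    rw [eNorm2_smul, ENNReal.toReal_mul, ENNReal.toReal_ofReal (abs_nonneg c)]
  norm_triangle f g := by
    change (eNorm2 α T (f.1 + g.1)).toReal
      ≤ (eNorm2 α T f.1).toReal + (eNorm2 α T g.1).toReal
    rw [← ENNReal.toReal_add f.2.2.2.ne g.2.2.2.ne]
    exact ENNReal.toReal_mono (ENNReal.add_ne_top.2 ⟨f.2.2.2.ne, g.2.2.2.ne⟩)
      (eNorm2_add_le α T f.2.1)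

instance (α a b : ℝ) : NormedAddCommGroup (W1 α a b) := NormedAddCommGroup.ofCore (core1 α a b)

instance (α a b : ℝ) : NormedSpace ℝ (W1 α a b) where
  norm_smul_le c f := ((core1 α a b).norm_smul c f).le

instance (α T : ℝ) : SeminormedAddCommGroup (W2 α T) := SeminormedAddCommGroup.ofCore (core2 α T)

instance (α T : ℝ) : NormedSpace ℝ (W2 α T) where
  norm_smul_le c f := ((core2 α T).norm_smul c f).le

/-! ### The generalized Stieltjes integral -/

/-- The left-sided Weyl derivative
`D_{a+}^α f(t) = Γ(1-α)⁻¹ ( f(t)/(t-a)^α + α ∫_a^t (f(t)-f(s))/(t-s)^{α+1} ds )`. -/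
def weylLeft (α a : ℝ) (f : ℝ → ℝ) (t : ℝ) : ℝ :=
  1 / Real.Gamma (1 - α) *
    (f t / (t - a) ^ α + α * ∫ s in a..t, (f t - f s) / (t - s) ^ (α + 1))

/-- The right-sided Weyl derivative without its complex phase: the usual
`D_{b-}^β f(t)` is `(-1)^β` times this number. -/
def weylRight (β b : ℝ) (f : ℝ → ℝ) (t : ℝ) : ℝ :=
  1 / Real.Gamma (1 - β) *
    (f t / (b - t) ^ β + β * ∫ s in t..b, (f t - f s) / (s - t) ^ (β + 1))

/-- The generalized Stieltjes integral
`∫_a^b f dg = (-1)^α ∫_a^b D_{a+}^α f(t) D_{b-}^{1-α} g_{b-}(t) dt`, where `g_{b-} = g - g(b)`.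
The two phases multiply to `(-1)^α (-1)^{1-α} = -1`. The integral is `0` if `b ≤ a`. -/
def gsInt (α a b : ℝ) (f g : ℝ → ℝ) : ℝ :=
  -∫ t in Ioc a b, weylLeft α a f t * weylRight (1 - α) b (fun s => g s - g b) t

/-- `∫_a^b |f(t)|/(t-a)^α dt + ∫_a^b ∫_a^t |f(t)-f(y)|/(t-y)^{α+1} dy dt`, in `[0,∞]`. -/
def gsNorm (α a b : ℝ) (f : ℝ → ℝ) : ℝ≥0∞ :=
  ∫⁻ t in Ioc a b, (ENNReal.ofReal (|f t| / (t - a) ^ α)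
    + ∫⁻ y in Ioc a t, ENNReal.ofReal (|f t - f y| / (t - y) ^ (α + 1)))

/-- `f` is integrable on `(a,b)` in the generalized Stieltjes sense with exponent `α`, against
every integrator in `W_2^{1-α}`. -/
def GSIntegrable (α a b : ℝ) (f : ℝ → ℝ) : Prop :=
  AEMeasurable f (volume.restrict (Ioc a b)) ∧ gsNorm α a b f < ∞

/-! ### Coefficients, the delay equation, kernels -/

/-- The class `C^n_b`: `n` times continuously differentiable with bounded derivatives of the
orders `1, …, n`. -/
def IsCb (n : ℕ) (f : ℝ → ℝ) : Prop :=
  ContDiff ℝ n f ∧ ∀ i, 1 ≤ i → i ≤ n → ∃ C, ∀ x, |iteratedDeriv i f x| ≤ C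

/-- The path `x` on `[-r,T]` solves
`x_t = η_0 + ∫_0^t b(x_s) ds + ∫_0^t σ(y_{s-r}) dg_s` on `[0,T]` and `x_t = η_t` on `[-r,0]`,
where `y` is a given path on `[-r,T-r]`. -/
structure IsDelaySolution (α r T : ℝ) (b σ η y g x : ℝ → ℝ) : Prop where
  initial : ∀ t ∈ Icc (-r) 0, x t = η t
  measurable : AEMeasurable x (volume.restrict (Icc 0 T))
  integrable : IntervalIntegrable (fun s => b (x s)) volume 0 T
  eq : ∀ t ∈ Icc 0 T,
    x t = η 0 + (∫ s in 0..t, b (x s)) + gsInt α 0 t (fun s => σ (y (s - r))) g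

/-- Regularity of a kernel `k s t`, `s ∈ [0,T]`, `t ∈ [-r,T-r]`, vanishing for `s > t`: it is
measurable, the one-variable generalized Stieltjes integrals of all its sections exist, and so
does the double one, absolutely; that is, `t ↦ k(·,t)` has finite `gsNorm` as a function with
values in the space of functions of `s` with norm `gsNorm`. -/
structure IsRegularKernel (α r T : ℝ) (k : ℝ → ℝ → ℝ) : Prop where
  measurable : Measurable (Function.uncurry k)
  vanish : ∀ s ∈ Icc 0 T, ∀ t ∈ Icc (-r) (T - r), t < s → k s t = 0
  section_left : ∀ t ∈ Icc 0 (T - r), GSIntegrable α 0 t (fun s => k s t)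
  section_right : ∀ s ∈ Icc 0 (T - r), GSIntegrable α s (T - r) (fun t => k s t)
  mixed : ∫⁻ t in Ioc 0 (T - r), (gsNorm α 0 T (fun s => k s t) / ENNReal.ofReal (t ^ α)
    + ∫⁻ v in Ioc 0 t, gsNorm α 0 T (fun s => k s t - k s v)
        / ENNReal.ofReal ((t - v) ^ (α + 1))) < ∞

/-- `Φ t s`, `s, t ∈ [0,T]`, solves the linear Volterra equation
`Φ_t(s) = ∫_s^t b'(x_u) Φ_u(s) du + σ(y_{s-r}) + ∫_s^t σ'(y_{u-r}) k(s,u-r) dg_u` for `s ≤ t`,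
and `Φ_t(s) = 0` for `s > t`. -/
structure IsVolterraKernel (α r T : ℝ) (b σ y g x : ℝ → ℝ) (k Φ : ℝ → ℝ → ℝ) : Prop where
  integrable : ∀ s ∈ Icc 0 T, IntervalIntegrable (fun u => Φ u s) volume s T
  eq : ∀ s ∈ Icc 0 T, ∀ t ∈ Icc 0 T, s ≤ t →
    Φ t s = (∫ u in s..t, deriv b (x u) * Φ u s) + σ (y (s - r))
      + gsInt α s t (fun u => deriv σ (y (u - r)) * k s (u - r)) g
  vanish : ∀ s ∈ Icc 0 T, ∀ t ∈ Icc 0 T, t < s → Φ t s = 0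

end FracDelay

end

/-! Extend the integrand `f` by zero to the left of `a` and stop the integrator `g` at time `b`. The
boundary terms of the two Weyl derivatives are then exactly the contributions of `w < a` and of `w >
b`. Up to constants, the left derivative at `s` is therefore the integral of `(f(s)-f(w))
(s-w)^{-α-1}` over all `w < s`, and the right derivative is an integral of the same kind for the
stopped path, bounded by a multiple of `‖g‖`. So `∫_a^b f dg` is the integral of the increments
`f(s)-f(w)` with respect to `incMeasure`, with a bounded weight that depends only on `g` and `b`
(`gsInt_eq_integral`). The absolute integral of the increments, `fracNorm`, is equivalent to
`N_{a,b}`. Linearity, estimates and Fubini theorems become facts about Lebesgue integrals.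

This formula hides locality, because the weight depends on `b`: if `f` vanishes after `u`, then
`∫_a^b f dg = ∫_a^u f dg` (`gsInt_eq_of_vanish`). Locality is visible in another description: the
integral is a constant times the limit of `ε⁻¹ ∫ f(s) (g_b(s+ε) - g_b(s)) ds`, with `g_b` the path
stopped at `b` (`tendsto_forward`). That in turn rests on the inversion of the left derivative by a
Riemann–Liouville integral (`rlInt_ae_eq`) and on a formula for averages of the right derivative
(`integral_rightDer_interval`). The constant `profileConst` is never evaluated; not even its being
nonzero matters.

Locality gives additivity over intervals, hence Hölder continuity of order `1-α` of the indefinite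
integral. As `1-α > α`, integration is a bounded bilinear map `W_1^α × W_2^{1-α} → W_1^α` (`intOp`).
Superposition with a `C²` function is Fréchet differentiable on `W_1^α` (`hasFDerivAt_nem`), so by
the chain rule the driving term `∫_0^· σ(x̄_{s-r}) dg_s` is differentiable in `g`, with some
derivative `q` in the direction `h`. The solution of `X = c + ∫ b(X) + p` depends on the path `p`
through the operator `1 + volt`, up to a quadratic error controlled by Grönwall's inequality
(`solution_expansion`). Thus `D_h x = q + volt β q` with `β = b'(x)`.

The kernel is built in the same way: for fixed `s` let `Φ(s) = source + volt β source` in the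
variable `t` (`resolv`); uniqueness is Grönwall's inequality again. It remains to integrate against
`h`. As `volt` is an ordinary integral in time, it commutes with `∫ … dh` (`incInt_integral`), so it
suffices that `∫ source dh = q` (`incInt_source`). There the double integral of `σ'(x̄_{u-r}) D_s
x̄_{u-r}` is exchanged by Fubini on the product of two increment measures, where absolute
convergence is the mixed condition on the kernel, and the inner integral becomes `D_h x̄_{u-r}` by
locality and by the assumption on `h`. -/

noncomputable section

namespace FracDelay

/-! ### The fractional kernel and the increment measure -/

/-- The kernel `x ↦ x^{-α-1}` on the positive half-line, extended by zero. -/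
def fracKer (α x : ℝ) : ℝ := if 0 < x then (x ^ (α + 1))⁻¹ else 0

lemma fracKer_nonneg (α x : ℝ) : 0 ≤ fracKer α x := by
  unfold fracKer; split_ifs with h <;> positivity

lemma fracKer_of_pos {α x : ℝ} (h : 0 < x) : fracKer α x = (x ^ (α + 1))⁻¹ := if_pos h

lemma fracKer_of_nonpos {α x : ℝ} (h : x ≤ 0) : fracKer α x = 0 := if_neg h.not_gt

@[fun_prop]
lemma measurable_fracKer (α : ℝ) : Measurable (fracKer α) :=
  Measurable.ite measurableSet_Ioi (by fun_prop) measurable_const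

lemma integrableOn_fracKer_Ioi {α c : ℝ} (hα : 0 < α) (hc : 0 < c) :
    IntegrableOn (fracKer α) (Ioi c) := by
  refine (integrableOn_Ioi_rpow_of_lt (a := -(α + 1)) (by linarith) hc).congr_fun
    (fun x hx => ?_) measurableSet_Ioi
  have : 0 < x := hc.trans hx
  simp only [fracKer_of_pos this, Real.rpow_neg this.le]

lemma integral_fracKer_Ioi {α c : ℝ} (hα : 0 < α) (hc : 0 < c) :
    ∫ x in Ioi c, fracKer α x = (c ^ α)⁻¹ / α := by
  have h := integral_Ioi_rpow_of_lt (a := -(α + 1)) (by linarith) hc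
  rw [setIntegral_congr_fun (g := fun x => x ^ (-(α + 1))) measurableSet_Ioi, h]
  · rw [show -(α + 1) + 1 = -α by ring, Real.rpow_neg hc.le, neg_div_neg_eq]
  · intro x hx
    have : 0 < x := hc.trans hx
    simp only [fracKer_of_pos this, Real.rpow_neg this.le]

lemma lintegral_fracKer_Ioi {α c : ℝ} (hα : 0 < α) (hc : 0 < c) :
    ∫⁻ x in Ioi c, ENNReal.ofReal (fracKer α x) = ENNReal.ofReal ((c ^ α)⁻¹ / α) := by
  rw [← integral_fracKer_Ioi hα hc, ofReal_integral_eq_lintegral_ofReal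
    (integrableOn_fracKer_Ioi hα hc) (ae_of_all _ fun x => fracKer_nonneg α x)]

lemma lintegral_fracKer_Ioi_sub {α y b : ℝ} (hα : 0 < α) (h : y < b) :
    ∫⁻ w in Ioi b, ENNReal.ofReal (fracKer α (w - y)) = ENNReal.ofReal (((b - y) ^ α)⁻¹ / α) := by
  rw [← lintegral_fracKer_Ioi hα (sub_pos.2 h), ← lintegral_indicator measurableSet_Ioi,
    ← lintegral_indicator measurableSet_Ioi,
    ← lintegral_sub_right_eq_self ((Ioi (b - y)).indicator _) y]
  refine lintegral_congr fun w => ?_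
  simp [indicator]

lemma lintegral_fracKer_Iio {α s c : ℝ} (hα : 0 < α) (h : c < s) :
    ∫⁻ w in Iio c, ENNReal.ofReal (fracKer α (s - w)) = ENNReal.ofReal (((s - c) ^ α)⁻¹ / α) := by
  rw [← lintegral_fracKer_Ioi hα (sub_pos.2 h), ← lintegral_indicator measurableSet_Ioi,
    ← lintegral_indicator measurableSet_Iio,
    ← lintegral_sub_left_eq_self ((Ioi (s - c)).indicator _) s]
  refine lintegral_congr fun w => ?_
  simp [indicator]

lemma integral_fracKer_Iio {α s c : ℝ} (hα : 0 < α) (h : c < s) :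
    ∫ w in Iio c, fracKer α (s - w) = ((s - c) ^ α)⁻¹ / α := by
  rw [integral_eq_lintegral_of_nonneg_ae (ae_of_all _ fun x => fracKer_nonneg α _)
    (Measurable.aestronglyMeasurable (by fun_prop)), lintegral_fracKer_Iio hα h,
    ENNReal.toReal_ofReal]
  have := sub_pos.2 h
  positivity

lemma integral_fracKer_Ioi_sub {α y b : ℝ} (hα : 0 < α) (h : y < b) :
    ∫ w in Ioi b, fracKer α (w - y) = ((b - y) ^ α)⁻¹ / α := by
  rw [integral_eq_lintegral_of_nonneg_ae (ae_of_all _ fun x => fracKer_nonneg α _)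
    (Measurable.aestronglyMeasurable (by fun_prop)), lintegral_fracKer_Ioi_sub hα h,
    ENNReal.toReal_ofReal]
  have := sub_pos.2 h
  positivity

/-- Passes from the quotients in the definitions of the norms to the kernel. On the diagonal `d = 0`
the two sides agree only because the increment vanishes there. -/
lemma ofReal_div_rpow_eq {α : ℝ} (x d : ℝ) (hd : 0 ≤ d) (hx : d = 0 → x = 0) :
    ENNReal.ofReal (|x| / d ^ (α + 1)) = ‖x‖ₑ * ENNReal.ofReal (fracKer α d) := by
  rcases hd.eq_or_lt with rfl | hd
  · simp [hx rfl]
  · rw [fracKer_of_pos hd, div_eq_mul_inv, ENNReal.ofReal_mul (abs_nonneg x),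
      Real.enorm_eq_ofReal_abs]

/-- The measure on the plane with density `(s-w)^{-α-1}` on `{w < s ≤ b}`. -/
def incMeasure (α b : ℝ) : Measure (ℝ × ℝ) :=
  ((volume.restrict (Iic b)).prod volume).withDensity
    fun p => ENNReal.ofReal (fracKer α (p.1 - p.2))

instance (α b : ℝ) : SigmaFinite (incMeasure α b) := by
  unfold incMeasure; infer_instance

lemma lintegral_incMeasure (α b : ℝ) {F : ℝ × ℝ → ℝ≥0∞} (hF : Measurable F) :
    ∫⁻ p, F p ∂incMeasure α b
      = ∫⁻ s in Iic b, ∫⁻ w, F (s, w) * ENNReal.ofReal (fracKer α (s - w)) := by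
  rw [incMeasure, lintegral_withDensity_eq_lintegral_mul _ (by fun_prop) hF, lintegral_prod _
    (by fun_prop)]
  simp [mul_comm]

lemma integrable_incMeasure_iff (α b : ℝ) {F : ℝ × ℝ → ℝ} :
    Integrable F (incMeasure α b) ↔ Integrable (fun p => F p * fracKer α (p.1 - p.2))
      ((volume.restrict (Iic b)).prod volume) := by
  rw [incMeasure, integrable_withDensity_iff_integrable_smul' (by fun_prop) (by simp)]
  simp [ENNReal.toReal_ofReal (fracKer_nonneg _ _), mul_comm]

lemma integral_incMeasure (α b : ℝ) {F : ℝ × ℝ → ℝ} (hF : Integrable F (incMeasure α b)) :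
    ∫ p, F p ∂incMeasure α b = ∫ s in Iic b, ∫ w, F (s, w) * fracKer α (s - w) := by
  have h := (integrable_incMeasure_iff α b).1 hF
  rw [incMeasure, integral_withDensity_eq_integral_toReal_smul (by fun_prop) (by simp),
    ← integral_prod _ h]
  simp [ENNReal.toReal_ofReal (fracKer_nonneg _ _), mul_comm]

/-- Lets integrals up to different times be compared on the single measure with endpoint `T`. -/
lemma incMeasure_restrict (α : ℝ) {b c : ℝ} (h : b ≤ c) :
    incMeasure α b = (incMeasure α c).restrict {p | p.1 ≤ b} := by
  have h1 : (volume.restrict (Iic b) : Measure ℝ).prod (volume : Measure ℝ)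
      = ((volume.restrict (Iic c)).prod volume).restrict {p : ℝ × ℝ | p.1 ≤ b} := by
    have : {p : ℝ × ℝ | p.1 ≤ b} = Iic b ×ˢ univ := by ext; simp
    rw [this, ← Measure.prod_restrict, Measure.restrict_restrict measurableSet_Iic,
      Measure.restrict_univ, Iic_inter_Iic, inf_of_le_left h]
  rw [incMeasure, h1, incMeasure, ← restrict_withDensity]
  exact measurableSet_le measurable_fst measurable_const

lemma ae_incMeasure_lt (α b : ℝ) : ∀ᵐ p ∂incMeasure α b, p.2 < p.1 := by
  rw [incMeasure, ae_withDensity_iff (by fun_prop)]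
  refine ae_of_all _ fun p hp => ?_
  by_contra hlt
  exact hp (by rw [fracKer_of_nonpos (by linarith)]; simp)

lemma incMeasure_absolutelyContinuous (α b : ℝ) :
    incMeasure α b ≪ (volume : Measure ℝ).prod volume :=
  (withDensity_absolutelyContinuous _ _).trans
    (Measure.AbsolutelyContinuous.prod Measure.restrict_le_self.absolutelyContinuous
      Measure.AbsolutelyContinuous.rfl)

lemma ae_incMeasure_fst {α b : ℝ} {P : ℝ → Prop} (h : ∀ᵐ s, P s) :
    ∀ᵐ p ∂incMeasure α b, P p.1 :=
  incMeasure_absolutelyContinuous α b (Measure.quasiMeasurePreserving_fst.ae h)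

lemma ae_incMeasure_snd {α b : ℝ} {P : ℝ → Prop} (h : ∀ᵐ s, P s) :
    ∀ᵐ p ∂incMeasure α b, P p.2 :=
  incMeasure_absolutelyContinuous α b (Measure.quasiMeasurePreserving_snd.ae h)

/-- Below `a` the integrand is a constant times the kernel, whose mass on `(-∞,a)` is
`(s-a)^{-α}/α`. This is how the boundary term of the Weyl derivative arises. -/
lemma lintegral_mul_fracKer_split {α a s : ℝ} (hα : 0 < α) (has : a < s) {z : ℝ → ℝ≥0∞}
    {A : ℝ≥0∞} (hA : ∀ w ≤ a, z w = A) :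
    ∫⁻ w, z w * ENNReal.ofReal (fracKer α (s - w))
      = A * ENNReal.ofReal (((s - a) ^ α)⁻¹ / α)
        + ∫⁻ w in Ioc a s, z w * ENNReal.ofReal (fracKer α (s - w)) := by
  rw [← lintegral_add_compl _ (measurableSet_Iic (a := a)), compl_Iic]
  congr 1
  · rw [setLIntegral_congr_fun (g := fun w => A * ENNReal.ofReal (fracKer α (s - w)))
      measurableSet_Iic fun w hw => by simp only [hA w hw],
      lintegral_const_mul _ (by fun_prop), setLIntegral_congr Iio_ae_eq_Iic.symm,
      lintegral_fracKer_Iio hα has]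
  · rw [← lintegral_indicator measurableSet_Ioi, ← lintegral_indicator measurableSet_Ioc]
    refine lintegral_congr fun w => ?_
    by_cases h1 : a < w <;> by_cases h2 : w ≤ s <;> simp [indicator, h1, h2]
    rw [fracKer_of_nonpos (by linarith)]; simp

/-- `Z` need not be the size of an increment of a scalar function: it will also be the seminorm of
an increment of a function-valued path, which is the form of the mixed condition on the kernel. -/
lemma lintegral_incMeasure_split {α a b : ℝ} (hα : 0 < α) {Z : ℝ × ℝ → ℝ≥0∞} (hZ : Measurable Z)
    {A : ℝ → ℝ≥0∞} (h0 : ∀ s ≤ a, ∀ w < s, Z (s, w) = 0) (hA : ∀ s > a, ∀ w ≤ a, Z (s, w) = A s) :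
    ∫⁻ p, Z p ∂incMeasure α b = ∫⁻ s in Ioc a b, (A s * ENNReal.ofReal (((s - a) ^ α)⁻¹ / α)
        + ∫⁻ w in Ioc a s, Z (s, w) * ENNReal.ofReal (fracKer α (s - w))) := by
  rw [lintegral_incMeasure α b hZ, ← lintegral_indicator measurableSet_Iic,
    ← lintegral_indicator measurableSet_Ioc]
  refine lintegral_congr fun s => ?_
  by_cases h1 : a < s <;> by_cases h2 : s ≤ b <;> simp only [indicator, mem_Ioc, mem_Iic, h1, h2,
    and_self, and_true, and_false, if_true, if_false]
  · exact lintegral_mul_fracKer_split hα h1 (hA s h1)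
  · rw [lintegral_eq_zero_iff' (by fun_prop)]
    refine ae_of_all _ fun w => ?_
    simp only [Pi.zero_apply, mul_eq_zero]
    by_cases hw : w < s
    · exact Or.inl (h0 s (not_lt.1 h1) w hw)
    · right; rw [fracKer_of_nonpos (by linarith)]; simp

/-! ### Comparison of the fractional seminorm with `N_{a,b}` -/

/-- The fractional seminorm `∫_{w<s≤b} |f(s)-f(w)| (s-w)^{-α-1}` of a function on the line. -/
def fracNorm (α b : ℝ) (f : ℝ → ℝ) : ℝ≥0∞ := ∫⁻ p, ‖f p.1 - f p.2‖ₑ ∂incMeasure α b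

lemma fracNorm_eq {α a b : ℝ} (hα : 0 < α) {f : ℝ → ℝ} (hf : Measurable f)
    (h0 : ∀ s ≤ a, f s = 0) :
    fracNorm α b f = ∫⁻ s in Ioc a b, (ENNReal.ofReal (|f s| / (s - a) ^ α) * ENNReal.ofReal α⁻¹
      + ∫⁻ y in Ioc a s, ENNReal.ofReal (|f s - f y| / (s - y) ^ (α + 1))) := by
  rw [fracNorm, lintegral_incMeasure_split (a := a) (A := fun s => ‖f s‖ₑ) hα (by fun_prop)]
  · refine setLIntegral_congr_fun measurableSet_Ioc fun s hs => ?_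
    have hsa : 0 < s - a := sub_pos.2 hs.1
    congr 1
    · rw [Real.enorm_eq_ofReal_abs, ← ENNReal.ofReal_mul (abs_nonneg _),
        ← ENNReal.ofReal_mul (by positivity)]
      congr 1
      field_simp
    · refine setLIntegral_congr_fun measurableSet_Ioc fun y hy => ?_
      rw [← ofReal_div_rpow_eq _ _ (sub_nonneg.2 hy.2)]
      intro h
      rw [show s = y by linarith]; simp
  · intro s hs w hw
    simp [h0 s hs, h0 w (hw.le.trans hs)]
  · intro s _ w hw
    simp [h0 w hw]

/-- For functions vanishing up to `a` the two quantities differ only by the factor `α⁻¹ ≥ 1` in the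
boundary term. -/
lemma gsNorm_le_fracNorm {α a b : ℝ} (hα : 0 < α) (hα1 : α < 1) {f : ℝ → ℝ} (hf : Measurable f)
    (h0 : ∀ s ≤ a, f s = 0) : gsNorm α a b f ≤ fracNorm α b f := by
  rw [fracNorm_eq hα hf h0, gsNorm]
  refine lintegral_mono fun s => add_le_add ?_ le_rfl
  refine le_mul_of_one_le_right' ?_
  rw [ENNReal.one_le_ofReal]
  exact (one_le_inv₀ hα).2 hα1.le

lemma fracNorm_le_gsNorm {α a b : ℝ} (hα : 0 < α) (hα1 : α < 1) {f : ℝ → ℝ} (hf : Measurable f)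
    (h0 : ∀ s ≤ a, f s = 0) : fracNorm α b f ≤ ENNReal.ofReal α⁻¹ * gsNorm α a b f := by
  rw [fracNorm_eq hα hf h0, gsNorm, ← lintegral_const_mul' _ _ ENNReal.ofReal_ne_top]
  refine lintegral_mono fun s => ?_
  rw [mul_add, mul_comm (ENNReal.ofReal α⁻¹)]
  refine add_le_add le_rfl ?_
  refine le_mul_of_one_le_left' ?_
  rw [ENNReal.one_le_ofReal]
  exact (one_le_inv₀ hα).2 hα1.le

lemma gsNorm_congr {α a b : ℝ} {f f' : ℝ → ℝ} (h : EqOn f f' (Ioc a b)) :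
    gsNorm α a b f = gsNorm α a b f' := by
  refine setLIntegral_congr_fun measurableSet_Ioc fun t ht => ?_
  simp only [h ht]
  congr 1
  refine setLIntegral_congr_fun measurableSet_Ioc fun y hy => ?_
  simp only [h ⟨hy.1, hy.2.trans ht.2⟩]

lemma gsInt_congr {α a b : ℝ} {f f' g : ℝ → ℝ} (h : EqOn f f' (Ioc a b)) :
    gsInt α a b f g = gsInt α a b f' g := by
  rw [gsInt, gsInt]
  congr 1
  refine setIntegral_congr_fun measurableSet_Ioc fun t ht => ?_
  congr 1
  rw [weylLeft, weylLeft, h ht, intervalIntegral.integral_of_le ht.1.le,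
    intervalIntegral.integral_of_le ht.1.le]
  congr 3
  refine setIntegral_congr_fun measurableSet_Ioc fun y hy => ?_
  simp only [h ⟨hy.1, hy.2.trans ht.2⟩]

lemma gsInt_of_le {α a b : ℝ} (h : b ≤ a) (f g : ℝ → ℝ) : gsInt α a b f g = 0 := by
  simp [gsInt, Ioc_eq_empty_of_le h]

/-! ### Weyl derivatives as integrals over half-lines -/

/-- `∫_{w<s} (f(s)-f(w)) (s-w)^{-α-1} dw`. -/
def leftDer (α : ℝ) (f : ℝ → ℝ) (s : ℝ) : ℝ := ∫ w, (f s - f w) * fracKer α (s - w)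

/-- `∫_{w>y} (g(y)-g(w)) (w-y)^{-β-1} dw`. -/
def rightDer (β : ℝ) (g : ℝ → ℝ) (y : ℝ) : ℝ := ∫ w, (g y - g w) * fracKer β (w - y)

/-- The path `g` stopped at time `b`. -/
def stopAt (g : ℝ → ℝ) (b s : ℝ) : ℝ := g (min s b)

/-- Since `f` is zero up to `a`, the part `w ≤ a` contributes `f(s) (s-a)^{-α}/α`, the boundary
term. The integrability `hi` is what permits splitting the half-line at `a`. -/
lemma weylLeft_eq {α a s : ℝ} (hα : 0 < α) (has : a < s) {f : ℝ → ℝ} (h0 : ∀ x ≤ a, f x = 0)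
    (hi : Integrable fun w => (f s - f w) * fracKer α (s - w)) :
    weylLeft α a f s = α / Real.Gamma (1 - α) * leftDer α f s := by
  have h1 : ∫ w in Iic a, (f s - f w) * fracKer α (s - w) = f s * (((s - a) ^ α)⁻¹ / α) := by
    rw [setIntegral_congr_fun (g := fun w => f s * fracKer α (s - w)) measurableSet_Iic
      fun w hw => by simp only [h0 w hw, sub_zero], integral_const_mul,
      setIntegral_congr_set Iio_ae_eq_Iic.symm, integral_fracKer_Iio hα has]
  have h2 : ∫ w in Ioi a, (f s - f w) * fracKer α (s - w)
      = ∫ w in a..s, (f s - f w) / (s - w) ^ (α + 1) := by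
    rw [intervalIntegral.integral_of_le has.le, ← integral_indicator measurableSet_Ioi,
      ← integral_indicator measurableSet_Ioc]
    refine integral_congr_ae (ae_of_all _ fun w => ?_)
    rcases lt_trichotomy w s with h | h | h
    · by_cases h1 : a < w <;> simp [indicator, h1, h.le, fracKer_of_pos (sub_pos.2 h),
        div_eq_mul_inv]
    · simp [indicator, h]
    · simp [indicator, h.not_ge, fracKer_of_nonpos (sub_nonpos.2 h.le)]
  rw [weylLeft, leftDer, ← integral_add_compl measurableSet_Iic hi, compl_Iic, h1, h2]
  field_simp

/-- For `w > b` the increment of the stopped path is constantly `g(y) - g(b)`, which yields the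
boundary term of `g_{b-}`. -/
lemma weylRight_eq {β y b : ℝ} (hβ : 0 < β) (hyb : y < b) {g : ℝ → ℝ}
    (hi : Integrable fun w => (stopAt g b y - stopAt g b w) * fracKer β (w - y)) :
    weylRight β b (fun s => g s - g b) y
      = β / Real.Gamma (1 - β) * rightDer β (stopAt g b) y := by
  have h1 : ∫ w in Ioi b, (stopAt g b y - stopAt g b w) * fracKer β (w - y)
      = (g y - g b) * (((b - y) ^ β)⁻¹ / β) := by
    rw [setIntegral_congr_fun (g := fun w => (g y - g b) * fracKer β (w - y)) measurableSet_Ioi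
      fun w hw => by simp only [stopAt, min_eq_right (le_of_lt (mem_Ioi.1 hw)), min_eq_left hyb.le],
      integral_const_mul, integral_fracKer_Ioi_sub hβ hyb]
  have h2 : ∫ w in Iic b, (stopAt g b y - stopAt g b w) * fracKer β (w - y)
      = ∫ w in y..b, (g y - g b - (g w - g b)) / (w - y) ^ (β + 1) := by
    rw [intervalIntegral.integral_of_le hyb.le, ← integral_indicator measurableSet_Iic,
      ← integral_indicator measurableSet_Ioc]
    refine integral_congr_ae (ae_of_all _ fun w => ?_)
    by_cases hw : y < w <;> by_cases hb : w ≤ b <;> simp [indicator, hw, hb, stopAt, hyb.le]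
    · rw [fracKer_of_pos (sub_pos.2 hw), div_eq_mul_inv]
    · right; exact fracKer_of_nonpos (by linarith)
  rw [weylRight, rightDer, ← integral_add_compl measurableSet_Iic hi, compl_Iic, h1, h2]
  field_simp
  ring

/-! ### Bounds for the integrator -/

lemma W2.measurable {α T : ℝ} (g : W2 α T) : Measurable g := g.2.1

lemma W2.eNorm2_eq {α T : ℝ} (g : W2 α T) : eNorm2 α T g = ENNReal.ofReal ‖g‖ :=
  (ENNReal.ofReal_toReal g.2.2.2.ne).symm

lemma W2.le_norm {α T : ℝ} (g : W2 α T) {u v : ℝ} (hu : 0 ≤ u) (huv : u < v) (hv : v ≤ T) :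
    ENNReal.ofReal (|g v - g u| / |v - u| ^ (1 - α))
    + ∫⁻ y in Ioc u v, ENNReal.ofReal (|g y - g u| / (y - u) ^ (2 - α)) ≤ ENNReal.ofReal ‖g‖ := by
  rw [← g.eNorm2_eq]
  exact le_trans (le_iSup₂ (f := fun v (_ : v ∈ Ioc u T) =>
      (ENNReal.ofReal (|g v - g u| / |v - u| ^ (1 - α))
      + ∫⁻ y in Ioc u v, ENNReal.ofReal (|g y - g u| / (y - u) ^ (2 - α)))) v ⟨huv, hv⟩)
      (le_iSup₂ (f := fun u (_ : u ∈ Icc (0 : ℝ) T) => ⨆ v ∈ Ioc u T,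
      (ENNReal.ofReal (|g v - g u| / |v - u| ^ (1 - α))
      + ∫⁻ y in Ioc u v, ENNReal.ofReal (|g y - g u| / (y - u) ^ (2 - α)))) u
        ⟨hu, huv.le.trans hv⟩)

lemma W2.abs_sub_le {α T : ℝ} (g : W2 α T) {u v : ℝ} (hu : 0 ≤ u) (huv : u ≤ v) (hv : v ≤ T) :
    |g v - g u| ≤ ‖g‖ * (v - u) ^ (1 - α) := by
  rcases huv.eq_or_lt with rfl | huv
  · simp only [sub_self, abs_zero]
    exact mul_nonneg (norm_nonneg _) (Real.rpow_nonneg le_rfl _)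
  · have h := (le_trans le_self_add (g.le_norm hu huv hv))
    rw [ENNReal.ofReal_le_ofReal_iff (norm_nonneg _), abs_of_pos (sub_pos.2 huv)] at h
    have : 0 < (v - u) ^ (1 - α) := Real.rpow_pos_of_pos (sub_pos.2 huv) _
    rwa [div_le_iff₀ this] at h

/-- The part `w ≤ b` is the integral term of the norm of `g`, and the part `w > b` is `(1-α)⁻¹`
times its Hölder quotient. Both belong to the same pair `(y,b)`, so their sum costs only one
`‖g‖/(1-α)`. -/
lemma lintegral_rightDer_le {α T : ℝ} (hα : 0 < α) (hα1 : α < 1) (g : W2 α T) {y b : ℝ}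
    (hy : 0 ≤ y) (hyb : y < b) (hb : b ≤ T) :
    ∫⁻ w, ‖(stopAt g b y - stopAt g b w) * fracKer (1 - α) (w - y)‖ₑ
      ≤ ENNReal.ofReal (‖g‖ / (1 - α)) := by
  have hβ : 0 < 1 - α := by linarith
  have hyb' := sub_pos.2 hyb
  have e : ∀ w, ‖(stopAt g b y - stopAt g b w) * fracKer (1 - α) (w - y)‖ₑ
      = ‖stopAt g b y - stopAt g b w‖ₑ * ENNReal.ofReal (fracKer (1 - α) (w - y)) := fun w => by
    rw [enorm_mul, Real.enorm_eq_ofReal_abs (fracKer _ _), abs_of_nonneg (fracKer_nonneg _ _)]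
  simp only [e]
  have h1 : ∫⁻ w in Ioi b, ‖stopAt g b y - stopAt g b w‖ₑ * ENNReal.ofReal (fracKer (1 - α) (w - y))
      = ENNReal.ofReal (|g b - g y| / |b - y| ^ (1 - α)) * ENNReal.ofReal (1 - α)⁻¹ := by
    rw [setLIntegral_congr_fun (g := fun w => ‖g y - g b‖ₑ
        * ENNReal.ofReal (fracKer (1 - α) (w - y))) measurableSet_Ioi
      fun w hw => by simp only [stopAt, min_eq_right (le_of_lt (mem_Ioi.1 hw)), min_eq_left hyb.le],
      lintegral_const_mul _ (by fun_prop), lintegral_fracKer_Ioi_sub hβ hyb,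
      Real.enorm_eq_ofReal_abs, ← ENNReal.ofReal_mul (by positivity),
      ← ENNReal.ofReal_mul (by positivity), abs_sub_comm, abs_of_pos hyb']
    congr 1
    field_simp
  have h2 : ∫⁻ w in Iic b, ‖stopAt g b y - stopAt g b w‖ₑ * ENNReal.ofReal (fracKer (1 - α) (w - y))
      = ∫⁻ w in Ioc y b, ENNReal.ofReal (|g w - g y| / (w - y) ^ (2 - α)) := by
    rw [← lintegral_indicator measurableSet_Iic, ← lintegral_indicator measurableSet_Ioc]
    refine lintegral_congr fun w => ?_
    by_cases hw : y < w <;> by_cases hb : w ≤ b <;> simp only [indicator, mem_Ioc, mem_Iic, hw, hb,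
      and_self, and_true, and_false, if_true, if_false]
    · rw [show 2 - α = (1 - α) + 1 by ring, ofReal_div_rpow_eq _ _ (sub_pos.2 hw).le
        (fun h => absurd h (sub_pos.2 hw).ne')]
      simp only [stopAt, min_eq_left hb, min_eq_left hyb.le]
      rw [← enorm_neg, neg_sub]
    · rw [fracKer_of_nonpos (by linarith)]; simp
  rw [← lintegral_add_compl _ (measurableSet_Iic (a := b)), compl_Iic, h1, h2, div_eq_mul_inv ‖g‖,
    ENNReal.ofReal_mul (norm_nonneg g)]
  have h3 : (1 : ℝ≥0∞) ≤ ENNReal.ofReal (1 - α)⁻¹ := by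
    rw [ENNReal.one_le_ofReal]
    exact (one_le_inv₀ hβ).2 (by linarith)
  calc _ ≤ (∫⁻ w in Ioc y b, ENNReal.ofReal (|g w - g y| / (w - y) ^ (2 - α)))
        * ENNReal.ofReal (1 - α)⁻¹
      + ENNReal.ofReal (|g b - g y| / |b - y| ^ (1 - α)) * ENNReal.ofReal (1 - α)⁻¹ :=
        add_le_add (le_mul_of_one_le_right' h3) le_rfl
    _ ≤ _ := by
      rw [← add_mul, add_comm]
      gcongr
      exact g.le_norm hy hyb hb

@[fun_prop]
lemma measurable_stop {g : ℝ → ℝ} (hg : Measurable g) (b : ℝ) : Measurable (stopAt g b) := by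
  unfold stopAt; fun_prop

lemma integrable_rightDer {α T : ℝ} (hα : 0 < α) (hα1 : α < 1) (g : W2 α T) {y b : ℝ}
    (hy : 0 ≤ y) (hyb : y < b) (hb : b ≤ T) :
    Integrable fun w => (stopAt g b y - stopAt g b w) * fracKer (1 - α) (w - y) := by
  have := g.measurable
  exact ⟨by fun_prop, (lintegral_rightDer_le hα hα1 g hy hyb hb).trans_lt ENNReal.ofReal_lt_top⟩

lemma abs_rightDer_le {α T : ℝ} (hα : 0 < α) (hα1 : α < 1) (g : W2 α T) {y b : ℝ}
    (hy : 0 ≤ y) (hyb : y < b) (hb : b ≤ T) :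
    |rightDer (1 - α) (stopAt g b) y| ≤ ‖g‖ / (1 - α) := by
  have hβ : 0 < 1 - α := by linarith
  have h := (enorm_integral_le_lintegral_enorm _).trans (lintegral_rightDer_le hα hα1 g hy hyb hb)
  rw [Real.enorm_eq_ofReal_abs, ENNReal.ofReal_le_ofReal_iff (by positivity)] at h
  exact h

lemma rightDer_stop_of_le {β y b : ℝ} (g : ℝ → ℝ) (h : b ≤ y) : rightDer β (stopAt g b) y = 0 := by
  rw [rightDer, ← integral_zero ℝ ℝ]
  refine integral_congr_ae (ae_of_all _ fun w => ?_)
  rcases le_or_gt w y with hw | hw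
  · simp [fracKer_of_nonpos (sub_nonpos.2 hw)]
  · simp [stopAt, h, h.trans hw.le]

/-! ### The weight of the integrator and the representation of the integral -/

/-- The density, with respect to the increment measure, of the generalized Stieltjes integral
against `g` up to time `b`. -/
def gsWeight (α : ℝ) (g : ℝ → ℝ) (b s : ℝ) : ℝ :=
  (Ioo 0 b).indicator (fun s => -(α / Real.Gamma (1 - α) * ((1 - α) / Real.Gamma α))
    * rightDer (1 - α) (stopAt g b) s) s

/-- The constant in the bounds for generalized Stieltjes integrals. -/
def gsConst (α : ℝ) : ℝ := α / Real.Gamma (1 - α) / Real.Gamma α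

lemma gsConst_pos {α : ℝ} (hα : 0 < α) (hα1 : α < 1) : 0 < gsConst α := by
  have := Real.Gamma_pos_of_pos hα
  have := Real.Gamma_pos_of_pos (sub_pos.2 hα1)
  unfold gsConst; positivity

lemma abs_gsWeight_le {α T : ℝ} (hα : 0 < α) (hα1 : α < 1) (g : W2 α T) {b : ℝ} (hb : b ≤ T)
    (s : ℝ) : |gsWeight α g b s| ≤ gsConst α * ‖g‖ := by
  have hc := gsConst_pos hα hα1
  have h1 := Real.Gamma_pos_of_pos hα
  have h2 := Real.Gamma_pos_of_pos (sub_pos.2 hα1)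
  have h3 : 0 < 1 - α := sub_pos.2 hα1
  unfold gsWeight indicator
  split_ifs with hs
  · rw [abs_mul, abs_neg, abs_of_pos (by positivity)]
    refine (mul_le_mul_of_nonneg_left (abs_rightDer_le hα hα1 g hs.1.le hs.2 hb)
      (by positivity)).trans (le_of_eq ?_)
    -- The factor `1-α` in the weight cancels the `(1-α)⁻¹` of the bound for the right derivative.
    unfold gsConst
    field_simp
  · rw [abs_zero]; positivity

/-- Joint measurability in the stopping time is needed later, where integrals with variable upper
limit are integrated in that limit. -/
lemma measurable_rightDer_stop {β : ℝ} {g : ℝ → ℝ} (hg : Measurable g) :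
    Measurable (fun q : ℝ × ℝ => rightDer β (stopAt g q.1) q.2) := by
  have : StronglyMeasurable (Function.uncurry fun (q : ℝ × ℝ) (w : ℝ) =>
      (stopAt g q.1 q.2 - stopAt g q.1 w) * fracKer β (w - q.2)) := by
    apply Measurable.stronglyMeasurable
    unfold stopAt
    fun_prop
  exact this.integral_prod_right.measurable

lemma measurable_gsWeight_uncurry {α : ℝ} {g : ℝ → ℝ} (hg : Measurable g) :
    Measurable (fun q : ℝ × ℝ => gsWeight α g q.1 q.2) := by
  have : (fun q : ℝ × ℝ => gsWeight α g q.1 q.2) = {q : ℝ × ℝ | 0 < q.2 ∧ q.2 < q.1}.indicator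
      (fun q => -(α / Real.Gamma (1 - α) * ((1 - α) / Real.Gamma α))
        * rightDer (1 - α) (stopAt g q.1) q.2) := by
    ext q; simp [gsWeight, indicator]
  rw [this]
  refine ((measurable_rightDer_stop hg).const_mul _).indicator ?_
  exact (measurableSet_lt measurable_const measurable_snd).inter
    (measurableSet_lt measurable_snd measurable_fst)

@[fun_prop]
lemma measurable_gsWeight {α : ℝ} {g : ℝ → ℝ} (hg : Measurable g) (b : ℝ) :
    Measurable (gsWeight α g b) :=
  (measurable_gsWeight_uncurry hg).comp (measurable_const.prodMk measurable_id)

lemma integrable_inc {α b : ℝ} {f : ℝ → ℝ} (hf : Measurable f) (hN : fracNorm α b f < ∞) :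
    Integrable (fun p : ℝ × ℝ => f p.1 - f p.2) (incMeasure α b) :=
  ⟨by fun_prop, hN⟩

lemma integrable_inc_mul_gsWeight {α T c : ℝ} (hα : 0 < α) (hα1 : α < 1) (g : W2 α T) {b : ℝ}
    (hb : b ≤ T) {F : ℝ × ℝ → ℝ} (hF : Integrable F (incMeasure α c)) :
    Integrable (fun p : ℝ × ℝ => F p * gsWeight α g b p.1) (incMeasure α c) := by
  have := g.measurable
  exact hF.mul_bdd (c := gsConst α * ‖g‖) (Measurable.aestronglyMeasurable (by fun_prop))
    (ae_of_all _ fun p => abs_gsWeight_le hα hα1 g hb p.1)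

/-- Representation of the generalized Stieltjes integral over the increment measure. -/
lemma gsInt_eq_integral {α T : ℝ} (hα : 0 < α) (hα1 : α < 1) (g : W2 α T) {a b : ℝ} (ha : 0 ≤ a)
    (hb : b ≤ T) {f : ℝ → ℝ} (hf : Measurable f) (h0 : ∀ s ≤ a, f s = 0)
    (hN : fracNorm α b f < ∞) :
    gsInt α a b f g = ∫ p, (f p.1 - f p.2) * gsWeight α g b p.1 ∂incMeasure α b := by
  have hint := integrable_inc hf hN
  have hae : ∀ᵐ s ∂volume.restrict (Iic b),
      Integrable fun w => (f s - f w) * fracKer α (s - w) :=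
    ((integrable_incMeasure_iff α b).1 hint).prod_right_ae
  rw [integral_incMeasure _ _ (integrable_inc_mul_gsWeight hα hα1 g hb hint), gsInt,
    ← integral_neg, setIntegral_congr_set Ioo_ae_eq_Ioc.symm,
    ← integral_indicator measurableSet_Ioo,
    ← integral_indicator measurableSet_Iic]
  refine integral_congr_ae ?_
  rw [ae_restrict_iff' measurableSet_Iic] at hae
  filter_upwards [hae] with s hs
  by_cases has : a < s
  · by_cases hsb : s < b
    · have hs0 : s ∈ Ioo 0 b := ⟨ha.trans_lt has, hsb⟩
      simp only [indicator, mem_Ioo, has, hsb, mem_Iic, hsb.le, and_self, if_true]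
      rw [weylLeft_eq hα has h0 (hs hsb.le), weylRight_eq (sub_pos.2 hα1) hsb
        (integrable_rightDer hα hα1 g hs0.1.le hsb hb), leftDer]
      simp only [gsWeight, indicator, hs0, if_true, mul_right_comm _ _ (fracKer _ _)]
      -- The right derivative has order `1-α`, so its normalisation is `Γ(1-(1-α)) = Γ(α)`.
      rw [integral_mul_const, sub_sub_cancel]
      ring
    · rw [indicator_of_notMem (by simp [hsb])]
      symm
      by_cases hsb' : s ≤ b <;> simp [indicator, hsb', gsWeight, hsb]
  · rw [indicator_of_notMem (by simp [has])]
    symm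
    by_cases hsb' : s ≤ b <;> simp only [indicator, hsb', mem_Iic, if_true, if_false]
    rw [← integral_zero ℝ ℝ]
    refine integral_congr_ae (ae_of_all _ fun w => ?_)
    rcases le_or_gt s w with hw | hw
    · simp [fracKer_of_nonpos (sub_nonpos.2 hw)]
    · simp [h0 s (not_lt.1 has), h0 w (hw.le.trans (not_lt.1 has))]

lemma gsWeight_of_le {α b s : ℝ} {g : ℝ → ℝ} (h : b ≤ s) : gsWeight α g b s = 0 := by
  simp [gsWeight, h]

/-- The weight carries the upper limit by itself, as it vanishes from time `b` on; the measure may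
extend further. -/
lemma integral_incMeasure_gsWeight {α b c : ℝ} (h : b ≤ c) (F : ℝ × ℝ → ℝ) (g : ℝ → ℝ) :
    ∫ p, F p * gsWeight α g b p.1 ∂incMeasure α b
      = ∫ p, F p * gsWeight α g b p.1 ∂incMeasure α c := by
  rw [incMeasure_restrict α h]
  refine setIntegral_eq_integral_of_forall_compl_eq_zero fun p hp => ?_
  rw [gsWeight_of_le (not_le.1 hp).le, mul_zero]

lemma fracNorm_mono {α b c : ℝ} (h : b ≤ c) (f : ℝ → ℝ) : fracNorm α b f ≤ fracNorm α c f := by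
  rw [fracNorm, incMeasure_restrict α h]
  exact setLIntegral_le_lintegral _ _

/-- For arbitrary `F`, because besides increments of one function the mixed increments of a
two-parameter kernel will be inserted. -/
lemma abs_integral_gsWeight_le {α T c : ℝ} (hα : 0 < α) (hα1 : α < 1) (g : W2 α T) {b : ℝ}
    (hb : b ≤ T) (F : ℝ × ℝ → ℝ) :
    ‖∫ p, F p * gsWeight α g b p.1 ∂incMeasure α c‖ₑ
      ≤ ENNReal.ofReal (gsConst α * ‖g‖) * ∫⁻ p, ‖F p‖ₑ ∂incMeasure α c := by
  refine (enorm_integral_le_lintegral_enorm _).trans ?_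
  rw [← lintegral_const_mul' _ _ ENNReal.ofReal_ne_top]
  refine lintegral_mono fun p => ?_
  rw [enorm_mul, mul_comm]
  gcongr
  rw [Real.enorm_eq_ofReal_abs]
  exact ENNReal.ofReal_le_ofReal (abs_gsWeight_le hα hα1 g hb _)

/-! ### Inversion of the left fractional derivative -/

/-- The fractional kernel, shifted by `δ`. -/
def regKer (α δ x : ℝ) : ℝ := (Ioi δ).indicator (fracKer α) (x + δ)

lemma regKer_nonneg (α δ x : ℝ) : 0 ≤ regKer α δ x :=
  indicator_nonneg (fun _ _ => fracKer_nonneg _ _) _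

@[fun_prop]
lemma measurable_regKer (α δ : ℝ) : Measurable (regKer α δ) := by
  have : Measurable ((Ioi δ).indicator (fracKer α)) :=
    (measurable_fracKer α).indicator measurableSet_Ioi
  unfold regKer; fun_prop

lemma integrable_regKer {α δ : ℝ} (hα : 0 < α) (hδ : 0 < δ) : Integrable (regKer α δ) :=
  ((integrableOn_fracKer_Ioi hα hδ).integrable_indicator measurableSet_Ioi).comp_add_right δ

lemma regKer_of_nonpos {α δ x : ℝ} (h : x ≤ 0) : regKer α δ x = 0 := by
  simp [regKer, h]

lemma regKer_of_pos {α δ x : ℝ} (h : 0 < x) : regKer α δ x = fracKer α (x + δ) := by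
  simp [regKer, h]

lemma regKer_le {α δ x : ℝ} (hα : 0 < α) (hδ : 0 < δ) : regKer α δ x ≤ fracKer α x := by
  rcases le_or_gt x 0 with h | h
  · rw [regKer_of_nonpos h, fracKer_of_nonpos h]
  · rw [regKer_of_pos h, fracKer_of_pos h, fracKer_of_pos (by linarith)]
    gcongr
    linarith

lemma tendsto_regKer (α x : ℝ) :
    Tendsto (fun δ => regKer α δ x) (𝓝[>] 0) (𝓝 (fracKer α x)) := by
  rcases le_or_gt x 0 with h | h
  · simp only [regKer_of_nonpos h, fracKer_of_nonpos h, tendsto_const_nhds]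
  · simp only [regKer_of_pos h]
    refine tendsto_nhdsWithin_of_tendsto_nhds ?_
    have : ContinuousAt (fun δ => ((x + δ) ^ (α + 1))⁻¹) 0 := by
      have : x + 0 ≠ 0 := by linarith
      refine ContinuousAt.inv₀ (ContinuousAt.rpow_const (by fun_prop) (Or.inl this)) ?_
      rw [add_zero]; positivity
    have h2 : Tendsto (fun δ => ((x + δ) ^ (α + 1))⁻¹) (𝓝 0) (𝓝 (fracKer α x)) := by
      rw [fracKer_of_pos h]
      simpa [ContinuousAt] using this
    refine h2.congr' ?_
    filter_upwards [lt_mem_nhds (show (0:ℝ) > -x by linarith)] with δ hδ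
    rw [fracKer_of_pos (by linarith)]

/-- The profile `(1 - (1-z)_+^α) z^{-α-1}` on the positive half-line. -/
def profile (α z : ℝ) : ℝ := (1 - (max (1 - z) 0) ^ α) * fracKer α z

/-- Beyond `1` the profile is the integrable tail of the kernel. On `(0,1]` one has `(1-z)^α ≥ 1-z`,
so the numerator is at most `z` and the profile at most `z^{-α}`. -/
lemma integrable_profile {α : ℝ} (hα : 0 < α) (hα1 : α < 1) : Integrable (profile α) := by
  have hm : Measurable (profile α) := by unfold profile; fun_prop
  have h1 : IntegrableOn (profile α) (Ioi 1) := by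
    refine (integrableOn_fracKer_Ioi hα one_pos).congr_fun (fun z hz => ?_) measurableSet_Ioi
    have : max (1 - z) 0 = 0 := max_eq_right (by linarith [mem_Ioi.1 hz])
    simp [profile, this, Real.zero_rpow hα.ne']
  have h2 : IntegrableOn (profile α) (Ioc 0 1) := by
    have hi : IntegrableOn (fun z : ℝ => z ^ (-α)) (Ioc 0 1) :=
      (intervalIntegrable_iff_integrableOn_Ioc_of_le zero_le_one).1
        (intervalIntegral.intervalIntegrable_rpow' (by linarith))
    refine Integrable.mono' hi hm.aestronglyMeasurable ?_
    filter_upwards [ae_restrict_mem measurableSet_Ioc] with z hz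
    have hmx : max (1 - z) 0 = 1 - z := max_eq_left (by linarith [hz.2])
    have hle : (1 - z) ^ α ≤ 1 := Real.rpow_le_one (by linarith [hz.2]) (by linarith [hz.1]) hα.le
    have hge : 1 - z ≤ (1 - z) ^ α := by
      rcases hz.2.eq_or_lt with h | h
      · simp [h, Real.zero_rpow hα.ne']
      · simpa using Real.rpow_le_rpow_of_exponent_ge (x := 1 - z) (by linarith) (by linarith [hz.1])
          hα1.le
    rw [profile, hmx, fracKer_of_pos hz.1, Real.norm_eq_abs, abs_of_nonneg (mul_nonneg
      (by linarith) (inv_nonneg.2 (Real.rpow_nonneg hz.1.le _)))]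
    calc (1 - (1 - z) ^ α) * (z ^ (α + 1))⁻¹ ≤ z * (z ^ (α + 1))⁻¹ := by
          gcongr
          · exact inv_nonneg.2 (Real.rpow_nonneg hz.1.le _)
          · linarith
      _ = z ^ (-α) := by
          rw [Real.rpow_add hz.1, Real.rpow_one, Real.rpow_neg hz.1.le]
          have := hz.1.ne'
          field_simp
  have h3 : IntegrableOn (profile α) (Iic 0) := by
    refine (integrableOn_zero).congr_fun (fun z hz => ?_) measurableSet_Iic
    simp [profile, fracKer_of_nonpos (mem_Iic.1 hz)]
  rw [← integrableOn_univ, ← Iic_union_Ioi (a := (0:ℝ)), ← Ioc_union_Ioi_eq_Ioi zero_le_one]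
  exact h3.union (h2.union h1)

/-- The function `s ↦ (v-s)^α` on `(a,v]`, extended by zero. -/
def powCut (α a v s : ℝ) : ℝ := (Ioc a v).indicator (fun s => (v - s) ^ α) s

@[fun_prop]
lemma measurable_powCut (α a v : ℝ) : Measurable (powCut α a v) := by
  have : Measurable (fun s => (v - s) ^ α) := by fun_prop
  exact this.indicator measurableSet_Ioc

lemma abs_powCut_le {α a v : ℝ} (hα : 0 < α) (s : ℝ) (hav : a ≤ v) :
    |powCut α a v s| ≤ (v - a) ^ α := by
  unfold powCut indicator
  split_ifs with h
  · have := sub_nonneg.2 h.2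
    rw [abs_of_nonneg (by positivity)]
    exact Real.rpow_le_rpow this (by linarith [h.1]) hα.le
  · have := sub_nonneg.2 hav
    rw [abs_zero]; positivity

/-- Scaling by `z = (w-s)/(v-s)`: the power contributes degree `α` and the kernel degree `-α-1`,
leaving the factor `(v-s)⁻¹` that the substitution absorbs. Hence the right derivative of order `α`
of `(v-·)^α` does not depend on `s`. -/
lemma powCut_sub_mul_fracKer {α a v s : ℝ} (hα : 0 < α) (has : a < s) (hsv : s < v) (w : ℝ) :
    (powCut α a v s - powCut α a v w) * fracKer α (w - s)
      = (v - s)⁻¹ * profile α ((w - s) / (v - s)) := by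
  have hL : 0 < v - s := sub_pos.2 hsv
  rcases le_or_gt w s with h | h
  · rw [profile, fracKer_of_nonpos (by linarith),
      fracKer_of_nonpos (div_nonpos_of_nonpos_of_nonneg (by linarith) hL.le)]
    simp
  · have hws : 0 < w - s := sub_pos.2 h
    have h1 : powCut α a v s = (v - s) ^ α := by simp [powCut, has, hsv.le]
    have h2 : powCut α a v w = (v - s) ^ α * (max (1 - (w - s) / (v - s)) 0) ^ α := by
      rw [← Real.mul_rpow hL.le (le_max_right _ _), mul_max_of_nonneg _ _ hL.le, mul_zero,
        mul_sub, mul_div_cancel₀ _ hL.ne', mul_one, sub_sub_sub_cancel_right]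
      rcases le_or_gt w v with hv | hv
      · rw [max_eq_left (by linarith)]; simp [powCut, has.trans h, hv]
      · rw [max_eq_right (by linarith), Real.zero_rpow hα.ne']; simp [powCut, hv]
    rw [h1, h2, profile, fracKer_of_pos hws, fracKer_of_pos (div_pos hws hL),
      Real.div_rpow hws.le hL.le, Real.rpow_add_one hL.ne']
    have : 0 < (w - s) ^ (α + 1) := by positivity
    have : 0 < (v - s) ^ α := by positivity
    field_simp

/-- The constant `∫_0^∞ (1 - (1-z)_+^α) z^{-α-1} dz`. -/
def profileConst (α : ℝ) : ℝ := ∫ z, profile α z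

lemma integrable_powCut {α a v s : ℝ} (hα : 0 < α) (hα1 : α < 1) (has : a < s) (hsv : s < v) :
    Integrable fun w => (powCut α a v s - powCut α a v w) * fracKer α (w - s) := by
  simp only [powCut_sub_mul_fracKer hα has hsv]
  exact (((integrable_profile hα hα1).comp_div (sub_pos.2 hsv).ne').comp_sub_right s).const_mul _

lemma rightDer_powCut {α a v s : ℝ} (hα : 0 < α) (has : a < s) (hsv : s < v) :
    rightDer α (powCut α a v) s = profileConst α := by
  simp only [rightDer, powCut_sub_mul_fracKer hα has hsv]
  have hL : 0 < v - s := sub_pos.2 hsv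
  rw [integral_const_mul, integral_sub_right_eq_self (fun w => profile α (w / (v - s))),
    Measure.integral_comp_div, abs_of_pos hL, smul_eq_mul,
    inv_mul_cancel_left₀ hL.ne', profileConst]

/-- By the same scaling the absolute integral is independent of `s`; this is the uniform bound for
the dominated convergence below. -/
lemma abs_powCut_sub_mul {α a v s : ℝ} (hα : 0 < α) (has : a < s) (hsv : s < v) :
    ∫ w, |powCut α a v s - powCut α a v w| * fracKer α (w - s) = ∫ z, |profile α z| := by
  have hL : 0 < v - s := sub_pos.2 hsv
  have e : ∀ w, |powCut α a v s - powCut α a v w| * fracKer α (w - s)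
      = (v - s)⁻¹ * |profile α ((w - s) / (v - s))| := fun w => by
    rw [← abs_of_nonneg (fracKer_nonneg α (w - s)), ← abs_mul, powCut_sub_mul_fracKer hα has hsv,
      abs_mul, abs_of_pos (inv_pos.2 hL)]
  simp only [e]
  rw [integral_const_mul, integral_sub_right_eq_self (fun w => |profile α (w / (v - s))|),
    Measure.integral_comp_div (fun z => |profile α z|), abs_of_pos hL, smul_eq_mul,
    inv_mul_cancel_left₀ hL.ne']

/-- The boundary term controls `|f(s)| (s-a)^{-α}`, and `(s-a)^α` is bounded on `(a,b]`. -/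
lemma integrableOn_of_fracNorm {α a b : ℝ} (hα : 0 < α) {f : ℝ → ℝ} (hf : Measurable f)
    (h0 : ∀ s ≤ a, f s = 0) (hN : fracNorm α b f < ∞) : IntegrableOn f (Ioc a b) := by
  rcases le_or_gt b a with hba | hab
  · simp [Ioc_eq_empty_of_le hba]
  refine ⟨hf.aestronglyMeasurable, ?_⟩
  rw [fracNorm_eq hα hf h0] at hN
  have hb : 0 < b - a := sub_pos.2 hab
  have h1 : ∫⁻ s in Ioc a b, ‖f s‖ₑ ≤ ENNReal.ofReal (α * (b - a) ^ α)
      * ∫⁻ s in Ioc a b, ENNReal.ofReal (|f s| / (s - a) ^ α) * ENNReal.ofReal α⁻¹ := by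
    rw [← lintegral_const_mul' _ _ ENNReal.ofReal_ne_top]
    refine setLIntegral_mono' measurableSet_Ioc fun s hs => ?_
    have hs1 : 0 < s - a := sub_pos.2 hs.1
    rw [← ENNReal.ofReal_mul (by positivity), ← ENNReal.ofReal_mul (by positivity),
      Real.enorm_eq_ofReal_abs]
    apply ENNReal.ofReal_le_ofReal
    have : (s - a) ^ α ≤ (b - a) ^ α := by gcongr; exact hs.2
    have h3 : 0 < (s - a) ^ α := by positivity
    calc |f s| = |f s| * (s - a) ^ α / (s - a) ^ α := by field_simp
      _ ≤ |f s| * (b - a) ^ α / (s - a) ^ α := by gcongr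
      _ = _ := by field_simp
  refine h1.trans_lt (ENNReal.mul_lt_top ENNReal.ofReal_lt_top (lt_of_le_of_lt ?_ hN))
  exact lintegral_mono fun s => le_self_add

/-- On the support of the kernel and of `ψ` one has `w < s ≤ v`, where cutting `f` off outside
`(a,v]` changes nothing. After the cut-off the function is integrable on the whole line, so the
regularised identity below applies to it. -/
lemma integrable_inc_mul_fracKer {α a b v : ℝ} {f : ℝ → ℝ} (hf : Measurable f)
    (h0 : ∀ s ≤ a, f s = 0) (hN : fracNorm α b f < ∞) (hvb : v ≤ b) {ψ : ℝ → ℝ}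
    (hψ : Measurable ψ) {C : ℝ} (hC : ∀ s, |ψ s| ≤ C) (hψ0 : ∀ s, v < s → ψ s = 0) :
    Integrable (fun p : ℝ × ℝ => ((Ioc a v).indicator f p.1 - (Ioc a v).indicator f p.2)
      * ψ p.1 * fracKer α (p.1 - p.2)) (volume.prod volume) := by
  have h1 := (integrable_incMeasure_iff α b).1 (integrable_inc hf hN)
  have h2 := h1.mul_bdd (g := fun p => ψ p.1) (c := C)
    (Measurable.aestronglyMeasurable (by fun_prop)) (ae_of_all _ fun p => hC _)
  have h3 : (volume.restrict (Iic b)).prod (volume : Measure ℝ)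
      = (volume.prod volume).restrict (Iic b ×ˢ univ) := by
    rw [← Measure.prod_restrict, Measure.restrict_univ]
  rw [h3] at h2
  refine ((integrable_indicator_iff (measurableSet_Iic.prod MeasurableSet.univ)).2 h2).congr ?_
  refine ae_of_all _ fun p => ?_
  rcases le_or_gt p.1 p.2 with hp | hp
  · simp [indicator, fracKer_of_nonpos (sub_nonpos.2 hp)]
  rcases le_or_gt p.1 v with hv | hv
  · have e1 : (Ioc a v).indicator f p.1 = f p.1 := by
      by_cases h : a < p.1 <;> simp [indicator, h, hv]
      exact (h0 _ (not_lt.1 h)).symm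
    have e2 : (Ioc a v).indicator f p.2 = f p.2 := by
      by_cases h : a < p.2 <;> simp [indicator, h, hp.le.trans hv]
      exact (h0 _ (not_lt.1 h)).symm
    simp only [e1, e2]
    simp only [indicator, mem_prod, mem_Iic, hv.trans hvb, mem_univ, and_self, if_true]
    ring
  · simp [indicator, hψ0 _ hv]

/-- Fractional integration by parts. With an integrable kernel the terms `h(s)ψ(s)` and `h(w)ψ(s)`
can be integrated separately; renaming the variables in the second moves the difference from `h` to
`ψ`. The singular kernel does not allow this splitting, hence the shift by `δ`. -/
lemma integral_inc_regKer {α δ : ℝ} (hα : 0 < α) (hδ : 0 < δ) {h ψ : ℝ → ℝ}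
    (hh : Integrable h) (hψ : Measurable ψ) {C : ℝ} (hC : ∀ s, |ψ s| ≤ C) :
    ∫ p : ℝ × ℝ, (h p.1 - h p.2) * ψ p.1 * regKer α δ (p.1 - p.2) ∂(volume.prod volume)
      = ∫ s, h s * ∫ w, (ψ s - ψ w) * regKer α δ (w - s) := by
  have hk := integrable_regKer hα hδ
  have i2 : Integrable (fun p : ℝ × ℝ => h p.2 * ψ p.1 * regKer α δ (p.1 - p.2))
      (volume.prod volume) := by
    have := (hh.convolution_integrand (ContinuousLinearMap.mul ℝ ℝ) hk).bdd_mul (c := C)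
      (f := fun p => ψ p.1) (Measurable.aestronglyMeasurable (by fun_prop))
      (ae_of_all _ fun p => hC _)
    refine this.congr (ae_of_all _ fun p => ?_)
    simp only [ContinuousLinearMap.mul_apply']
    ring
  have i1 : Integrable (fun p : ℝ × ℝ => h p.1 * ψ p.1 * regKer α δ (p.1 - p.2))
      (volume.prod volume) := by
    have h1 : Integrable (fun s => h s * ψ s) :=
      hh.mul_bdd hψ.aestronglyMeasurable (ae_of_all _ hC)
    have := (h1.convolution_integrand (ContinuousLinearMap.mul ℝ ℝ) hk.comp_neg
      (μ := volume)).swap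
    refine this.congr (ae_of_all _ fun p => ?_)
    simp
  have s1 : ∀ s, Integrable fun w => regKer α δ (w - s) := fun s => hk.comp_sub_right s
  simp only [sub_mul]
  rw [integral_sub i1 i2, integral_prod _ i1, integral_prod_symm _ i2, ← integral_sub
    i1.integral_prod_left i2.integral_prod_right]
  refine integral_congr_ae (ae_of_all _ fun s => ?_)
  simp only
  have e : ∫ w, regKer α δ (s - w) = ∫ w, regKer α δ (w - s) := by
    rw [integral_sub_left_eq_self, integral_sub_right_eq_self]
  rw [integral_const_mul, e, integral_sub ((s1 s).const_mul _)
    ((s1 s).bdd_mul hψ.aestronglyMeasurable (ae_of_all _ hC)), integral_const_mul, mul_sub,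
    mul_assoc]
  congr 1
  rw [← integral_const_mul]
  congr 1 with w
  ring

/-- Integrate by parts against `ψ(s) = (v-s)^α`, whose right derivative is the constant
`profileConst α`, first with the shifted kernel; then let `δ → 0` on both sides. The left side is
dominated through the finite seminorm of `f`, the right side by `|h|` times the absolute integral of
the profile. -/
lemma setIntegral_leftDer_mul_rpow {α a b v : ℝ} (hα : 0 < α) (hα1 : α < 1) {f : ℝ → ℝ}
    (hf : Measurable f) (h0 : ∀ s ≤ a, f s = 0) (hN : fracNorm α b f < ∞) (hav : a ≤ v)
    (hvb : v ≤ b) :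
    ∫ s in Ioc a v, leftDer α f s * (v - s) ^ α = profileConst α * ∫ s in Ioc a v, f s := by
  set ψ := powCut α a v with hψ
  set h := (Ioc a v).indicator f with hh
  have hψm : Measurable ψ := measurable_powCut α a v
  have hψb : ∀ s, |ψ s| ≤ (v - a) ^ α := fun s => abs_powCut_le hα s hav
  have hhi : Integrable h :=
    ((integrableOn_of_fracNorm hα hf h0 hN).mono_set
      (Ioc_subset_Ioc_right hvb)).integrable_indicator measurableSet_Ioc
  have hint := integrable_inc_mul_fracKer hf h0 hN hvb hψm hψb
    (fun s hs => by simp [hψ, powCut, hs])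
  have hhm : Measurable h := hf.indicator measurableSet_Ioc
  have t1 : Tendsto (fun δ => ∫ p : ℝ × ℝ, (h p.1 - h p.2) * ψ p.1 * regKer α δ (p.1 - p.2)
      ∂(volume.prod volume)) (𝓝[>] 0)
      (𝓝 (∫ p : ℝ × ℝ, (h p.1 - h p.2) * ψ p.1 * fracKer α (p.1 - p.2)
      ∂(volume.prod volume))) := by
    refine tendsto_integral_filter_of_dominated_convergence _ (Eventually.of_forall fun δ =>
      Measurable.aestronglyMeasurable (by fun_prop)) ?_ hint.norm ?_
    · filter_upwards [self_mem_nhdsWithin] with δ hδ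
      refine ae_of_all _ fun p => ?_
      rw [norm_mul, norm_mul _ (fracKer _ _)]
      gcongr
      rw [Real.norm_of_nonneg (regKer_nonneg _ _ _), Real.norm_of_nonneg (fracKer_nonneg _ _)]
      exact regKer_le hα hδ
    · exact ae_of_all _ fun p => (tendsto_regKer α _).const_mul _
  have t2 : Tendsto (fun δ => ∫ s, h s * ∫ w, (ψ s - ψ w) * regKer α δ (w - s)) (𝓝[>] 0)
      (𝓝 (∫ s, h s * profileConst α)) := by
    refine tendsto_integral_filter_of_dominated_convergence
      (fun s => ‖h s‖ * ∫ z, |profile α z|) (Eventually.of_forall fun δ => ?_) ?_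
      (hhi.norm.mul_const _) ?_
    · refine hhm.aestronglyMeasurable.mul (StronglyMeasurable.aestronglyMeasurable ?_)
      refine StronglyMeasurable.integral_prod_right
        (f := fun s w => (ψ s - ψ w) * regKer α δ (w - s)) (Measurable.stronglyMeasurable ?_)
      unfold Function.uncurry
      fun_prop
    · filter_upwards [self_mem_nhdsWithin] with δ hδ
      have hv : ∀ᵐ s : ℝ, s ≠ v := by simp [ae_iff]
      filter_upwards [hv] with s hsv
      rw [norm_mul]
      by_cases hs : s ∈ Ioo a v
      · gcongr
        rw [← abs_powCut_sub_mul hα hs.1 hs.2]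
        refine norm_integral_le_of_norm_le ?_ (ae_of_all _ fun w => ?_)
        · refine (integrable_powCut hα hα1 hs.1 hs.2).norm.congr (ae_of_all _ fun w => ?_)
          simp [abs_of_nonneg (fracKer_nonneg _ _)]
        · rw [norm_mul, Real.norm_of_nonneg (regKer_nonneg _ _ _), Real.norm_eq_abs]
          gcongr
          exact regKer_le hα hδ
      · have : h s = 0 := by
          rw [hh, indicator_of_notMem]
          intro hs'
          exact hs ⟨hs'.1, lt_of_le_of_ne hs'.2 hsv⟩
        simp [this]
    · have hv : ∀ᵐ s : ℝ, s ≠ v := by simp [ae_iff]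
      filter_upwards [hv] with s hsv
      by_cases hs : s ∈ Ioo a v
      · refine Tendsto.const_mul _ ?_
        rw [← rightDer_powCut hα hs.1 hs.2]
        refine tendsto_integral_filter_of_dominated_convergence _ (Eventually.of_forall fun δ =>
          Measurable.aestronglyMeasurable (by fun_prop)) ?_
          (integrable_powCut hα hα1 hs.1 hs.2).norm
          (ae_of_all _ fun w => (tendsto_regKer α _).const_mul _)
        filter_upwards [self_mem_nhdsWithin] with δ hδ
        refine ae_of_all _ fun w => ?_
        rw [norm_mul, norm_mul, Real.norm_of_nonneg (regKer_nonneg _ _ _),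
          Real.norm_of_nonneg (fracKer_nonneg _ _)]
        gcongr
        exact regKer_le hα hδ
      · have : h s = 0 := by
          rw [hh, indicator_of_notMem]
          intro hs'
          exact hs ⟨hs'.1, lt_of_le_of_ne hs'.2 hsv⟩
        simp [this]
  have t3 := t1.congr' (f₂ := fun δ => ∫ s, h s * ∫ w, (ψ s - ψ w) * regKer α δ (w - s)) (by
    filter_upwards [self_mem_nhdsWithin] with δ hδ
    exact integral_inc_regKer hα hδ hhi hψm hψb)
  have e := tendsto_nhds_unique t3 t2
  rw [integral_prod _ hint, integral_mul_const, hh, integral_indicator measurableSet_Ioc] at e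
  rw [mul_comm, ← e, ← integral_indicator measurableSet_Ioc]
  refine integral_congr_ae (ae_of_all _ fun s => ?_)
  by_cases hs : s ∈ Ioc a v
  · have hψs : ψ s = (v - s) ^ α := by rw [hψ, powCut, indicator_of_mem hs]
    simp only [indicator_of_mem hs, hψs, leftDer]
    rw [← integral_mul_const]
    refine integral_congr_ae (ae_of_all _ fun w => ?_)
    rcases le_or_gt s w with hp | hp
    · simp [fracKer_of_nonpos (sub_nonpos.2 hp)]
    · have e2 : (Ioc a v).indicator f w = f w := by
        by_cases h : a < w <;> simp [indicator, h, hp.le.trans hs.2]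
        exact (h0 _ (not_lt.1 h)).symm
      simp only [e2]; ring
  · have hψs : ψ s = 0 := by rw [hψ, powCut, indicator_of_notMem hs]
    simp [indicator_of_notMem hs, hψs]

/-- The kernel `x ↦ x^{α-1}` on `(0,R]`, extended by zero. -/
def rlKer (α R x : ℝ) : ℝ := (Ioc 0 R).indicator (fun x => x ^ (α - 1)) x

lemma integrableOn_rpow_sub_one {α : ℝ} (hα : 0 < α) (R : ℝ) :
    IntegrableOn (fun x : ℝ => x ^ (α - 1)) (Ioc 0 R) := by
  rcases le_or_gt R 0 with h | h
  · simp [Ioc_eq_empty_of_le h]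
  · exact (intervalIntegrable_iff_integrableOn_Ioc_of_le h.le).1
      (intervalIntegral.intervalIntegrable_rpow' (by linarith))

lemma integrable_rlKer {α : ℝ} (hα : 0 < α) (R : ℝ) : Integrable (rlKer α R) :=
  (integrableOn_rpow_sub_one hα R).integrable_indicator measurableSet_Ioc

lemma integrableOn_leftDer {α b : ℝ} {f : ℝ → ℝ} (hf : Measurable f) (hN : fracNorm α b f < ∞) :
    IntegrableOn (leftDer α f) (Iic b) :=
  ((integrable_incMeasure_iff α b).1 (integrable_inc hf hN)).integral_prod_left

/-- The Riemann–Liouville integral, on `(a,b]`, of the left fractional derivative. -/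
def rlInt (α a b : ℝ) (f : ℝ → ℝ) (x : ℝ) : ℝ :=
  ∫ s, (Ioc a b).indicator (leftDer α f) s * rlKer α (b - a) (x - s)

lemma integrable_rlInt_prod {α a b : ℝ} (hα : 0 < α) {f : ℝ → ℝ} (hf : Measurable f)
    (hN : fracNorm α b f < ∞) :
    Integrable (fun p : ℝ × ℝ => (Ioc a b).indicator (leftDer α f) p.2
      * rlKer α (b - a) (p.1 - p.2)) (volume.prod volume) := by
  have hD : Integrable ((Ioc a b).indicator (leftDer α f)) :=
    ((integrableOn_leftDer hf hN).mono_set Ioc_subset_Iic_self).integrable_indicator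
      measurableSet_Ioc
  exact hD.convolution_integrand (ContinuousLinearMap.mul ℝ ℝ) (integrable_rlKer hα (b - a))

/-- Fubini, stated for bounded test functions: indicators of half-lines serve for the inversion,
increments of the stopped path for the forward quotients. -/
lemma setIntegral_rlInt_mul {α a b : ℝ} (hα : 0 < α) {f : ℝ → ℝ} (hf : Measurable f)
    (hN : fracNorm α b f < ∞) {φ : ℝ → ℝ} (hφ : Measurable φ) {C : ℝ} (hC : ∀ x, |φ x| ≤ C) :
    ∫ x in Ioc a b, rlInt α a b f x * φ x
      = ∫ s in Ioc a b, leftDer α f s * ∫ x in Ioc s b, (x - s) ^ (α - 1) * φ x := by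
  have hi : Integrable (Function.uncurry fun x s => ((Ioc a b).indicator (leftDer α f) s
      * rlKer α (b - a) (x - s)) * φ x) ((volume.restrict (Ioc a b)).prod volume) := by
    have h := (integrable_rlInt_prod (a := a) hα hf hN).mul_bdd (g := fun p => φ p.1) (c := C)
      (Measurable.aestronglyMeasurable (by fun_prop)) (ae_of_all _ fun p => hC _)
    exact h.mono_measure (Measure.prod_mono Measure.restrict_le_self le_rfl)
  simp only [rlInt, ← integral_mul_const]
  rw [integral_integral_swap hi, ← integral_indicator measurableSet_Ioc]
  refine integral_congr_ae (ae_of_all _ fun s => ?_)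
  by_cases hs : s ∈ Ioc a b
  · simp only [indicator_of_mem hs, mul_assoc]
    rw [integral_const_mul, ← integral_indicator measurableSet_Ioc,
      ← integral_indicator measurableSet_Ioc]
    congr 2 with x
    by_cases hxb : x ≤ b
    · by_cases hsx : s < x
      · simp [indicator, hxb, hsx, rlKer, hs.1.trans hsx]
        intro; linarith [hs.1]
      · simp [indicator, hsx, rlKer]
    · simp [indicator, hxb]
  · simp [indicator_of_notMem hs]

lemma setIntegral_sub_rpow {α s v : ℝ} (hα : 0 < α) (hsv : s ≤ v) :
    ∫ x in Ioc s v, (x - s) ^ (α - 1) = (v - s) ^ α / α := by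
  rw [← intervalIntegral.integral_of_le hsv,
    intervalIntegral.integral_comp_sub_right (fun x => x ^ (α - 1)), sub_self,
    integral_rpow (Or.inl (by linarith)), sub_add_cancel, Real.zero_rpow hα.ne', sub_zero]

/-- Inversion: the Riemann–Liouville integral recovers the function. -/
lemma rlInt_ae_eq {α a b : ℝ} (hα : 0 < α) (hα1 : α < 1) {f : ℝ → ℝ} (hf : Measurable f)
    (h0 : ∀ s ≤ a, f s = 0) (hN : fracNorm α b f < ∞) :
    ∀ᵐ x, x ∈ Ioc a b → α * rlInt α a b f x = profileConst α * f x := by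
  rcases le_or_gt b a with hba | hab
  · simp [Ioc_eq_empty_of_le hba]
  set J := rlInt α a b f with hJ
  have hJi : Integrable J := (integrable_rlInt_prod (a := a) hα hf hN).integral_prod_left
  have hfi := integrableOn_of_fracNorm hα hf h0 hN
  have hint : IntegrableOn (fun x => α * J x - profileConst α * f x) (Ioc a b) :=
    (hJi.integrableOn.const_mul α).sub (hfi.const_mul _)
  have hII : IntervalIntegrable (fun x => α * J x - profileConst α * f x) volume a b :=
    (intervalIntegrable_iff_integrableOn_Ioc_of_le hab.le).2 hint
  -- Testing with the indicator of `(-∞,v]` turns `(x-s)^{α-1}` into `(v-s)^α/α`, so the primitives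
  -- of `α J` and of `profileConst α * f` agree at every `v`. Lebesgue differentiation then gives
  -- equality almost everywhere.
  have hz : ∀ v ∈ Icc a b, ∫ x in a..v, (α * J x - profileConst α * f x) = 0 := by
    intro v hv
    have e1 : ∫ x in Ioc a v, J x = ∫ s in Ioc a v, leftDer α f s * ((v - s) ^ α / α) := by
      have h1 := setIntegral_rlInt_mul (a := a) (b := b) hα hf hN (φ := (Iic v).indicator 1)
        (measurable_one.indicator measurableSet_Iic) (C := 1) (fun x => by
          by_cases h : x ≤ v <;> simp [indicator, h])
      have h2 : ∫ x in Ioc a b, J x * (Iic v).indicator 1 x = ∫ x in Ioc a v, J x := by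
        rw [← integral_indicator measurableSet_Ioc, ← integral_indicator measurableSet_Ioc]
        congr 1 with x
        by_cases h : x ≤ v
        · simp [indicator, h, h.trans hv.2]
        · simp [indicator, h]
      rw [← h2, h1, ← integral_indicator measurableSet_Ioc, ← integral_indicator measurableSet_Ioc]
      congr 1 with s
      by_cases hs : a < s
      · by_cases hsv : s ≤ v
        · simp only [indicator, mem_Ioc, hs, hsv, hsv.trans hv.2, and_self, if_true]
          rw [← setIntegral_sub_rpow hα hsv, ← integral_indicator measurableSet_Ioc,
            ← integral_indicator measurableSet_Ioc]
          congr 2 with x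
          by_cases h : x ≤ v
          · simp [indicator, h, h.trans hv.2]
          · simp [indicator, h]
        · have : ∫ x in Ioc s b, (x - s) ^ (α - 1) * (Iic v).indicator 1 x = 0 := by
            rw [← integral_zero ℝ ℝ, ← integral_indicator measurableSet_Ioc]
            congr 1 with x
            by_cases h : s < x
            · have : ¬ x ≤ v := by linarith
              simp [indicator, this]
            · simp [indicator, h]
          rw [indicator_of_notMem (by simp [hsv] : s ∉ Ioc a v)]
          by_cases hsI : s ∈ Ioc a b
          · rw [indicator_of_mem hsI, this, mul_zero]
          · rw [indicator_of_notMem hsI]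
      · simp [indicator, hs]
    rw [intervalIntegral.integral_of_le hv.1, integral_sub (hJi.integrableOn.const_mul α)
      ((hfi.mono_set (Ioc_subset_Ioc_right hv.2)).const_mul _), integral_const_mul,
      integral_const_mul, e1, ← setIntegral_leftDer_mul_rpow hα hα1 hf h0 hN hv.1 hv.2,
      ← integral_const_mul, sub_eq_zero]
    congr 1 with s
    field_simp
  have hb : ∀ᵐ x : ℝ, x ≠ b := by simp [ae_iff]
  filter_upwards [hII.ae_hasDerivAt_integral, hb] with x hx hxb hxI
  have hxi : x ∈ Ioo a b := ⟨hxI.1, lt_of_le_of_ne hxI.2 hxb⟩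
  have hd := hx (by rw [uIcc_of_le hab.le]; exact Ioo_subset_Icc_self hxi) a left_mem_uIcc
  have hd0 : HasDerivAt (fun x => ∫ t in a..x, (α * J t - profileConst α * f t)) 0 x := by
    refine (hasDerivAt_const x (0:ℝ)).congr_of_eventuallyEq ?_
    filter_upwards [Ioo_mem_nhds hxi.1 hxi.2] with y hy
    exact hz y (Ioo_subset_Icc_self hy)
  exact sub_eq_zero.1 (hd.unique hd0)

/-! ### Averages of the right fractional derivative -/

lemma W2.bounded {α T : ℝ} (g : W2 α T) (hα1 : α < 1) (hT : 0 ≤ T) : ∃ M, ∀ s, |g s| ≤ M := by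
  refine ⟨|g 0| + ‖g‖ * T ^ (1 - α), fun s => ?_⟩
  have h2 : 0 ≤ ‖g‖ * T ^ (1 - α) := by positivity
  by_cases hs : s ∈ Icc 0 T
  · have h1 := g.abs_sub_le le_rfl hs.1 hs.2
    rw [sub_zero] at h1
    have h3 : s ^ (1 - α) ≤ T ^ (1 - α) :=
      Real.rpow_le_rpow hs.1 hs.2 (by linarith)
    have h4 : |g s| ≤ |g 0| + |g s - g 0| := by
      have := abs_add_le (g 0) (g s - g 0)
      simpa using this
    have := mul_le_mul_of_nonneg_left h3 (norm_nonneg g)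
    linarith
  · have : g s = 0 := g.2.2.1 s hs
    rw [this, abs_zero]; positivity

lemma rightDer_eq (β : ℝ) (G : ℝ → ℝ) (y : ℝ) :
    rightDer β G y = ∫ z, (G y - G (y + z)) * fracKer β z := by
  rw [rightDer, ← integral_add_left_eq_self (fun w => (G y - G w) * fracKer β (w - y)) y]
  simp

lemma abs_rightDer_stop_le {α T : ℝ} (hα : 0 < α) (hα1 : α < 1) (g : W2 α T) {y b : ℝ}
    (hy : 0 ≤ y) (hb : b ≤ T) :
    |rightDer (1 - α) (stopAt g b) y| ≤ ‖g‖ / (1 - α) := by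
  rcases lt_or_ge y b with h | h
  · exact abs_rightDer_le hα hα1 g hy h hb
  · rw [rightDer_stop_of_le _ h, abs_zero]
    exact div_nonneg (norm_nonneg _) (by linarith)

/-- For a fixed gap `z`, averaging `G(y) - G(y+z)` over a window of length `ε` equals averaging
`G(x) - G(x+ε)` over a window of length `z`: the roles of gap and window are exchanged. Integrating
the kernel over all `z > x` then gives `x^{α-1}/(1-α)`. -/
lemma integral_rightDer_interval {α T : ℝ} (hα : 0 < α) (hα1 : α < 1) (g : W2 α T) {w b ε : ℝ}
    (hw : 0 ≤ w) (hwb : w < b) (hb : b ≤ T) (hε : 0 < ε) :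
    ∫ y in w..(w + ε), rightDer (1 - α) (stopAt g b) y
      = (1 - α)⁻¹ * ∫ x in Ioc w b, (x - w) ^ (α - 1) * (stopAt g b x - stopAt g b (x + ε)) := by
  set G := stopAt g b with hG
  have hβ : 0 < 1 - α := by linarith
  have hGm : Measurable G := measurable_stop g.measurable b
  obtain ⟨M, hM⟩ := g.bounded hα1 ((hw.trans hwb.le).trans hb)
  have hGM : ∀ s, |G s| ≤ M := fun s => hM _
  have hGi : ∀ c d, IntervalIntegrable G volume c d := fun c d =>
    (intervalIntegrable_const (c := M)).mono_fun' hGm.aestronglyMeasurable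
      (ae_of_all _ fun s => hGM s)
  set D : ℝ → ℝ := fun x => G (w + x) - G (w + x + ε) with hD
  have hDm : Measurable D := by fun_prop
  have hDM : ∀ x, |D x| ≤ 2 * M := fun x => by
    have := abs_sub (G (w + x)) (G (w + x + ε))
    linarith [hGM (w + x), hGM (w + x + ε)]
  -- Beyond `b` both values are those of the path stopped at `b`; this makes the integration domain
  -- in `x` bounded.
  have hD0 : ∀ x, b - w < x → D x = 0 := fun x hx => by
    simp only [hD, hG, stopAt]
    rw [min_eq_right (by linarith), min_eq_right (by linarith), sub_self]
  have i1 : Integrable (Function.uncurry fun y z => (G y - G (y + z)) * fracKer (1 - α) z)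
      ((volume.restrict (Ioc w (w + ε))).prod volume) := by
    refine ⟨Measurable.aestronglyMeasurable (by unfold Function.uncurry; fun_prop), ?_⟩
    rw [HasFiniteIntegral, lintegral_prod _ (Measurable.aemeasurable (by
      unfold Function.uncurry; fun_prop))]
    have hle : ∀ y ∈ Ioc w (w + ε), ∫⁻ z, ‖(G y - G (y + z)) * fracKer (1 - α) z‖ₑ
        ≤ ENNReal.ofReal (‖g‖ / (1 - α)) := by
      intro y hy
      rcases lt_or_ge y b with h | h
      · rw [← lintegral_sub_right_eq_self _ y]
        simpa using lintegral_rightDer_le hα hα1 g (hw.trans hy.1.le) h hb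
      · have : ∀ z, (G y - G (y + z)) * fracKer (1 - α) z = 0 := fun z => by
          rcases le_or_gt z 0 with hz | hz
          · rw [fracKer_of_nonpos hz, mul_zero]
          · simp only [hG, stopAt]
            rw [min_eq_right h, min_eq_right (by linarith), sub_self, zero_mul]
        simp [this]
    refine (setLIntegral_mono' measurableSet_Ioc hle).trans_lt ?_
    rw [lintegral_const]
    refine ENNReal.mul_lt_top ENNReal.ofReal_lt_top ?_
    simp
  have e1 : ∫ y in w..(w + ε), rightDer (1 - α) G y
      = ∫ z, (∫ y in w..(w + ε), (G y - G (y + z))) * fracKer (1 - α) z := by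
    simp only [rightDer_eq, intervalIntegral.integral_of_le (le_add_of_nonneg_right hε.le)]
    rw [integral_integral_swap i1]
    congr 1 with z
    rw [integral_mul_const]
  -- Regrouping four primitives: `∫_w^{w+ε} G - ∫_{w+z}^{w+z+ε} G = ∫_w^{w+z} G - ∫_{w+ε}^{w+ε+z}
  -- G`.
  have e2 : ∀ z, 0 < z → ∫ y in w..(w + ε), (G y - G (y + z)) = ∫ x in Ioc 0 z, D x := by
    intro z hz
    rw [intervalIntegral.integral_sub (hGi _ _)
      (by simpa using (hGi (w + z) (w + ε + z)).comp_add_right z),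
      intervalIntegral.integral_comp_add_right,
      intervalIntegral.integral_interval_sub_interval_comm (hGi _ _) (hGi _ _) (hGi _ _),
      ← intervalIntegral.integral_of_le hz.le, intervalIntegral.integral_sub]
    · rw [intervalIntegral.integral_comp_add_left]
      simp only [add_right_comm w _ ε]
      rw [intervalIntegral.integral_comp_add_left]
      simp
    · simpa using (hGi (w + 0) (w + z)).comp_add_left w
    · simp only [add_right_comm w _ ε]
      simpa using (hGi (w + ε + 0) (w + ε + z)).comp_add_left (w + ε)
  set D₀ : ℝ → ℝ := (Ioc 0 (b - w)).indicator D with hD₀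
  have hD₀m : Measurable D₀ := hDm.indicator measurableSet_Ioc
  have hiK : ∀ x, 0 < x → Integrable ((Ioi x).indicator (fracKer (1 - α))) := fun x hx =>
    (integrableOn_fracKer_Ioi hβ hx).integrable_indicator measurableSet_Ioi
  have hind : Measurable (fun p : ℝ × ℝ => (Ioi p.2).indicator (fracKer (1 - α)) p.1) := by
    have : (fun p : ℝ × ℝ => (Ioi p.2).indicator (fracKer (1 - α)) p.1)
        = {p : ℝ × ℝ | p.2 < p.1}.indicator (fun p => fracKer (1 - α) p.1) := by
      ext p; simp [indicator]
    rw [this]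
    exact Measurable.indicator (by fun_prop) (measurableSet_lt measurable_snd measurable_fst)
  have hpow : ∀ x : ℝ, 0 < x → (x ^ (1 - α))⁻¹ = x ^ (α - 1) := fun x hx => by
    rw [← Real.rpow_neg hx.le, neg_sub]
  have hKint : ∀ x, 0 < x → ∫ z, (Ioi x).indicator (fracKer (1 - α)) z
      = x ^ (α - 1) / (1 - α) := fun x hx => by
    rw [integral_indicator measurableSet_Ioi, integral_fracKer_Ioi hβ hx, hpow x hx]
  have i2 : Integrable (Function.uncurry fun z x => D₀ x * (Ioi x).indicator (fracKer (1 - α)) z)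
      (volume.prod volume) := by
    rw [integrable_prod_iff' (Measurable.aestronglyMeasurable (by
      unfold Function.uncurry; fun_prop))]
    simp only [Function.uncurry]
    refine ⟨ae_of_all _ fun x => ?_, ?_⟩
    · by_cases hx : x ∈ Ioc 0 (b - w)
      · exact (hiK x hx.1).const_mul _
      · simp [hD₀, indicator_of_notMem hx]
    · have h3 : Integrable (fun x => (Ioc 0 (b - w)).indicator
          (fun x => |D x| * (x ^ (α - 1) / (1 - α))) x) := by
        refine IntegrableOn.integrable_indicator ?_ measurableSet_Ioc
        refine Integrable.bdd_mul (c := 2 * M) ((integrableOn_rpow_sub_one hα _).div_const _)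
          (Measurable.aestronglyMeasurable (by fun_prop)) (ae_of_all _ fun x => ?_)
        rw [Real.norm_eq_abs, abs_abs]; exact hDM x
      refine h3.congr (ae_of_all _ fun x => ?_)
      by_cases hx : x ∈ Ioc 0 (b - w)
      · simp only [indicator_of_mem hx, hD₀, norm_mul]
        rw [integral_const_mul, ← hKint x hx.1]
        congr 2 with z
        rw [Real.norm_of_nonneg (indicator_nonneg (fun _ _ => fracKer_nonneg _ _) _)]
      · simp [hD₀, indicator_of_notMem hx]
  have e3 : ∀ z, (∫ y in w..(w + ε), (G y - G (y + z))) * fracKer (1 - α) z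
      = ∫ x, D₀ x * (Ioi x).indicator (fracKer (1 - α)) z := by
    intro z
    rcases le_or_gt z 0 with hz | hz
    · rw [fracKer_of_nonpos hz, mul_zero, ← integral_zero ℝ ℝ]
      congr 1 with x
      by_cases hx : x ∈ Ioc 0 (b - w)
      · have : ¬ x < z := by linarith [hx.1]
        simp [indicator, this]
      · simp [hD₀, indicator_of_notMem hx]
    · rw [e2 z hz, ← integral_mul_const, setIntegral_congr_set Ioo_ae_eq_Ioc.symm,
        ← integral_indicator measurableSet_Ioo]
      congr 1 with x
      by_cases h1 : 0 < x <;> by_cases h2 : x < z <;> by_cases h3 : x ≤ b - w <;>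
        simp [indicator, hD₀, h1, h2, h3]
      left; exact hD0 x (not_le.1 h3)
  rw [e1]
  simp only [e3]
  rw [integral_integral_swap i2]
  simp only [integral_const_mul]
  rw [← integral_const_mul, ← integral_indicator measurableSet_Ioc,
    ← integral_add_left_eq_self ((Ioc w b).indicator _) w]
  refine integral_congr_ae (ae_of_all _ fun x => ?_)
  by_cases hx : x ∈ Ioc 0 (b - w)
  · have hx' : w + x ∈ Ioc w b := ⟨by linarith [hx.1], by linarith [hx.2]⟩
    simp only [hD₀, indicator_of_mem hx]
    simp only [indicator_of_mem hx', add_sub_cancel_left, hKint x hx.1, hD]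
    ring
  · have hx' : w + x ∉ Ioc w b := fun h => hx ⟨by linarith [h.1], by linarith [h.2]⟩
    simp [hD₀, indicator_of_notMem hx, indicator_of_notMem hx']

/-! ### The forward integral and locality -/

lemma gsInt_eq_leftDer {α T : ℝ} (hα : 0 < α) (hα1 : α < 1) (g : W2 α T) {a b : ℝ} (ha : 0 ≤ a)
    (hb : b ≤ T) {f : ℝ → ℝ} (hf : Measurable f) (h0 : ∀ s ≤ a, f s = 0)
    (hN : fracNorm α b f < ∞) :
    gsInt α a b f g = -(α / Real.Gamma (1 - α) * ((1 - α) / Real.Gamma α))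
      * ∫ s in Ioc a b, leftDer α f s * rightDer (1 - α) (stopAt g b) s := by
  rw [gsInt_eq_integral hα hα1 g ha hb hf h0 hN, integral_incMeasure _ _
    (integrable_inc_mul_gsWeight hα hα1 g hb (integrable_inc hf hN)), ← integral_const_mul,
    ← integral_indicator measurableSet_Iic, ← integral_indicator measurableSet_Ioc]
  congr 1 with s
  simp only [mul_right_comm _ _ (fracKer _ _), integral_mul_const]
  by_cases hsb : s ≤ b
  · by_cases has : a < s
    · have e : gsWeight α g b s = -(α / Real.Gamma (1 - α) * ((1 - α) / Real.Gamma α))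
          * rightDer (1 - α) (stopAt g b) s := by
        rcases hsb.eq_or_lt with rfl | hlt
        · rw [gsWeight_of_le le_rfl, rightDer_stop_of_le _ le_rfl, mul_zero]
        · rw [gsWeight, indicator_of_mem (show s ∈ Ioo 0 b from ⟨ha.trans_lt has, hlt⟩)]
      simp only [indicator, mem_Iic, mem_Ioc, hsb, has, and_self, if_true, e, leftDer]
      ring
    · have : ∫ w, (f s - f w) * fracKer α (s - w) = 0 := by
        rw [← integral_zero ℝ ℝ]
        congr 1 with w
        rcases le_or_gt s w with hw | hw
        · simp [fracKer_of_nonpos (sub_nonpos.2 hw)]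
        · simp [h0 s (not_lt.1 has), h0 w (hw.le.trans (not_lt.1 has))]
      simp [indicator, has, this]
  · simp [indicator, hsb]

/-- The generalized Stieltjes integral is a limit of forward difference quotients. -/
lemma tendsto_forward {α T : ℝ} (hα : 0 < α) (hα1 : α < 1) (g : W2 α T) {a b : ℝ} (ha : 0 ≤ a)
    (hb : b ≤ T) {f : ℝ → ℝ} (hf : Measurable f) (h0 : ∀ s ≤ a, f s = 0)
    (hN : fracNorm α b f < ∞) :
    Tendsto (fun ε => profileConst α / (Real.Gamma (1 - α) * Real.Gamma α)
      * (ε⁻¹ * ∫ s in Ioc a b, f s * (stopAt g b (s + ε) - stopAt g b s))) (𝓝[>] 0)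
      (𝓝 (gsInt α a b f g)) := by
  rcases le_or_gt b a with hba | hab
  · rw [gsInt_of_le hba]; simp [Ioc_eq_empty_of_le hba]
  have hβ : 0 < 1 - α := by linarith
  have hT : 0 ≤ T := (ha.trans hab.le).trans hb
  obtain ⟨M, hM⟩ := g.bounded hα1 hT
  have hgm := g.measurable
  set R := rightDer (1 - α) (stopAt g b) with hR
  have hRm : Measurable R :=
    (measurable_rightDer_stop hgm).comp (measurable_const.prodMk measurable_id)
  have hRb : ∀ y, 0 ≤ y → |R y| ≤ ‖g‖ / (1 - α) := fun y hy =>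
    abs_rightDer_stop_le hα hα1 g hy hb
  have hRi : IntervalIntegrable R volume 0 (b + 1) := by
    rw [intervalIntegrable_iff_integrableOn_Ioc_of_le (by linarith)]
    refine Measure.integrableOn_of_bounded (M := ‖g‖ / (1 - α)) (by simp)
      hRm.aestronglyMeasurable ?_
    filter_upwards [ae_restrict_mem measurableSet_Ioc] with y hy using hRb y hy.1.le
  -- Replace `f` by the Riemann–Liouville integral of its left derivative and exchange the
  -- integrals; the inner one is an average of the right derivative of the stopped path.
  have key : ∀ ε, 0 < ε → profileConst α * ∫ s in Ioc a b, f s * (stopAt g b (s + ε) - stopAt g b s)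
      = -(α * (1 - α)) * ∫ s in Ioc a b, leftDer α f s * ∫ y in s..(s + ε), R y := by
    intro ε hε
    have h1 := setIntegral_rlInt_mul (a := a) (b := b) hα hf hN
      (φ := fun s => stopAt g b (s + ε) - stopAt g b s) (by fun_prop) (C := 2 * M) (fun x => by
        have := abs_sub (stopAt g b (x + ε)) (stopAt g b x)
        linarith [hM (min (x + ε) b), hM (min x b), show |stopAt g b (x + ε)| ≤ M from hM _,
          show |stopAt g b x| ≤ M from hM _])
    have h2 : ∫ s in Ioc a b, profileConst α * (f s * (stopAt g b (s + ε) - stopAt g b s))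
        = ∫ s in Ioc a b, α * (rlInt α a b f s * (stopAt g b (s + ε) - stopAt g b s)) := by
      refine setIntegral_congr_ae measurableSet_Ioc ?_
      filter_upwards [rlInt_ae_eq hα hα1 hf h0 hN] with x hx hxI
      rw [← mul_assoc, ← hx hxI, mul_assoc]
    rw [← integral_const_mul, h2, integral_const_mul, h1, ← integral_const_mul,
      ← integral_const_mul, setIntegral_congr_set Ioo_ae_eq_Ioc.symm,
      setIntegral_congr_set Ioo_ae_eq_Ioc.symm]
    refine setIntegral_congr_fun measurableSet_Ioo fun s hs => ?_
    simp only [hR]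
    rw [integral_rightDer_interval hα hα1 g (ha.trans hs.1.le) hs.2 hb hε]
    have : ∀ x, (x - s) ^ (α - 1) * (stopAt g b x - stopAt g b (x + ε))
        = -((x - s) ^ (α - 1) * (stopAt g b (x + ε) - stopAt g b x)) := fun x => by ring
    simp only [this, integral_neg]
    field_simp
  -- The averages of the bounded function `R` converge almost everywhere by Lebesgue
  -- differentiation. With `ε ≤ 1` all of them live on `[0,b+1]`.
  have hlim : Tendsto (fun ε => ∫ s in Ioc a b, leftDer α f s * (ε⁻¹ * ∫ y in s..(s + ε), R y))
      (𝓝[>] 0) (𝓝 (∫ s in Ioc a b, leftDer α f s * R s)) := by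
    have hDi : IntegrableOn (leftDer α f) (Ioc a b) :=
      (integrableOn_leftDer hf hN).mono_set Ioc_subset_Iic_self
    have hRI : ∀ s ε, 0 < s → s ≤ b → 0 ≤ ε → ε ≤ 1 →
        (∫ y in s..(s + ε), R y) = (∫ y in 0..(s + ε), R y) - ∫ y in 0..s, R y := by
      intro s ε hs hsb hε hε1
      rw [intervalIntegral.integral_interval_sub_left] <;>
      refine hRi.mono_set (uIcc_subset_uIcc ?_ ?_) <;> rw [uIcc_of_le (by linarith)] <;>
        constructor <;> linarith
    have hsm : ∀ ε, 0 < ε → ε ≤ 1 → AEStronglyMeasurable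
        (fun s => ∫ y in s..(s + ε), R y) (volume.restrict (Ioc a b)) := by
      intro ε hε hε1
      have hc : ContinuousOn (fun x => ∫ y in 0..x, R y) (Icc 0 (b + 1)) := by
        have := intervalIntegral.continuousOn_primitive_interval (μ := volume) (f := R) (a := 0)
          (b := b + 1) (by
            rw [uIcc_of_le (by linarith),
              ← intervalIntegrable_iff_integrableOn_Icc_of_le (by linarith)]
            exact hRi)
        rwa [uIcc_of_le (by linarith)] at this
      have hc1 : ContinuousOn (fun s => (∫ y in 0..(s + ε), R y) - ∫ y in 0..s, R y) (Ioc a b) := by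
        refine ContinuousOn.sub (hc.comp (by fun_prop) fun s hs => ?_) (hc.mono fun s hs => ?_)
        · exact ⟨by linarith [hs.1], by linarith [hs.2]⟩
        · exact ⟨by linarith [hs.1], by linarith [hs.2]⟩
      refine (hc1.aestronglyMeasurable measurableSet_Ioc).congr ?_
      filter_upwards [ae_restrict_mem measurableSet_Ioc] with s hs
      rw [hRI s ε (ha.trans_lt hs.1) hs.2 hε.le hε1]
    refine tendsto_integral_filter_of_dominated_convergence
      (fun s => ‖leftDer α f s‖ * (‖g‖ / (1 - α))) ?_ ?_ (hDi.norm.mul_const _) ?_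
    · filter_upwards [Ioc_mem_nhdsGT one_pos] with ε hε
      exact hDi.aestronglyMeasurable.mul ((hsm ε hε.1 hε.2).const_mul _)
    · filter_upwards [self_mem_nhdsWithin] with ε hε
      have hε' : 0 < ε := hε
      filter_upwards [ae_restrict_mem measurableSet_Ioc] with s hs
      rw [norm_mul]
      gcongr
      rw [norm_mul, norm_inv, Real.norm_of_nonneg hε'.le, inv_mul_le_iff₀ hε']
      have := intervalIntegral.norm_integral_le_of_norm_le_const (f := R) (a := s) (b := s + ε)
        (C := ‖g‖ / (1 - α)) (fun y hy => by
          rw [uIoc_of_le (by linarith)] at hy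
          exact hRb y (by linarith [hs.1, hy.1]))
      rw [add_sub_cancel_left, abs_of_pos hε'] at this
      linarith
    · filter_upwards [ae_restrict_mem measurableSet_Ioc,
        ae_restrict_of_ae hRi.ae_hasDerivAt_integral] with s hs hd
      refine Tendsto.const_mul _ ?_
      have h3 := (hd (by rw [uIcc_of_le (by linarith)]; constructor <;> linarith [hs.1, hs.2]) 0
        left_mem_uIcc).tendsto_slope_zero_right
      refine h3.congr' ?_
      filter_upwards [Ioc_mem_nhdsGT one_pos] with ε hε
      rw [hRI s ε (ha.trans_lt hs.1) hs.2 hε.1.le hε.2, smul_eq_mul]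
  rw [gsInt_eq_leftDer hα hα1 g ha hb hf h0 hN]
  refine (hlim.const_mul (-(α / Real.Gamma (1 - α) * ((1 - α) / Real.Gamma α)))).congr' ?_
  filter_upwards [self_mem_nhdsWithin] with ε hε
  have h4 : ∀ s, leftDer α f s * (ε⁻¹ * ∫ y in s..(s + ε), R y)
      = ε⁻¹ * (leftDer α f s * ∫ y in s..(s + ε), R y) := fun s => by ring
  simp only [h4]
  rw [integral_const_mul]
  have h5 := key ε hε
  have := (Real.Gamma_pos_of_pos hα).ne'
  have := (Real.Gamma_pos_of_pos hβ).ne'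
  calc _ = ε⁻¹ / (Real.Gamma (1 - α) * Real.Gamma α)
        * (-(α * (1 - α)) * ∫ s in Ioc a b, leftDer α f s * ∫ y in s..(s + ε), R y) := by
        field_simp
    _ = _ := by rw [← h5]; field_simp

/-- For `w < u < s` the increment of `f` is `-f(w)`. Integrating the kernel over `s ∈ (u,b]` gives
`(u-w)^{-α}/α` up to the tail beyond `b`, which is at most `(b-u)^{-α}/α`. So the seminorm up to `b
> u` forces `f` to be small near `u`. -/
lemma integrableOn_mul_rpow_neg {α a u b : ℝ} (hα : 0 < α) (hub : u < b) {f : ℝ → ℝ}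
    (hf : Measurable f) (h0 : ∀ s ≤ a, f s = 0) (h1 : ∀ s, u < s → f s = 0)
    (hN : fracNorm α b f < ∞) :
    IntegrableOn (fun s => f s * ((u - s) ^ α)⁻¹) (Ioo a u) := by
  refine ⟨Measurable.aestronglyMeasurable (by fun_prop), ?_⟩
  have hfi := integrableOn_of_fracNorm hα hf h0 hN
  have hA : ∫⁻ w in Ioo a u, ‖f w‖ₑ * ∫⁻ s in Ioc u b, ENNReal.ofReal (fracKer α (s - w)) < ∞ := by
    have h2 : ∫⁻ s in Ioc u b,
        ∫⁻ w in Ioo a u, ‖f w‖ₑ * ENNReal.ofReal (fracKer α (s - w)) < ∞ := by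
      refine lt_of_le_of_lt ?_ hN
      rw [fracNorm, lintegral_incMeasure _ _ (by fun_prop)]
      refine (setLIntegral_mono' measurableSet_Ioc fun s hs => ?_).trans
        (lintegral_mono_set Ioc_subset_Iic_self)
      refine (lintegral_mono fun w => ?_).trans (setLIntegral_le_lintegral _ _)
      simp [h1 s hs.1]
    rw [lintegral_lintegral_swap (Measurable.aemeasurable (by
      unfold Function.uncurry; fun_prop))] at h2
    refine lt_of_eq_of_lt (lintegral_congr fun w => ?_) h2
    rw [lintegral_const_mul _ (by fun_prop)]
  have hB : ∫⁻ w in Ioo a u, ‖f w‖ₑ * ENNReal.ofReal (((b - u) ^ α)⁻¹ / α) < ∞ := by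
    rw [lintegral_mul_const _ (by fun_prop)]
    exact ENNReal.mul_lt_top ((lintegral_mono_set (show Ioo a u ⊆ Ioc a b from
      fun s hs => ⟨hs.1, hs.2.le.trans hub.le⟩)).trans_lt hfi.2) ENNReal.ofReal_lt_top
  have hle : ∀ w ∈ Ioo a u, ‖f w * ((u - w) ^ α)⁻¹‖ₑ ≤ ENNReal.ofReal α *
      (‖f w‖ₑ * (∫⁻ s in Ioc u b, ENNReal.ofReal (fracKer α (s - w)))
        + ‖f w‖ₑ * ENNReal.ofReal (((b - u) ^ α)⁻¹ / α)) := by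
    intro w hw
    have huw : 0 < u - w := sub_pos.2 hw.2
    have hbu : 0 < b - u := sub_pos.2 hub
    have h3 : ENNReal.ofReal (((u - w) ^ α)⁻¹ / α)
        ≤ (∫⁻ s in Ioc u b, ENNReal.ofReal (fracKer α (s - w)))
          + ENNReal.ofReal (((b - u) ^ α)⁻¹ / α) := by
      rw [← lintegral_fracKer_Ioi_sub hα hw.2, ← Ioc_union_Ioi_eq_Ioi hub.le]
      refine (lintegral_union_le _ _ _).trans (add_le_add le_rfl ?_)
      rw [lintegral_fracKer_Ioi_sub hα (hw.2.trans hub)]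
      apply ENNReal.ofReal_le_ofReal
      gcongr
      exact hw.2.le
    rw [enorm_mul, Real.enorm_of_nonneg (by positivity : (0:ℝ) ≤ ((u - w) ^ α)⁻¹), ← mul_add,
      mul_left_comm]
    gcongr
    calc ENNReal.ofReal ((u - w) ^ α)⁻¹
        = ENNReal.ofReal α * ENNReal.ofReal (((u - w) ^ α)⁻¹ / α) := by
          rw [← ENNReal.ofReal_mul hα.le, mul_div_cancel₀ _ hα.ne']
      _ ≤ _ := by gcongr
  refine (setLIntegral_mono' measurableSet_Ioo hle).trans_lt ?_
  rw [lintegral_const_mul' _ _ ENNReal.ofReal_ne_top, lintegral_add_right' _ (by fun_prop)]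
  exact ENNReal.mul_lt_top ENNReal.ofReal_lt_top (ENNReal.add_lt_top.2 ⟨hA, hB⟩)

/-- Locality: an integrand vanishing after time `u` can be integrated up to time `u`. -/
lemma gsInt_eq_of_vanish {α T : ℝ} (hα : 0 < α) (hα1 : α < 1) (g : W2 α T) {a u b : ℝ}
    (ha : 0 ≤ a) (hau : a ≤ u) (hub : u ≤ b) (hb : b ≤ T) {f : ℝ → ℝ} (hf : Measurable f)
    (h0 : ∀ s ≤ a, f s = 0) (h1 : ∀ s, u < s → f s = 0) (hN : fracNorm α b f < ∞) :
    gsInt α a b f g = gsInt α a u f g := by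
  rcases hub.eq_or_lt with rfl | hub'
  · rfl
  have hT : 0 ≤ T := ((ha.trans hau).trans hub).trans hb
  obtain ⟨M, hM⟩ := g.bounded hα1 hT
  have hgm := g.measurable
  have tb := tendsto_forward hα hα1 g ha hb hf h0 hN
  have tu := tendsto_forward hα hα1 g ha (hub.trans hb) hf h0 ((fracNorm_mono hub f).trans_lt hN)
  -- Both integrals are limits of forward quotients, and the difference of the quotients tends to
  -- zero. The integral up to `u` is added on both sides so that uniqueness of limits gives the
  -- desired equality itself.
  refine tendsto_nhds_unique_of_eventuallyEq (tb.sub tu |>.add_const (gsInt α a u f g))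
    (g := fun ε => profileConst α / (Real.Gamma (1 - α) * Real.Gamma α)
      * (∫ s in Ioo a u, ε⁻¹ * (f s * (stopAt g b (s + ε) - stopAt g u (s + ε))))
      + gsInt α a u f g) (a := gsInt α a b f g - gsInt α a u f g + gsInt α a u f g)
    (b := gsInt α a u f g) ?_ ?_ |> fun h => by simpa using h
  · have hz : Tendsto (fun ε =>
        ∫ s in Ioo a u, ε⁻¹ * (f s * (stopAt g b (s + ε) - stopAt g u (s + ε))))
        (𝓝[>] 0) (𝓝 (∫ s in Ioo a u, (0:ℝ))) := by
      refine tendsto_integral_filter_of_dominated_convergence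
        (fun s => ‖g‖ * ‖f s * ((u - s) ^ α)⁻¹‖)
        (Eventually.of_forall fun ε => Measurable.aestronglyMeasurable (by fun_prop)) ?_
        ((integrableOn_mul_rpow_neg hα hub' hf h0 h1 hN).norm.const_mul _) ?_
      · filter_upwards [self_mem_nhdsWithin] with ε hε
        have hε' : 0 < ε := hε
        filter_upwards [ae_restrict_mem measurableSet_Ioo] with s hs
        have hus : 0 < u - s := sub_pos.2 hs.2
        rcases le_or_gt (s + ε) u with h | h
        · have : stopAt g b (s + ε) - stopAt g u (s + ε) = 0 := by
            simp [stopAt, h, h.trans hub]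
          rw [this]; simp only [mul_zero, norm_zero]; positivity
        · have h2 : |stopAt g b (s + ε) - stopAt g u (s + ε)| ≤ ‖g‖ * ε ^ (1 - α) := by
            simp only [stopAt, min_eq_right h.le]
            refine (g.abs_sub_le ((ha.trans hau)) (le_min h.le hub)
              ((min_le_right _ _).trans hb)).trans ?_
            gcongr
            · exact sub_nonneg.2 (le_min h.le hub)
            · linarith [min_le_left (s + ε) b, hs.2]
          rw [norm_mul, norm_mul, norm_mul, norm_inv, Real.norm_of_nonneg hε'.le,
            Real.norm_of_nonneg (by positivity : 0 ≤ ((u - s) ^ α)⁻¹), Real.norm_eq_abs (_ - _)]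
          -- The two stopped paths differ at `s+ε` only if `u-s < ε`, and then by at most `‖g‖
          -- ε^{1-α}`. After division by `ε` this is at most `‖g‖ (u-s)^{-α}`, integrable against
          -- `f` by the preceding lemma. For fixed `s < u` it is zero once `ε ≤ u-s`.
          have h3 : ((ε) ^ α)⁻¹ ≤ ((u - s) ^ α)⁻¹ := by
            gcongr
            linarith
          calc ε⁻¹ * (‖f s‖ * |stopAt g b (s + ε) - stopAt g u (s + ε)|)
              ≤ ε⁻¹ * (‖f s‖ * (‖g‖ * ε ^ (1 - α))) := by gcongr
            _ = ‖g‖ * (‖f s‖ * (ε ^ α)⁻¹) := by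
                rw [Real.rpow_sub hε', Real.rpow_one]
                field_simp
            _ ≤ _ := by gcongr
      · filter_upwards [ae_restrict_mem measurableSet_Ioo] with s hs
        refine tendsto_const_nhds.congr' ?_
        have : Ioc 0 (u - s) ∈ 𝓝[>] (0:ℝ) := Ioc_mem_nhdsGT (sub_pos.2 hs.2)
        filter_upwards [this] with ε hε
        have h : s + ε ≤ u := by linarith [hε.2]
        simp [stopAt, h, h.trans hub]
    simpa using (hz.const_mul (profileConst α / (Real.Gamma (1 - α) * Real.Gamma α))).add_const
      (gsInt α a u f g)
  · filter_upwards [self_mem_nhdsWithin] with ε hε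
    have hst : ∀ c s, |stopAt g c s| ≤ M := fun c s => hM _
    have hfi := integrableOn_of_fracNorm hα hf h0 hN
    have hint : ∀ c, IntegrableOn
        (fun s => f s * (stopAt g c (s + ε) - stopAt g c s)) (Ioc a b) := by
      intro c
      refine hfi.mul_bdd (c := 2 * M) (Measurable.aestronglyMeasurable (by fun_prop))
        (ae_of_all _ fun s => ?_)
      have := abs_sub (stopAt g c (s + ε)) (stopAt g c s)
      rw [Real.norm_eq_abs]
      linarith [hst c (s + ε), hst c s]
    have hsub : Ioc a u ⊆ Ioc a b := Ioc_subset_Ioc_right hub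
    have e1 : ∫ s in Ioc a b, f s * (stopAt g b (s + ε) - stopAt g b s)
        = ∫ s in Ioc a u, f s * (stopAt g b (s + ε) - stopAt g b s) := by
      refine setIntegral_eq_of_subset_of_forall_sdiff_eq_zero measurableSet_Ioc hsub
        fun s hs => ?_
      have : u < s := by
        by_contra h
        exact hs.2 ⟨hs.1.1, not_lt.1 h⟩
      rw [h1 s this, zero_mul]
    rw [e1, add_left_inj, ← mul_sub, ← mul_sub, ← integral_sub ((hint b).mono_set hsub)
      ((hint u).mono_set hsub), integral_const_mul, ← integral_Ioc_eq_integral_Ioo]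
    congr 2
    refine setIntegral_congr_fun measurableSet_Ioc fun s hs => ?_
    simp only [stopAt, min_eq_left hs.2, min_eq_left (hs.2.trans hub)]
    ring

/-! ### The space `W_1^α` -/

lemma W1.measurable {α a b : ℝ} (f : W1 α a b) : Measurable f := f.2.1

lemma W1.eNorm1_eq {α a b : ℝ} (f : W1 α a b) : eNorm1 α a b f = ENNReal.ofReal ‖f‖ :=
  (ENNReal.ofReal_toReal f.2.2.2.ne).symm

lemma le_eNorm1 {α a b u : ℝ} (f : ℝ → ℝ) (hu : u ∈ Icc a b) :
    ENNReal.ofReal |f u| + ∫⁻ v in Ioc a u, ENNReal.ofReal (|f u - f v| / (u - v) ^ (α + 1))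
      ≤ eNorm1 α a b f :=
  le_iSup₂ (f := fun u (_ : u ∈ Icc a b) =>
      (ENNReal.ofReal |f u| + ∫⁻ v in Ioc a u, ENNReal.ofReal (|f u - f v| / (u - v) ^ (α + 1))))
      u hu

lemma W1.le_norm {α a b u : ℝ} (f : W1 α a b) (hu : u ∈ Icc a b) :
    ENNReal.ofReal |f u| + ∫⁻ v in Ioc a u, ENNReal.ofReal (|f u - f v| / (u - v) ^ (α + 1))
      ≤ ENNReal.ofReal ‖f‖ := f.eNorm1_eq ▸ le_eNorm1 f hu

lemma abs_le_of_eNorm1_le {α a b u M : ℝ} {f : ℝ → ℝ} (hM : 0 ≤ M)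
    (h : eNorm1 α a b f ≤ ENNReal.ofReal M) (hu : u ∈ Icc a b) : |f u| ≤ M := by
  have := (le_self_add.trans (le_eNorm1 f hu)).trans h
  rwa [ENNReal.ofReal_le_ofReal_iff hM] at this

lemma W1.abs_le {α a b : ℝ} (f : W1 α a b) (u : ℝ) : |f u| ≤ ‖f‖ := by
  by_cases hu : u ∈ Icc a b
  · exact abs_le_of_eNorm1_le (norm_nonneg _) f.eNorm1_eq.le hu
  · have : f u = 0 := f.2.2.1 u hu
    rw [this, abs_zero]; exact norm_nonneg _

lemma eNorm1_congr {α a b : ℝ} {f f' : ℝ → ℝ} (h : EqOn f f' (Icc a b)) :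
    eNorm1 α a b f = eNorm1 α a b f' := by
  unfold eNorm1
  refine iSup_congr fun u => iSup_congr fun hu => ?_
  rw [h hu]
  congr 1
  refine setLIntegral_congr_fun measurableSet_Ioc fun v hv => ?_
  simp only [h (⟨hv.1.le, hv.2.trans hu.2⟩ : v ∈ Icc a b)]

/-- The element of `W_1^α(a,b)` given by a function with finite norm. -/
def toW1 (α a b : ℝ) (f : ℝ → ℝ) (hf : Measurable ((Icc a b).indicator f))
    (h : eNorm1 α a b f < ∞) : W1 α a b :=
  ⟨(Icc a b).indicator f, hf, fun _ ht => indicator_of_notMem ht _,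
    (eNorm1_congr (fun _ hu => indicator_of_mem hu f)).trans_lt h⟩

lemma toW1_apply {α a b : ℝ} {f : ℝ → ℝ} {hf : Measurable ((Icc a b).indicator f)}
    {h : eNorm1 α a b f < ∞} {t : ℝ} (ht : t ∈ Icc a b) : toW1 α a b f hf h t = f t :=
  indicator_of_mem ht f

lemma W1.ext {α a b : ℝ} {f f' : W1 α a b} (h : ∀ t ∈ Icc a b, f t = f' t) : f = f' := by
  refine Subtype.ext (funext fun t => ?_)
  by_cases ht : t ∈ Icc a b
  · exact h t ht
  · exact (f.2.2.1 t ht).trans (f'.2.2.1 t ht).symm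

lemma W1.add_apply {α a b : ℝ} (f f' : W1 α a b) (t : ℝ) : (f + f') t = f t + f' t := rfl

lemma W1.sub_apply {α a b : ℝ} (f f' : W1 α a b) (t : ℝ) : (f - f') t = f t - f' t := rfl

lemma W1.smul_apply {α a b : ℝ} (c : ℝ) (f : W1 α a b) (t : ℝ) : (c • f) t = c * f t := rfl

lemma W2.add_coe {α T : ℝ} (f f' : W2 α T) : ((f + f' : W2 α T) : ℝ → ℝ) = f + f' := rfl

lemma W2.smul_coe {α T : ℝ} (c : ℝ) (f : W2 α T) :
    ((c • f : W2 α T) : ℝ → ℝ) = c • (f : ℝ → ℝ) := rfl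

lemma W1.norm_le {α a b C : ℝ} (f : W1 α a b) (hC : 0 ≤ C)
    (h : eNorm1 α a b f ≤ ENNReal.ofReal C) : ‖f‖ ≤ C := by
  rwa [f.eNorm1_eq, ENNReal.ofReal_le_ofReal_iff hC] at h

lemma eNorm1_le_iff {α a b : ℝ} {f : ℝ → ℝ} {C : ℝ≥0∞} : eNorm1 α a b f ≤ C ↔
    ∀ u ∈ Icc a b, ENNReal.ofReal |f u|
      + ∫⁻ v in Ioc a u, ENNReal.ofReal (|f u - f v| / (u - v) ^ (α + 1)) ≤ C := by
  unfold eNorm1; exact iSup₂_le_iff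

/-- A function whose size and increments are dominated by those of elements of `W_1^α`. -/
lemma eNorm1_le_of_increments {α a b A B D : ℝ} {F : ℝ → ℝ} (δ y : W1 α a b) (hA : 0 ≤ A)
    (hB : 0 ≤ B) (hD : 0 ≤ D) (h1 : ∀ u ∈ Icc a b, |F u| ≤ A * |δ u| + D)
    (h2 : ∀ u ∈ Icc a b, ∀ v ∈ Icc a b, |F u - F v| ≤ A * |δ u - δ v| + B * |y u - y v|) :
    eNorm1 α a b F ≤ ENNReal.ofReal (A * ‖δ‖ + B * ‖y‖ + D) := by
  have hδm := δ.measurable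
  have hym := y.measurable
  rw [eNorm1_le_iff]
  intro u hu
  have i1 : ENNReal.ofReal |F u| ≤ ENNReal.ofReal A * ENNReal.ofReal |δ u| + ENNReal.ofReal D := by
    rw [← ENNReal.ofReal_mul hA, ← ENNReal.ofReal_add (by positivity) hD]
    exact ENNReal.ofReal_le_ofReal (h1 u hu)
  have i2 : ∫⁻ v in Ioc a u, ENNReal.ofReal (|F u - F v| / (u - v) ^ (α + 1))
      ≤ ENNReal.ofReal A * (∫⁻ v in Ioc a u, ENNReal.ofReal (|δ u - δ v| / (u - v) ^ (α + 1)))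
      + ENNReal.ofReal B * ∫⁻ v in Ioc a u, ENNReal.ofReal (|y u - y v| / (u - v) ^ (α + 1)) := by
    rw [← lintegral_const_mul' _ _ ENNReal.ofReal_ne_top,
      ← lintegral_const_mul' _ _ ENNReal.ofReal_ne_top, ← lintegral_add_left (by fun_prop)]
    refine setLIntegral_mono' measurableSet_Ioc fun v hv => ?_
    have huv : 0 ≤ u - v := sub_nonneg.2 hv.2
    rw [← ENNReal.ofReal_mul hA, ← ENNReal.ofReal_mul hB, ← ENNReal.ofReal_add (by positivity)
      (by positivity), ← mul_div_assoc, ← mul_div_assoc, ← add_div]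
    apply ENNReal.ofReal_le_ofReal
    gcongr
    exact h2 u hu v ⟨hv.1.le, hv.2.trans hu.2⟩
  rw [ENNReal.ofReal_add (by positivity) hD, ENNReal.ofReal_add (by positivity) (by positivity),
    ENNReal.ofReal_mul hA, ENNReal.ofReal_mul hB]
  calc _ ≤ (ENNReal.ofReal A * ENNReal.ofReal |δ u| + ENNReal.ofReal D) + _ := add_le_add i1 i2
    _ = ENNReal.ofReal A * (ENNReal.ofReal |δ u|
          + ∫⁻ v in Ioc a u, ENNReal.ofReal (|δ u - δ v| / (u - v) ^ (α + 1)))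
        + ENNReal.ofReal B * (∫⁻ v in Ioc a u, ENNReal.ofReal (|y u - y v| / (u - v) ^ (α + 1)))
        + ENNReal.ofReal D := by ring
    _ ≤ _ := by
      gcongr
      · exact δ.le_norm hu
      · exact le_add_self.trans (y.le_norm hu)

lemma lintegral_inv_rpow {γ a b : ℝ} (hγ : γ < 1) (hab : a ≤ b) :
    ∫⁻ s in Ioc a b, ENNReal.ofReal ((s - a) ^ γ)⁻¹
      = ENNReal.ofReal ((b - a) ^ (1 - γ) / (1 - γ)) := by
  have h := setIntegral_sub_rpow (α := 1 - γ) (s := a) (v := b) (by linarith) hab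
  rw [← h, ofReal_integral_eq_lintegral_ofReal]
  · refine setLIntegral_congr_fun measurableSet_Ioc fun s hs => ?_
    rw [← Real.rpow_neg (sub_nonneg.2 hs.1.le)]
    congr 2; ring
  · rw [← IntegrableOn, ← intervalIntegrable_iff_integrableOn_Ioc_of_le hab]
    have := (intervalIntegral.intervalIntegrable_rpow' (r := 1 - γ - 1) (a := a - a) (b := b - a)
      (by linarith)).comp_sub_right a
    simpa using this
  · filter_upwards [ae_restrict_mem measurableSet_Ioc] with s hs
    exact Real.rpow_nonneg (sub_nonneg.2 hs.1.le) _

lemma lintegral_inv_rpow_right {γ a b : ℝ} (hγ : γ < 1) (hab : a ≤ b) :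
    ∫⁻ s in Ioc a b, ENNReal.ofReal ((b - s) ^ γ)⁻¹
      = ENNReal.ofReal ((b - a) ^ (1 - γ) / (1 - γ)) := by
  rw [← lintegral_inv_rpow hγ hab, setLIntegral_congr Ioo_ae_eq_Ioc.symm,
    setLIntegral_congr Ioo_ae_eq_Ioc.symm, ← lintegral_indicator measurableSet_Ioo,
    ← lintegral_indicator measurableSet_Ioo,
    ← lintegral_sub_left_eq_self ((Ioo a b).indicator _) (a + b)]
  refine lintegral_congr fun s => ?_
  by_cases hs : s ∈ Ioo a b
  · have : a + b - s ∈ Ioo a b := ⟨by linarith [hs.2], by linarith [hs.1]⟩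
    rw [indicator_of_mem hs, indicator_of_mem this]
    congr 3; ring
  · have : a + b - s ∉ Ioo a b := fun h => hs ⟨by linarith [h.2], by linarith [h.1]⟩
    rw [indicator_of_notMem hs, indicator_of_notMem this]

/-- Hölder functions of exponent `1-α > α` have finite `W_1^α`-norm. -/
lemma eNorm1_le_of_holder {α T A B : ℝ} (hα' : α < 1 / 2) (hA : 0 ≤ A) (hB : 0 ≤ B)
    {F : ℝ → ℝ} (h1 : ∀ t ∈ Icc 0 T, |F t| ≤ B)
    (h2 : ∀ s t, 0 ≤ s → s ≤ t → t ≤ T → |F t - F s| ≤ A * (t - s) ^ (1 - α)) :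
    eNorm1 α 0 T F ≤ ENNReal.ofReal (B + A * (T ^ (1 - 2 * α) / (1 - 2 * α))) := by
  rw [eNorm1_le_iff]
  intro t ht
  have hc : 0 < 1 - 2 * α := by linarith
  have hT : 0 ≤ T := ht.1.trans ht.2
  rw [ENNReal.ofReal_add hB (by positivity), ENNReal.ofReal_mul hA]
  refine add_le_add (ENNReal.ofReal_le_ofReal (h1 t ht)) ?_
  have h3 : ∫⁻ v in Ioc 0 t, ENNReal.ofReal (|F t - F v| / (t - v) ^ (α + 1))
      ≤ ENNReal.ofReal A * ∫⁻ v in Ioc 0 t, ENNReal.ofReal ((t - v) ^ (2 * α))⁻¹ := by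
    rw [← lintegral_const_mul' _ _ ENNReal.ofReal_ne_top, setLIntegral_congr Ioo_ae_eq_Ioc.symm,
      setLIntegral_congr Ioo_ae_eq_Ioc.symm]
    refine setLIntegral_mono' measurableSet_Ioo fun v hv => ?_
    have htv : 0 < t - v := sub_pos.2 hv.2
    rw [← ENNReal.ofReal_mul hA]
    apply ENNReal.ofReal_le_ofReal
    rw [div_le_iff₀ (by positivity), mul_assoc, ← Real.rpow_neg htv.le, ← Real.rpow_add htv]
    refine (h2 v t hv.1.le hv.2.le ht.2).trans (le_of_eq ?_)
    congr 2; ring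
  refine h3.trans ?_
  rw [lintegral_inv_rpow_right (by linarith) ht.1, sub_zero]
  gcongr
  · exact ht.1
  · exact ht.2

lemma measurable_indicator_of_holder {γ T A : ℝ} (hγ : 0 < γ) {F : ℝ → ℝ}
    (h2 : ∀ s t, 0 ≤ s → s ≤ t → t ≤ T → |F t - F s| ≤ A * (t - s) ^ γ) :
    Measurable ((Icc 0 T).indicator F) := by
  have hc : ContinuousOn F (Icc 0 T) := by
    have h3 : ∀ s ∈ Icc 0 T, ∀ t ∈ Icc 0 T, |F t - F s| ≤ A * |t - s| ^ γ := by
      intro s hs t ht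
      rcases le_total s t with h | h
      · rw [abs_of_nonneg (sub_nonneg.2 h)]
        exact h2 s t hs.1 h ht.2
      · rw [abs_sub_comm, abs_sub_comm t, abs_of_nonneg (sub_nonneg.2 h)]
        exact h2 t s ht.1 h hs.2
    intro s hs
    rw [ContinuousWithinAt, tendsto_iff_norm_sub_tendsto_zero]
    have h4 : Tendsto (fun t => A * |t - s| ^ γ) (𝓝[Icc 0 T] s) (𝓝 0) := by
      have : ContinuousAt (fun t => A * |t - s| ^ γ) s :=
        ContinuousAt.mul continuousAt_const (ContinuousAt.rpow_const (by fun_prop) (Or.inr hγ.le))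
      have h5 : Tendsto (fun t => A * |t - s| ^ γ) (𝓝 s) (𝓝 (A * |s - s| ^ γ)) := this
      simp only [sub_self, abs_zero, Real.zero_rpow hγ.ne', mul_zero] at h5
      exact h5.mono_left nhdsWithin_le_nhds
    refine squeeze_zero' (Eventually.of_forall fun t => norm_nonneg _) ?_ h4
    filter_upwards [self_mem_nhdsWithin] with t ht
    exact h3 s hs t ht
  have := hc.measurable_piecewise (g := fun _ => (0:ℝ)) continuousOn_const measurableSet_Icc
  rwa [← piecewise_eq_indicator]

/-! ### Integrals of elements of `W_1^α` -/

lemma measurable_indicator_Ioc {f : ℝ → ℝ} (hf : Measurable f) (a b : ℝ) :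
    Measurable ((Ioc a b).indicator f) := hf.indicator measurableSet_Ioc

/-- On `(a,b]` the value of `f` costs `M (s-a)^{-α}/α` and its increments cost `M`. For `s` in
`(b,c]` the cut-off function only sees the jump at `b`, of cost `M (s-b)^{-α}/α`, integrable since
`α < 1`. The case `c > b` is what locality requires. -/
lemma fracNorm_indicator_le {α T a b c M : ℝ} (hα : 0 < α) (hα1 : α < 1) {f : ℝ → ℝ}
    (hf : Measurable f) (hM : 0 ≤ M) (h : eNorm1 α 0 T f ≤ ENNReal.ofReal M) (ha : 0 ≤ a)
    (hab : a ≤ b) (hbc : b ≤ c) (hbT : b ≤ T) :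
    fracNorm α c ((Ioc a b).indicator f) ≤ ENNReal.ofReal M *
      (ENNReal.ofReal (α⁻¹ * ((b - a) ^ (1 - α) / (1 - α)) + (b - a))
        + ENNReal.ofReal (α⁻¹ * ((c - b) ^ (1 - α) / (1 - α)))) := by
  have hα0 : 0 ≤ α⁻¹ := by positivity
  have hfm := measurable_indicator_Ioc hf a b
  rw [fracNorm_eq (a := a) hα hfm (fun s hs => by simp [hs.not_gt]),
    ← Ioc_union_Ioc_eq_Ioc hab hbc]
  refine (lintegral_union_le _ _ _).trans ?_
  rw [mul_add]
  refine add_le_add ?_ ?_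
  · have e : ENNReal.ofReal (α⁻¹ * ((b - a) ^ (1 - α) / (1 - α)) + (b - a))
        = ∫⁻ s in Ioc a b, (ENNReal.ofReal α⁻¹ * ENNReal.ofReal ((s - a) ^ α)⁻¹ + 1) := by
      have : 0 ≤ (b - a) := sub_nonneg.2 hab
      have : 0 < 1 - α := by linarith
      rw [lintegral_add_right _ measurable_const, lintegral_const_mul' _ _ ENNReal.ofReal_ne_top,
        lintegral_inv_rpow hα1 hab, ENNReal.ofReal_add (by positivity) (by positivity),
        ENNReal.ofReal_mul hα0]
      simp
    rw [e, ← lintegral_const_mul' _ _ ENNReal.ofReal_ne_top]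
    refine setLIntegral_mono' measurableSet_Ioc fun s hs => ?_
    have hs0 : s ∈ Icc 0 T := ⟨ha.trans hs.1.le, hs.2.trans hbT⟩
    have hsa : 0 ≤ s - a := sub_nonneg.2 hs.1.le
    rw [mul_add, mul_one]
    refine add_le_add ?_ ?_
    · rw [indicator_of_mem hs, mul_comm, div_eq_mul_inv, ENNReal.ofReal_mul (abs_nonneg _),
        mul_left_comm]
      gcongr
      exact abs_le_of_eNorm1_le hM h hs0
    · have : ∫⁻ y in Ioc a s, ENNReal.ofReal (|(Ioc a b).indicator f s - (Ioc a b).indicator f y|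
            / (s - y) ^ (α + 1))
          = ∫⁻ y in Ioc a s, ENNReal.ofReal (|f s - f y| / (s - y) ^ (α + 1)) := by
        refine setLIntegral_congr_fun measurableSet_Ioc fun y hy => ?_
        have hy' : y ∈ Ioc a b := ⟨hy.1, hy.2.trans hs.2⟩
        simp only [indicator_of_mem hs, indicator_of_mem hy']
      rw [this]
      exact ((lintegral_mono_set (Ioc_subset_Ioc_left ha)).trans le_add_self).trans
        ((le_eNorm1 f hs0).trans h)
  · rw [ENNReal.ofReal_mul hα0, ← lintegral_inv_rpow hα1 hbc, ← lintegral_const_mul' _ _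
      ENNReal.ofReal_ne_top, ← lintegral_const_mul' _ _ ENNReal.ofReal_ne_top]
    refine setLIntegral_mono' measurableSet_Ioc fun s hs => ?_
    have hs' : s ∉ Ioc a b := fun h => hs.1.not_ge h.2
    have hsb : 0 ≤ s - b := sub_nonneg.2 hs.1.le
    simp only [indicator_of_notMem hs', abs_zero, zero_div, ENNReal.ofReal_zero, zero_mul, zero_add,
      zero_sub, abs_neg]
    have h3 : ∫⁻ y in Ioc a s, ENNReal.ofReal (|(Ioc a b).indicator f y| / (s - y) ^ (α + 1))
        ≤ ENNReal.ofReal M * ∫⁻ y in Iio b, ENNReal.ofReal (fracKer α (s - y)) := by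
      rw [← lintegral_const_mul' _ _ ENNReal.ofReal_ne_top, setLIntegral_congr Iio_ae_eq_Iic,
        ← lintegral_indicator measurableSet_Iic, ← lintegral_indicator measurableSet_Ioc]
      refine lintegral_mono fun y => ?_
      by_cases hy : y ∈ Ioc a b
      · have hys : 0 < s - y := by linarith [hy.2, hs.1]
        have hyb : y ∈ Iic b := hy.2
        have hy2 : y ∈ Ioc a s := ⟨hy.1, by linarith⟩
        rw [indicator_of_mem hy2, indicator_of_mem hyb, indicator_of_mem hy,
          ← ENNReal.ofReal_mul hM, fracKer_of_pos hys, div_eq_mul_inv]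
        gcongr
        exact abs_le_of_eNorm1_le hM h ⟨ha.trans hy.1.le, hy.2.trans hbT⟩
      · have : (Ioc a s).indicator (fun y => ENNReal.ofReal
            (|(Ioc a b).indicator f y| / (s - y) ^ (α + 1))) y = 0 := by
          unfold indicator at hy ⊢
          simp [hy]
        rw [this]; exact zero_le
    refine h3.trans ?_
    rw [lintegral_fracKer_Iio hα hs.1, ← ENNReal.ofReal_mul hα0, div_eq_mul_inv, mul_comm α⁻¹]

lemma fracNorm_indicator_lt_top {α T a b c M : ℝ} (hα : 0 < α) (hα1 : α < 1) {f : ℝ → ℝ}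
    (hf : Measurable f) (hM : 0 ≤ M) (h : eNorm1 α 0 T f ≤ ENNReal.ofReal M) (ha : 0 ≤ a)
    (hab : a ≤ b) (hbc : b ≤ c) (hbT : b ≤ T) : fracNorm α c ((Ioc a b).indicator f) < ∞ :=
  (fracNorm_indicator_le hα hα1 hf hM h ha hab hbc hbT).trans_lt
    (ENNReal.mul_lt_top ENNReal.ofReal_lt_top
      (ENNReal.add_lt_top.2 ⟨ENNReal.ofReal_lt_top, ENNReal.ofReal_lt_top⟩))

lemma gsInt_indicator {α a b : ℝ} (f g : ℝ → ℝ) :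
    gsInt α a b ((Ioc a b).indicator f) g = gsInt α a b f g :=
  gsInt_congr fun _ hs => indicator_of_mem hs f

lemma gsInt_le_of_fracNorm {α T : ℝ} (hα : 0 < α) (hα1 : α < 1) (g : W2 α T) {a b C : ℝ}
    (ha : 0 ≤ a) (hb : b ≤ T) (hC : 0 ≤ C) {f : ℝ → ℝ} (hf : Measurable f) (h0 : ∀ s ≤ a, f s = 0)
    (hN : fracNorm α b f ≤ ENNReal.ofReal C) :
    |gsInt α a b f g| ≤ gsConst α * ‖g‖ * C := by
  have hc := gsConst_pos hα hα1
  rw [gsInt_eq_integral hα hα1 g ha hb hf h0 (hN.trans_lt ENNReal.ofReal_lt_top)]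
  have h := abs_integral_gsWeight_le (c := b) hα hα1 g hb (fun p => f p.1 - f p.2)
  rw [Real.enorm_eq_ofReal_abs] at h
  rw [← ENNReal.ofReal_le_ofReal_iff (by positivity), ENNReal.ofReal_mul (by positivity)]
  exact h.trans (by gcongr; exact hN)

lemma gsInt_add_of_fracNorm {α T : ℝ} (hα : 0 < α) (hα1 : α < 1) (g : W2 α T) {a b : ℝ}
    (ha : 0 ≤ a) (hb : b ≤ T) {f f' : ℝ → ℝ} (hf : Measurable f) (h0 : ∀ s ≤ a, f s = 0)
    (hN : fracNorm α b f < ∞) (hf' : Measurable f') (h0' : ∀ s ≤ a, f' s = 0)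
    (hN' : fracNorm α b f' < ∞) :
    gsInt α a b (fun s => f s + f' s) g = gsInt α a b f g + gsInt α a b f' g := by
  have hi := integrable_inc hf hN
  have hi' := integrable_inc hf' hN'
  have hs : fracNorm α b (fun s => f s + f' s) < ∞ := by
    have := (hi.add hi').2
    refine lt_of_eq_of_lt (lintegral_congr fun p => ?_) this
    simp only [Pi.add_apply]
    congr 1; ring
  rw [gsInt_eq_integral hα hα1 g ha hb (f := fun s => f s + f' s)
      (by fun_prop) (fun s h => by simp [h0 s h, h0' s h]) hs,
    gsInt_eq_integral hα hα1 g ha hb hf h0 hN, gsInt_eq_integral hα hα1 g ha hb hf' h0' hN',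
    ← integral_add (integrable_inc_mul_gsWeight hα hα1 g hb hi)
      (integrable_inc_mul_gsWeight hα hα1 g hb hi')]
  congr 1 with p
  ring

/-- The constant in the Hölder bound of the indefinite integral. -/
def holderConst (α T : ℝ) : ℝ := gsConst α * (α⁻¹ / (1 - α) + T ^ α)

lemma holderConst_nonneg {α T : ℝ} (hα : 0 < α) (hα1 : α < 1) (hT : 0 ≤ T) :
    0 ≤ holderConst α T := by
  have := gsConst_pos hα hα1
  have : 0 < 1 - α := by linarith
  unfold holderConst; positivity

lemma abs_gsInt_le {α T a b M : ℝ} (hα : 0 < α) (hα1 : α < 1) {f : ℝ → ℝ}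
    (hf : Measurable f) (hM : 0 ≤ M) (h : eNorm1 α 0 T f ≤ ENNReal.ofReal M) (ha : 0 ≤ a)
    (hab : a ≤ b) (hbT : b ≤ T) (g : W2 α T) :
    |gsInt α a b f g| ≤ holderConst α T * M * ‖g‖ * (b - a) ^ (1 - α) := by
  have hβ : 0 < 1 - α := by linarith
  have hba : 0 ≤ b - a := sub_nonneg.2 hab
  have h1 : fracNorm α b ((Ioc a b).indicator f)
      ≤ ENNReal.ofReal (M * (α⁻¹ * ((b - a) ^ (1 - α) / (1 - α)) + (b - a))) := by
    refine (fracNorm_indicator_le hα hα1 hf hM h ha hab le_rfl hbT).trans ?_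
    rw [sub_self, Real.zero_rpow hβ.ne', zero_div, mul_zero, ENNReal.ofReal_zero, add_zero,
      ENNReal.ofReal_mul hM]
  have h2 := gsInt_le_of_fracNorm hα hα1 g ha hbT (by positivity)
    (measurable_indicator_Ioc hf a b) (fun s hs => by simp [hs.not_gt]) h1
  rw [gsInt_indicator] at h2
  refine h2.trans ?_
  -- The term of order one is absorbed into the power `1-α` at the price `T^α`.
  have h3 : b - a ≤ T ^ α * (b - a) ^ (1 - α) := by
    rcases hba.eq_or_lt with h | h
    · rw [← h]; have := ha.trans (hab.trans hbT); positivity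
    · calc b - a = (b - a) ^ α * (b - a) ^ (1 - α) := by
            rw [← Real.rpow_add h, add_sub_cancel, Real.rpow_one]
        _ ≤ _ := by
            gcongr
            linarith
  have := gsConst_pos hα hα1
  calc gsConst α * ‖g‖ * (M * (α⁻¹ * ((b - a) ^ (1 - α) / (1 - α)) + (b - a)))
      ≤ gsConst α * ‖g‖ * (M * (α⁻¹ * ((b - a) ^ (1 - α) / (1 - α))
          + T ^ α * (b - a) ^ (1 - α))) := by gcongr
    _ = _ := by unfold holderConst; ring

/-- An integrand vanishing up to time `u` can be integrated from time `u` on. -/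
lemma gsInt_eq_of_vanish_left {α T : ℝ} (hα : 0 < α) (hα1 : α < 1) (g : W2 α T) {a u b : ℝ}
    (ha : 0 ≤ a) (hau : a ≤ u) (hb : b ≤ T) {f : ℝ → ℝ} (hf : Measurable f)
    (h0 : ∀ s ≤ u, f s = 0) (hN : fracNorm α b f < ∞) :
    gsInt α a b f g = gsInt α u b f g := by
  rw [gsInt_eq_integral hα hα1 g ha hb hf (fun s hs => h0 s (hs.trans hau)) hN,
    gsInt_eq_integral hα hα1 g (ha.trans hau) hb hf h0 hN]

/-- Additivity of the integral with respect to the interval. -/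
lemma gsInt_add_interval {α T u t M : ℝ} (hα : 0 < α) (hα1 : α < 1) {f : ℝ → ℝ}
    (hf : Measurable f) (hM : 0 ≤ M) (h : eNorm1 α 0 T f ≤ ENNReal.ofReal M) (hu : 0 ≤ u)
    (hut : u ≤ t) (htT : t ≤ T) (g : W2 α T) :
    gsInt α 0 t f g = gsInt α 0 u f g + gsInt α u t f g := by
  have m1 := measurable_indicator_Ioc hf 0 u
  have m2 := measurable_indicator_Ioc hf u t
  have n1 := fracNorm_indicator_lt_top hα hα1 hf hM h le_rfl hu hut (hut.trans htT)
  have n2 := fracNorm_indicator_lt_top hα hα1 hf hM h hu hut le_rfl htT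
  have z2 : ∀ s ≤ u, (Ioc u t).indicator f s = 0 := fun s hs => by simp [hs.not_gt]
  have z1 : ∀ s ≤ 0, (Ioc 0 u).indicator f s = 0 := fun s hs => by simp [hs.not_gt]
  -- Split the integrand at `u`: locality shortens the interval for the first piece from the right,
  -- and the second piece already vanishes up to `u`.
  have e : gsInt α 0 t f g
      = gsInt α 0 t (fun s => (Ioc 0 u).indicator f s + (Ioc u t).indicator f s) g := by
    refine gsInt_congr fun s hs => ?_
    by_cases hsu : s ≤ u
    · simp [indicator, hs.1, hsu, hsu.not_gt]
    · simp [indicator, not_le.1 hsu, hsu, hs.2]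
  rw [e, gsInt_add_of_fracNorm hα hα1 g le_rfl htT m1 z1 n1 m2
    (fun s hs => z2 s (hs.trans hu)) n2,
    gsInt_eq_of_vanish hα hα1 g le_rfl hu hut htT m1 z1 (fun s hs => by simp [hs.not_ge]) n1,
    gsInt_eq_of_vanish_left hα hα1 g le_rfl hu htT m2 z2 n2, gsInt_indicator, gsInt_indicator]

lemma abs_gsInt_sub_le {α T s t M : ℝ} (hα : 0 < α) (hα1 : α < 1) {f : ℝ → ℝ}
    (hf : Measurable f) (hM : 0 ≤ M) (h : eNorm1 α 0 T f ≤ ENNReal.ofReal M) (hs : 0 ≤ s)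
    (hst : s ≤ t) (htT : t ≤ T) (g : W2 α T) :
    |gsInt α 0 t f g - gsInt α 0 s f g| ≤ holderConst α T * M * ‖g‖ * (t - s) ^ (1 - α) := by
  rw [gsInt_add_interval hα hα1 hf hM h hs hst htT g, add_sub_cancel_left]
  exact abs_gsInt_le hα hα1 hf hM h hs hst htT g

/-! ### The bilinear integral operator -/

/-- The constant in the bound of the integral operator on `W_1^α`. -/
def opConst (α T : ℝ) : ℝ :=
  holderConst α T * T ^ (1 - α) + holderConst α T * (T ^ (1 - 2 * α) / (1 - 2 * α))

/-- The indefinite integral is Hölder of order `1-α`. The increment integral of its `W_1^α`-norm is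
then dominated by that of `(t-v)^{-2α}`, finite because `α < 1/2`. -/
lemma eNorm1_gsInt_le {α T : ℝ} (hα : 0 < α) (hα' : α < 1 / 2) (f : W1 α 0 T) (g : W2 α T) :
    eNorm1 α 0 T (fun t => gsInt α 0 t f g) ≤ ENNReal.ofReal (opConst α T * ‖f‖ * ‖g‖) := by
  have hα1 : α < 1 := by linarith
  rcases lt_or_ge T 0 with hT | hT
  · simp [eNorm1, Icc_eq_empty_of_lt hT]
  have hh := holderConst_nonneg hα hα1 hT
  refine (eNorm1_le_of_holder (A := holderConst α T * ‖f‖ * ‖g‖)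
    (B := holderConst α T * ‖f‖ * ‖g‖ * T ^ (1 - α)) hα' (by positivity) (by positivity)
    ?_ ?_).trans
    (le_of_eq ?_)
  · intro t ht
    refine (abs_gsInt_le hα hα1 f.measurable (norm_nonneg f) f.eNorm1_eq.le le_rfl ht.1 ht.2
      g).trans ?_
    have : 0 ≤ t := ht.1
    rw [sub_zero]
    gcongr
    exact ht.2
  · intro s t hs hst htT
    exact abs_gsInt_sub_le hα hα1 f.measurable (norm_nonneg f) f.eNorm1_eq.le hs hst htT g
  · unfold opConst; congr 1; ring

lemma gsWeight_add {α T : ℝ} (hα : 0 < α) (hα1 : α < 1) (g g' : W2 α T) {b : ℝ} (hb : b ≤ T)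
    (s : ℝ) : gsWeight α (g + g' : W2 α T) b s = gsWeight α g b s + gsWeight α g' b s := by
  unfold gsWeight
  by_cases hs : s ∈ Ioo 0 b
  · simp only [indicator_of_mem hs]
    rw [← mul_add, rightDer, rightDer, rightDer, ← integral_add
      (integrable_rightDer hα hα1 g hs.1.le hs.2 hb)
      (integrable_rightDer hα hα1 g' hs.1.le hs.2 hb)]
    congr 1
    refine integral_congr_ae (ae_of_all _ fun w => ?_)
    simp only [W2.add_coe, stopAt, Pi.add_apply]
    ring
  · simp [indicator_of_notMem hs]

lemma gsWeight_smul {α T : ℝ} (c : ℝ) (g : W2 α T) (b s : ℝ) :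
    gsWeight α (c • g : W2 α T) b s = c * gsWeight α g b s := by
  unfold gsWeight
  by_cases hs : s ∈ Ioo 0 b
  · simp only [indicator_of_mem hs]
    have e : rightDer (1 - α) (stopAt (c • g : W2 α T) b) s
        = c * rightDer (1 - α) (stopAt g b) s := by
      rw [rightDer, rightDer, ← integral_const_mul]
      refine integral_congr_ae (ae_of_all _ fun w => ?_)
      simp only [W2.smul_coe, stopAt, Pi.smul_apply, smul_eq_mul]
      ring
    rw [e]; ring
  · simp [indicator_of_notMem hs]

lemma gsInt_eq_integral_indicator {α T t M : ℝ} (hα : 0 < α) (hα1 : α < 1) {f : ℝ → ℝ}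
    (hf : Measurable f) (hM : 0 ≤ M) (h : eNorm1 α 0 T f ≤ ENNReal.ofReal M)
    (ht : t ∈ Icc 0 T) (g : W2 α T) :
    gsInt α 0 t f g = ∫ p, ((Ioc 0 t).indicator f p.1 - (Ioc 0 t).indicator f p.2)
      * gsWeight α g t p.1 ∂incMeasure α t := by
  rw [← gsInt_eq_integral hα hα1 g le_rfl ht.2 (measurable_indicator_Ioc hf 0 t)
    (fun s hs => by simp [hs.not_gt])
    (fracNorm_indicator_lt_top hα hα1 hf hM h le_rfl ht.1 le_rfl ht.2), gsInt_indicator]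

lemma gsInt_add_left {α T t : ℝ} (hα : 0 < α) (hα1 : α < 1) (f f' : W1 α 0 T)
    (ht : t ∈ Icc 0 T) (g : W2 α T) :
    gsInt α 0 t (f + f' : W1 α 0 T) g = gsInt α 0 t f g + gsInt α 0 t f' g := by
  have hn : ∀ f : W1 α 0 T, fracNorm α t ((Ioc 0 t).indicator f) < ∞ := fun f =>
    fracNorm_indicator_lt_top hα hα1 f.measurable (norm_nonneg f) f.eNorm1_eq.le le_rfl ht.1
      le_rfl ht.2
  rw [← gsInt_indicator (f : ℝ → ℝ), ← gsInt_indicator (f' : ℝ → ℝ),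
    ← gsInt_add_of_fracNorm hα hα1 g le_rfl
    ht.2 (measurable_indicator_Ioc f.measurable 0 t) (fun s hs => by simp [hs.not_gt]) (hn f)
    (measurable_indicator_Ioc f'.measurable 0 t) (fun s hs => by simp [hs.not_gt]) (hn f')]
  refine gsInt_congr fun s hs => ?_
  simp only [indicator_of_mem hs, W1.add_apply]

lemma gsInt_smul_left {α a b c : ℝ} (f g : ℝ → ℝ) :
    gsInt α a b (fun s => c * f s) g = c * gsInt α a b f g := by
  have : ∀ t, weylLeft α a (fun s => c * f s) t = c * weylLeft α a f t := fun t => by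
    simp only [weylLeft, ← mul_sub, mul_div_assoc, intervalIntegral.integral_const_mul]
    ring
  simp only [gsInt, this, mul_assoc, integral_const_mul, mul_neg]

lemma gsInt_add_right {α T t : ℝ} (hα : 0 < α) (hα1 : α < 1) (f : W1 α 0 T)
    (ht : t ∈ Icc 0 T) (g g' : W2 α T) :
    gsInt α 0 t f (g + g' : W2 α T) = gsInt α 0 t f g + gsInt α 0 t f g' := by
  have hi := integrable_inc (measurable_indicator_Ioc f.measurable 0 t)
    (fracNorm_indicator_lt_top hα hα1 f.measurable (norm_nonneg f) f.eNorm1_eq.le le_rfl ht.1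
      le_rfl ht.2)
  rw [gsInt_eq_integral_indicator hα hα1 f.measurable (norm_nonneg f) f.eNorm1_eq.le ht,
    gsInt_eq_integral_indicator hα hα1 f.measurable (norm_nonneg f) f.eNorm1_eq.le ht,
    gsInt_eq_integral_indicator hα hα1 f.measurable (norm_nonneg f) f.eNorm1_eq.le ht,
    ← integral_add (integrable_inc_mul_gsWeight hα hα1 g ht.2 hi)
      (integrable_inc_mul_gsWeight hα hα1 g' ht.2 hi)]
  congr 1 with p
  rw [gsWeight_add hα hα1 g g' ht.2]
  ring

lemma gsInt_smul_right {α T t : ℝ} (hα : 0 < α) (hα1 : α < 1) (f : W1 α 0 T)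
    (ht : t ∈ Icc 0 T) (c : ℝ) (g : W2 α T) :
    gsInt α 0 t f (c • g : W2 α T) = c * gsInt α 0 t f g := by
  rw [gsInt_eq_integral_indicator hα hα1 f.measurable (norm_nonneg f) f.eNorm1_eq.le ht,
    gsInt_eq_integral_indicator hα hα1 f.measurable (norm_nonneg f) f.eNorm1_eq.le ht,
    ← integral_const_mul]
  congr 1 with p
  rw [gsWeight_smul]
  ring

lemma measurable_gsInt_indicator {α T : ℝ} (hα : 0 < α) (hα' : α < 1 / 2) (f : W1 α 0 T)
    (g : W2 α T) : Measurable ((Icc 0 T).indicator fun t => gsInt α 0 t f g) :=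
  measurable_indicator_of_holder (γ := 1 - α) (by linarith) fun _ _ hs hst htT =>
    abs_gsInt_sub_le hα (by linarith) f.measurable (norm_nonneg f) f.eNorm1_eq.le hs hst htT g

/-- The bounded bilinear operator `(f,g) ↦ ∫_0^· f dg`. -/
def intOp {α : ℝ} (T : ℝ) (hα : 0 < α) (hα' : α < 1 / 2) :
    W1 α 0 T →L[ℝ] W2 α T →L[ℝ] W1 α 0 T :=
  LinearMap.mkContinuous₂ (LinearMap.mk₂ ℝ (fun f g => toW1 α 0 T (fun t => gsInt α 0 t f g)
      (measurable_gsInt_indicator hα hα' f g)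
      ((eNorm1_gsInt_le hα hα' f g).trans_lt ENNReal.ofReal_lt_top))
    (fun f f' g => W1.ext fun t ht => by
      rw [W1.add_apply, toW1_apply ht, toW1_apply ht, toW1_apply ht,
        gsInt_add_left hα (by linarith) f f' ht])
    (fun c f g => W1.ext fun t ht => by
      rw [W1.smul_apply, toW1_apply ht, toW1_apply ht, ← gsInt_smul_left]; rfl)
    (fun f g g' => W1.ext fun t ht => by
      rw [W1.add_apply, toW1_apply ht, toW1_apply ht, toW1_apply ht,
        gsInt_add_right hα (by linarith) f ht])
    (fun c f g => W1.ext fun t ht => by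
      rw [W1.smul_apply, toW1_apply ht, toW1_apply ht, gsInt_smul_right hα (by linarith) f ht]))
    (max (opConst α T) 0) (fun f g => by
      refine W1.norm_le _ (by positivity) ?_
      have e : eNorm1 α 0 T (toW1 α 0 T (fun t => gsInt α 0 t f g)
          (measurable_gsInt_indicator hα hα' f g)
          ((eNorm1_gsInt_le hα hα' f g).trans_lt ENNReal.ofReal_lt_top))
          = eNorm1 α 0 T (fun t => gsInt α 0 t f g) := eNorm1_congr fun t ht => toW1_apply ht
      refine e.le.trans ((eNorm1_gsInt_le hα hα' f g).trans ?_)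
      gcongr
      exact le_max_left _ _)

lemma intOp_apply {α T : ℝ} (hα : 0 < α) (hα' : α < 1 / 2) (f : W1 α 0 T) (g : W2 α T) {t : ℝ}
    (ht : t ∈ Icc 0 T) : intOp T hα hα' f g t = gsInt α 0 t f g :=
  toW1_apply (f := fun t => gsInt α 0 t f g) (hf := measurable_gsInt_indicator hα hα' f g)
    (h := (eNorm1_gsInt_le hα hα' f g).trans_lt ENNReal.ofReal_lt_top) ht

/-- A bounded linear operator into `W_1^α(a,b)` from a linear family of functions. -/
def W1.mkOp {α a b : ℝ} {E : Type*} [SeminormedAddCommGroup E] [NormedSpace ℝ E]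
    (F : E → ℝ → ℝ) (hm : ∀ e, Measurable ((Icc a b).indicator (F e)))
    (hb : ∃ K, 0 ≤ K ∧ ∀ e, eNorm1 α a b (F e) ≤ ENNReal.ofReal (K * ‖e‖))
    (hadd : ∀ e e', ∀ t ∈ Icc a b, F (e + e') t = F e t + F e' t)
    (hsmul : ∀ (c : ℝ) e, ∀ t ∈ Icc a b, F (c • e) t = c * F e t) : E →L[ℝ] W1 α a b :=
  have hlt : ∀ e, eNorm1 α a b (F e) < ∞ := fun e =>
    (hb.choose_spec.2 e).trans_lt ENNReal.ofReal_lt_top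
  LinearMap.mkContinuousOfExistsBound
    { toFun := fun e => toW1 α a b (F e) (hm e) (hlt e)
      map_add' := fun e e' => W1.ext fun t ht => by
        change (Icc a b).indicator (F (e + e')) t
          = (Icc a b).indicator (F e) t + (Icc a b).indicator (F e') t
        simp only [indicator_of_mem ht, hadd e e' t ht]
      map_smul' := fun c e => W1.ext fun t ht => by
        change (Icc a b).indicator (F (c • e)) t = c * (Icc a b).indicator (F e) t
        simp only [indicator_of_mem ht, hsmul c e t ht] }
    (by
      obtain ⟨K, hK, h⟩ := hb
      refine ⟨K, fun e => W1.norm_le _ (by positivity) ?_⟩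
      exact (eNorm1_congr fun t ht => indicator_of_mem ht (F e)).le.trans (h e))

lemma W1.mkOp_apply {α a b : ℝ} {E : Type*} [SeminormedAddCommGroup E] [NormedSpace ℝ E]
    (F : E → ℝ → ℝ) (hm : ∀ e, Measurable ((Icc a b).indicator (F e)))
    (hb : ∃ K, 0 ≤ K ∧ ∀ e, eNorm1 α a b (F e) ≤ ENNReal.ofReal (K * ‖e‖))
    (hadd : ∀ e e', ∀ t ∈ Icc a b, F (e + e') t = F e t + F e' t)
    (hsmul : ∀ (c : ℝ) e, ∀ t ∈ Icc a b, F (c • e) t = c * F e t) (e : E) {t : ℝ}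
    (ht : t ∈ Icc a b) : W1.mkOp F hm hb hadd hsmul e t = F e t :=
  indicator_of_mem ht (F e)

/-! ### Translation -/

lemma eNorm1_shift_le {α r T : ℝ} (f : ℝ → ℝ) :
    eNorm1 α 0 T (fun t => f (t - r)) ≤ eNorm1 α (-r) (T - r) f := by
  rw [eNorm1_le_iff]
  intro u hu
  refine le_trans (le_of_eq ?_) (le_eNorm1 f (u := u - r) ⟨by linarith [hu.1], by linarith [hu.2]⟩)
  congr 1
  rw [← lintegral_indicator measurableSet_Ioc, ← lintegral_indicator measurableSet_Ioc,
    ← lintegral_sub_right_eq_self ((Ioc (-r) (u - r)).indicator _) r]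
  refine lintegral_congr fun v => ?_
  by_cases hv : v ∈ Ioc 0 u
  · have : v - r ∈ Ioc (-r) (u - r) := ⟨by linarith [hv.1], by linarith [hv.2]⟩
    rw [indicator_of_mem hv, indicator_of_mem this, sub_sub_sub_cancel_right]
  · have : v - r ∉ Ioc (-r) (u - r) := fun h => hv ⟨by linarith [h.1], by linarith [h.2]⟩
    rw [indicator_of_notMem hv, indicator_of_notMem this]

/-- The translation `f ↦ f(·-r)` from `W_1^α(-r,T-r)` to `W_1^α(0,T)`. -/
def shift (α r T : ℝ) : W1 α (-r) (T - r) →L[ℝ] W1 α 0 T :=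
  W1.mkOp (fun f t => f (t - r))
    (fun f => (f.measurable.comp (measurable_id.sub_const r)).indicator measurableSet_Icc)
    ⟨1, zero_le_one, fun f => by
      rw [one_mul, ← f.eNorm1_eq]
      exact eNorm1_shift_le _⟩
    (fun _ _ _ _ => rfl) (fun _ _ _ _ => rfl)

lemma shift_apply {α r T t : ℝ} (f : W1 α (-r) (T - r)) (ht : t ∈ Icc 0 T) :
    shift α r T f t = f (t - r) := W1.mkOp_apply _ _ _ _ _ f ht

/-! ### Superposition operators -/

lemma IsCb.differentiable {σ : ℝ → ℝ} (h : IsCb 2 σ) : Differentiable ℝ σ :=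
  h.1.differentiable (by norm_num)

lemma IsCb.contDiff_deriv {σ : ℝ → ℝ} (h : IsCb 2 σ) : ContDiff ℝ 1 (deriv σ) :=
  ((contDiff_succ_iff_deriv (n := 1)).1 (by simpa [one_add_one_eq_two] using h.1)).2.2

lemma IsCb.differentiable_deriv {σ : ℝ → ℝ} (h : IsCb 2 σ) : Differentiable ℝ (deriv σ) :=
  h.contDiff_deriv.differentiable (by norm_num)

lemma IsCb.continuous_deriv2 {σ : ℝ → ℝ} (h : IsCb 2 σ) : Continuous (deriv (deriv σ)) :=
  h.contDiff_deriv.continuous_deriv le_rfl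

lemma IsCb.exists_bound {σ : ℝ → ℝ} (h : IsCb 2 σ) :
    ∃ C, 0 ≤ C ∧ (∀ x, |deriv σ x| ≤ C) ∧ ∀ x, |deriv (deriv σ) x| ≤ C := by
  obtain ⟨C1, h1⟩ := h.2 1 le_rfl (by norm_num)
  obtain ⟨C2, h2⟩ := h.2 2 (by norm_num) le_rfl
  simp only [iteratedDeriv_one] at h1
  simp only [iteratedDeriv_succ, iteratedDeriv_zero] at h2
  refine ⟨max C1 C2, ?_, fun x => (h1 x).trans (le_max_left _ _),
    fun x => (h2 x).trans (le_max_right _ _)⟩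
  exact (abs_nonneg _).trans ((h1 0).trans (le_max_left _ _))

lemma abs_sub_le_of_deriv {φ : ℝ → ℝ} (hφ : Differentiable ℝ φ) {C : ℝ}
    (hC : ∀ x, |deriv φ x| ≤ C) (x y : ℝ) : |φ x - φ y| ≤ C * |x - y| := by
  have := convex_univ.norm_image_sub_le_of_norm_deriv_le (f := φ) (C := C)
    (fun z _ => hφ z) (fun z _ => hC z) (mem_univ y) (mem_univ x)
  simpa using this

section Nemytskii

variable {α a b : ℝ} {σ : ℝ → ℝ}

lemma eNorm1_comp_lt_top (hσ : IsCb 2 σ) (y : W1 α a b) : eNorm1 α a b (fun t => σ (y t)) < ∞ := by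
  obtain ⟨C, hC, h1, -⟩ := hσ.exists_bound
  refine (eNorm1_le_of_increments (A := C) (B := 0) (D := |σ 0|) y 0 hC le_rfl (abs_nonneg _)
    (fun u _ => ?_) (fun u _ v _ => ?_)).trans_lt ENNReal.ofReal_lt_top
  · have := abs_sub_le_of_deriv hσ.differentiable h1 (y u) 0
    rw [sub_zero] at this
    have h2 := abs_add_le (σ (y u) - σ 0) (σ 0)
    rw [sub_add_cancel] at h2
    linarith
  · rw [zero_mul, add_zero]
    exact abs_sub_le_of_deriv hσ.differentiable h1 _ _

/-- The superposition operator `y ↦ σ ∘ y`. -/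
def nem (hσ : IsCb 2 σ) (y : W1 α a b) : W1 α a b :=
  toW1 α a b (fun t => σ (y t))
    ((hσ.differentiable.continuous.measurable.comp y.measurable).indicator measurableSet_Icc)
    (eNorm1_comp_lt_top hσ y)

lemma nem_apply (hσ : IsCb 2 σ) (y : W1 α a b) {t : ℝ} (ht : t ∈ Icc a b) :
    nem hσ y t = σ (y t) := toW1_apply ht

/-- Product rule for increments: `σ'(y)` is bounded and inherits the increments of `y` through the
bound on `σ''`. -/
lemma eNorm1_deriv_mul_le (hσ : IsCb 2 σ) {C : ℝ} (hC : 0 ≤ C) (h1 : ∀ x, |deriv σ x| ≤ C)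
    (h2 : ∀ x, |deriv (deriv σ) x| ≤ C) (y δ : W1 α a b) :
    eNorm1 α a b (fun t => deriv σ (y t) * δ t) ≤ ENNReal.ofReal ((C + C * ‖y‖) * ‖δ‖) := by
  refine (eNorm1_le_of_increments (A := C) (B := C * ‖δ‖) (D := 0) δ y hC (by positivity) le_rfl
    (fun u _ => ?_) (fun u _ v _ => ?_)).trans (ENNReal.ofReal_le_ofReal (le_of_eq (by ring)))
  · rw [abs_mul, add_zero]
    gcongr
    exact h1 _
  · have e : deriv σ (y u) * δ u - deriv σ (y v) * δ v
        = deriv σ (y v) * (δ u - δ v) + (deriv σ (y u) - deriv σ (y v)) * δ u := by ring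
    rw [e]
    refine (abs_add_le _ _).trans (add_le_add ?_ ?_)
    · rw [abs_mul]; gcongr; exact h1 _
    · rw [abs_mul, mul_right_comm]
      gcongr
      · exact abs_sub_le_of_deriv hσ.differentiable_deriv h2 _ _
      · exact δ.abs_le u

lemma measurable_deriv_mul (hσ : IsCb 2 σ) (y δ : W1 α a b) :
    Measurable ((Icc a b).indicator fun t => deriv σ (y t) * δ t) :=
  (((hσ.contDiff_deriv.continuous.measurable.comp y.measurable).mul δ.measurable)).indicator
    measurableSet_Icc

/-- The derivative `δ ↦ σ'(y) δ` of the superposition operator. -/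
def nemDer (hσ : IsCb 2 σ) (y : W1 α a b) : W1 α a b →L[ℝ] W1 α a b :=
  W1.mkOp (fun δ t => deriv σ (y t) * δ t) (measurable_deriv_mul hσ y)
    (by
      obtain ⟨C, hC, h1, h2⟩ := hσ.exists_bound
      exact ⟨C + C * ‖y‖, by positivity, eNorm1_deriv_mul_le hσ hC h1 h2 y⟩)
    (fun _ _ _ _ => mul_add _ _ _) (fun _ _ _ _ => mul_left_comm _ _ _)

lemma nemDer_apply (hσ : IsCb 2 σ) (y δ : W1 α a b) {t : ℝ} (ht : t ∈ Icc a b) :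
    nemDer hσ y δ t = deriv σ (y t) * δ t := W1.mkOp_apply _ _ _ _ _ δ ht

lemma taylor_first_order (hσ : IsCb 2 σ) {C : ℝ} (h2 : ∀ x, |deriv (deriv σ) x| ≤ C)
    (p d : ℝ) : |σ (p + d) - σ p - deriv σ p * d| ≤ C * |d| * |d| := by
  have hd : ∀ z, HasDerivAt (fun z => σ z - deriv σ p * z) (deriv σ z - deriv σ p) z := fun z => by
    have := (hσ.differentiable z).hasDerivAt.sub ((hasDerivAt_id z).const_mul (deriv σ p))
    rw [mul_one] at this
    exact this
  have := (convex_uIcc p (p + d)).norm_image_sub_le_of_norm_hasDerivWithin_le (C := C * |d|)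
    (f := fun z => σ z - deriv σ p * z) (fun z _ => (hd z).hasDerivWithinAt) (fun z hz => by
      refine (abs_sub_le_of_deriv hσ.differentiable_deriv h2 z p).trans ?_
      have hC : 0 ≤ C := (abs_nonneg _).trans (h2 0)
      have := abs_sub_left_of_mem_uIcc hz
      rw [add_sub_cancel_left] at this
      exact mul_le_mul_of_nonneg_left this hC) left_mem_uIcc right_mem_uIcc
  simp only [Real.norm_eq_abs, add_sub_cancel_left] at this
  refine le_trans (le_of_eq ?_) this
  congr 1; ring

/-- The Taylor remainder is a function of base point and displacement; change them one at a time.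
Its derivative in the base point, `σ'(z+d) - σ'(z) - σ''(z) d`, is at most `ε|d|` by the modulus of
continuity of `σ''`; its derivative in the displacement is at most `C m`. Since the `W_1^α`-norm
sees increments, a pointwise Taylor bound would not suffice. -/
lemma remainder_increment (hσ : IsCb 2 σ) {C M ε η : ℝ} (hC : 0 ≤ C)
    (h2 : ∀ x, |deriv (deriv σ) x| ≤ C) (hη : ∀ p q, |p| ≤ M → |p - q| ≤ η →
      |deriv (deriv σ) p - deriv (deriv σ) q| ≤ ε) {m p p' d d' : ℝ} (hm : m ≤ η)
    (hp : |p| ≤ M) (hp' : |p'| ≤ M) (hd : |d| ≤ m) (hd' : |d'| ≤ m) :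
    |(σ (p + d) - σ p - deriv σ p * d) - (σ (p' + d') - σ p' - deriv σ p' * d')|
      ≤ C * m * |d - d'| + ε * m * |p - p'| := by
  have hm0 : 0 ≤ m := (abs_nonneg _).trans hd
  have hε : 0 ≤ ε := (abs_nonneg _).trans (hη p p hp (by simpa using hm0.trans hm))
  have k1 : |(σ (p + d) - σ p - deriv σ p * d) - (σ (p' + d) - σ p' - deriv σ p' * d)|
      ≤ ε * m * |p - p'| := by
    have hd1 : ∀ z, HasDerivAt (fun z => σ (z + d) - σ z - deriv σ z * d)
        (deriv σ (z + d) - deriv σ z - deriv (deriv σ) z * d) z := fun z => by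
      have e1 := (hσ.differentiable (z + d)).hasDerivAt.comp_add_const z d
      exact (e1.sub (hσ.differentiable z).hasDerivAt).sub
        ((hσ.differentiable_deriv z).hasDerivAt.mul_const d)
    have := (convex_Icc (-M) M).norm_image_sub_le_of_norm_hasDerivWithin_le (C := ε * m)
      (f := fun z => σ (z + d) - σ z - deriv σ z * d) (fun z _ => (hd1 z).hasDerivWithinAt)
      (fun z hz => ?_) (abs_le.1 hp') (abs_le.1 hp)
    · simpa using this
    · have hd2 : ∀ w, HasDerivAt (fun w => deriv σ w - deriv (deriv σ) z * w)
          (deriv (deriv σ) w - deriv (deriv σ) z) w := fun w => by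
        have := (hσ.differentiable_deriv w).hasDerivAt.sub
          ((hasDerivAt_id w).const_mul (deriv (deriv σ) z))
        rw [mul_one] at this
        exact this
      have h3 := (convex_uIcc z (z + d)).norm_image_sub_le_of_norm_hasDerivWithin_le (C := ε)
        (f := fun w => deriv σ w - deriv (deriv σ) z * w) (fun w _ => (hd2 w).hasDerivWithinAt)
        (fun w hw => by
          rw [Real.norm_eq_abs, abs_sub_comm]
          refine hη z w (abs_le.2 hz) ?_
          have h4 := abs_sub_left_of_mem_uIcc hw
          rw [abs_sub_comm]
          rw [add_sub_cancel_left] at h4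
          exact h4.trans (hd.trans hm)) left_mem_uIcc right_mem_uIcc
      simp only [Real.norm_eq_abs, add_sub_cancel_left] at h3
      rw [Real.norm_eq_abs]
      calc _ = |deriv σ (z + d) - deriv (deriv σ) z * (z + d)
            - (deriv σ z - deriv (deriv σ) z * z)| := by congr 1; ring
        _ ≤ ε * |d| := h3
        _ ≤ ε * m := by gcongr
  have k2 : |(σ (p' + d) - σ p' - deriv σ p' * d) - (σ (p' + d') - σ p' - deriv σ p' * d')|
      ≤ C * m * |d - d'| := by
    have hd1 : ∀ z, HasDerivAt (fun z => σ (p' + z) - σ p' - deriv σ p' * z)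
        (deriv σ (p' + z) - deriv σ p') z := fun z => by
      have e1 := (hσ.differentiable (p' + z)).hasDerivAt.comp_const_add p' z
      have := (e1.sub_const (σ p')).sub ((hasDerivAt_id z).const_mul (deriv σ p'))
      rw [mul_one] at this
      exact this
    have := (convex_Icc (-m) m).norm_image_sub_le_of_norm_hasDerivWithin_le (C := C * m)
      (f := fun z => σ (p' + z) - σ p' - deriv σ p' * z) (fun z _ => (hd1 z).hasDerivWithinAt)
      (fun z hz => ?_) (abs_le.1 hd') (abs_le.1 hd)
    · simpa using this
    · refine (abs_sub_le_of_deriv hσ.differentiable_deriv h2 _ _).trans ?_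
      rw [add_sub_cancel_left]
      gcongr
      exact abs_le.2 hz
  calc _ ≤ _ := abs_sub_le _ (σ (p' + d) - σ p' - deriv σ p' * d) _
    _ ≤ _ := by linarith

/-- Uniform continuity on `[-M-1, M+1]`; capping `η` at `1` keeps `q` in that compact set. -/
lemma exists_modulus (hσ : IsCb 2 σ) (M : ℝ) {ε : ℝ} (hε : 0 < ε) : ∃ η > 0, ∀ p q, |p| ≤ M →
    |p - q| ≤ η → |deriv (deriv σ) p - deriv (deriv σ) q| ≤ ε := by
  have hu := (isCompact_Icc (a := -M - 1) (b := M + 1)).uniformContinuousOn_of_continuous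
    hσ.continuous_deriv2.continuousOn
  rw [Metric.uniformContinuousOn_iff_le] at hu
  obtain ⟨η, hη, h⟩ := hu ε hε
  refine ⟨min η 1, by positivity, fun p q hp hpq => ?_⟩
  have h1 := abs_le.1 hp
  have h2 := abs_le.1 (hpq.trans (min_le_right _ _))
  exact h p ⟨by linarith, by linarith⟩ q ⟨by linarith, by linarith⟩
    (hpq.trans (min_le_left _ _))

/-- The superposition operator is Fréchet differentiable. -/
lemma hasFDerivAt_nem (hσ : IsCb 2 σ) (y : W1 α a b) :
    HasFDerivAt (nem hσ) (nemDer hσ y) y := by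
  obtain ⟨C, hC, h1, h2⟩ := hσ.exists_bound
  rw [hasFDerivAt_iff_isLittleO_nhds_zero, Asymptotics.isLittleO_iff]
  intro c hc
  -- The two coefficients of the remainder bound, `C‖δ‖` and `ε‖y‖`, are each to be at most `c/2`;
  -- adding `1` in the denominators avoids division by zero.
  obtain ⟨η, hη, hmod⟩ := exists_modulus hσ ‖y‖ (ε := c / (2 * (‖y‖ + 1))) (by positivity)
  have hθ : 0 < min η (c / (2 * (C + 1))) := by positivity
  filter_upwards [Metric.ball_mem_nhds (0 : W1 α a b) hθ] with δ hδ
  rw [mem_ball_zero_iff] at hδ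
  have hδη : ‖δ‖ ≤ η := hδ.le.trans (min_le_left _ _)
  have hδc : ‖δ‖ ≤ c / (2 * (C + 1)) := hδ.le.trans (min_le_right _ _)
  have e : ∀ t ∈ Icc a b, (nem hσ (y + δ) - nem hσ y - nemDer hσ y δ) t
      = σ (y t + δ t) - σ (y t) - deriv σ (y t) * δ t := fun t ht => by
    rw [W1.sub_apply, W1.sub_apply, nem_apply hσ _ ht, nem_apply hσ _ ht, nemDer_apply hσ _ _ ht,
      W1.add_apply]
  have hb := eNorm1_le_of_increments (A := C * ‖δ‖) (B := c / (2 * (‖y‖ + 1)) * ‖δ‖) (D := 0)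
    (F := fun t => σ (y t + δ t) - σ (y t) - deriv σ (y t) * δ t) δ y (by positivity)
    (by positivity) le_rfl (fun u _ => by
      rw [add_zero]
      refine (taylor_first_order hσ h2 (y u) (δ u)).trans ?_
      gcongr
      exact δ.abs_le u)
    (fun u _ v _ => remainder_increment hσ hC h2 hmod hδη (y.abs_le u) (y.abs_le v)
      (δ.abs_le u) (δ.abs_le v))
  rw [← eNorm1_congr e] at hb
  refine (W1.norm_le _ (by positivity) hb).trans ?_
  have k1 : C * ‖δ‖ ≤ c / 2 := by
    calc C * ‖δ‖ ≤ (C + 1) * (c / (2 * (C + 1))) := by gcongr; linarith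
      _ = c / 2 := by field_simp
  have k2 : c / (2 * (‖y‖ + 1)) * ‖y‖ ≤ c / 2 := by
    calc c / (2 * (‖y‖ + 1)) * ‖y‖ ≤ c / (2 * (‖y‖ + 1)) * (‖y‖ + 1) := by gcongr; linarith
      _ = c / 2 := by field_simp
  calc C * ‖δ‖ * ‖δ‖ + c / (2 * (‖y‖ + 1)) * ‖δ‖ * ‖y‖ + 0
      = (C * ‖δ‖ + c / (2 * (‖y‖ + 1)) * ‖y‖) * ‖δ‖ := by ring
    _ ≤ (c / 2 + c / 2) * ‖δ‖ := by gcongr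
    _ = c * ‖δ‖ := by ring

end Nemytskii

/-! ### Linear Volterra equations -/

lemma intervalIntegrable_of_bounded {φ : ℝ → ℝ} {a b M : ℝ} (hab : a ≤ b)
    (hφ : AEStronglyMeasurable φ (volume.restrict (Ioc a b))) (hM : ∀ u ∈ Ioc a b, |φ u| ≤ M) :
    IntervalIntegrable φ volume a b := by
  rw [intervalIntegrable_iff_integrableOn_Ioc_of_le hab]
  exact (integrable_const M).mono' hφ
    ((ae_restrict_iff' measurableSet_Ioc).2 (ae_of_all _ hM))

lemma abs_integral_le {φ : ℝ → ℝ} {a b M : ℝ} (hab : a ≤ b) (hM : ∀ u ∈ Ioc a b, |φ u| ≤ M) :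
    |∫ u in a..b, φ u| ≤ M * (b - a) := by
  have := intervalIntegral.norm_integral_le_of_norm_le_const (a := a) (b := b) (f := φ) (C := M)
    (by rwa [uIoc_of_le hab])
  rwa [abs_of_nonneg (sub_nonneg.2 hab)] at this

/-- Grönwall's inequality in integral form. -/
lemma gronwall_integral {e : ℝ → ℝ} {a b A L : ℝ} (hL : 0 ≤ L) (hA : 0 ≤ A)
    (he : IntervalIntegrable e volume a b)
    (h : ∀ t ∈ Icc a b, |e t| ≤ A + L * ∫ u in a..t, |e u|) {t : ℝ} (ht : t ∈ Icc a b) :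
    |e t| ≤ A * (1 + L * ((b - a) * Real.exp (L * (b - a)))) := by
  have hab : a ≤ b := ht.1.trans ht.2
  have hsub : ∀ {t}, t ∈ Icc a b → IntervalIntegrable (fun u => |e u|) volume a t := fun ht =>
    (he.abs).mono_set (uIcc_subset_uIcc_left (by rwa [uIcc_of_le hab]))
  set ψ : ℝ → ℝ := fun t => ∫ u in a..t, |e u| with hψ
  -- Integrating factor. As `e` is merely integrable, the primitive is only absolutely continuous,
  -- and the product rule holds almost everywhere.
  set f : ℝ → ℝ := fun u => Real.exp (-(L * (u - a))) with hf
  have hfd : ∀ u, HasDerivAt f (f u * -L) u := fun u => by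
    have := ((((hasDerivAt_id u).sub_const a).const_mul L).neg).exp
    rwa [mul_one] at this
  have hfc : ContDiff ℝ 1 f := by
    rw [hf]; fun_prop
  have h1 := AbsolutelyContinuousOnInterval.integral_deriv_mul_eq_sub (f := f) (g := ψ)
    (hfc.contDiffOn.absolutelyContinuousOnInterval (a := a) (b := t))
    ((hsub ht).absolutelyContinuousOnInterval_intervalIntegral left_mem_uIcc)
  have h0 : ψ a = 0 := intervalIntegral.integral_same
  rw [h0, mul_zero, sub_zero] at h1
  have hψ0 : ∀ u ∈ Icc a b, 0 ≤ ψ u := fun u hu =>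
    intervalIntegral.integral_nonneg hu.1 fun _ _ => abs_nonneg _
  have h2 : f t * ψ t ≤ A * (t - a) := by
    rw [← h1]
    have : ∫ u in a..t, A = A * (t - a) := by
      rw [intervalIntegral.integral_const, smul_eq_mul, mul_comm]
    rw [← this, intervalIntegral.integral_of_le ht.1, intervalIntegral.integral_of_le ht.1]
    have hder : ∀ᵐ u, u ∈ Ioc a t → deriv ψ u = |e u| := by
      filter_upwards [(hsub ht).ae_hasDerivAt_integral] with u hu hut
      exact (hu (Ioc_subset_Icc_self.trans (uIcc_of_le ht.1).ge hut) a left_mem_uIcc).deriv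
    have hle : ∀ᵐ u ∂volume.restrict (Ioc a t), deriv f u * ψ u + f u * deriv ψ u ≤ A := by
      rw [ae_restrict_iff' measurableSet_Ioc]
      filter_upwards [hder] with u hu hut
      have hub : u ∈ Icc a b := ⟨hut.1.le, hut.2.trans ht.2⟩
      rw [hu hut, (hfd u).deriv]
      have hf0 : 0 < f u := Real.exp_pos _
      have hf1 : f u ≤ 1 := Real.exp_le_one_iff.2
        (neg_nonpos.2 (mul_nonneg hL (sub_nonneg.2 hut.1.le)))
      have := h u hub
      calc f u * -L * ψ u + f u * |e u| = f u * (|e u| - L * ψ u) := by ring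
        _ ≤ f u * A := by gcongr; linarith
        _ ≤ 1 * A := by gcongr
        _ = A := one_mul A
    by_cases hi : IntegrableOn (fun u => deriv f u * ψ u + f u * deriv ψ u) (Ioc a t)
    · exact integral_mono_ae hi (integrable_const _) hle
    -- A non-integrable function has integral zero by convention, so the bound persists because `A ≥
    -- 0`; integrability need not be proved.
    · rw [integral_undef hi]
      exact integral_nonneg fun _ => hA
  have h3 : ψ t ≤ A * ((b - a) * Real.exp (L * (b - a))) := by
    have e1 : ψ t = Real.exp (L * (t - a)) * (f t * ψ t) := by
      rw [← mul_assoc, hf, ← Real.exp_add]; simp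
    rw [e1]
    have h4 : 0 ≤ t - a := sub_nonneg.2 ht.1
    have h5 : t - a ≤ b - a := by linarith [ht.2]
    calc _ ≤ Real.exp (L * (b - a)) * (A * (b - a)) := by
            refine mul_le_mul (by gcongr) (h2.trans (by gcongr)) ?_ (Real.exp_pos _).le
            exact mul_nonneg (Real.exp_pos _).le (hψ0 t ht)
      _ = _ := by ring
  calc |e t| ≤ A + L * ψ t := h t ht
    _ ≤ A + L * (A * ((b - a) * Real.exp (L * (b - a)))) := by gcongr
    _ = _ := by ring

/-- The primitive `t ↦ ∫_0^t β`. -/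
def prim (β : ℝ → ℝ) (t : ℝ) : ℝ := ∫ u in 0..t, β u

/-- `v = volt β q` solves `v_t = ∫_0^t β_u (q_u + v_u) du`. -/
def volt (β q : ℝ → ℝ) (t : ℝ) : ℝ :=
  Real.exp (prim β t) * ∫ u in 0..t, β u * Real.exp (-prim β u) * q u

section Volt

variable {β q : ℝ → ℝ} {L T : ℝ}

lemma intervalIntegrable_beta (hβ : Measurable β) (hL : ∀ t, |β t| ≤ L) (a b : ℝ) :
    IntervalIntegrable β volume a b :=
  (intervalIntegrable_const (c := L)).mono_fun hβ.aestronglyMeasurable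
    (ae_of_all _ fun u => (hL u).trans (le_abs_self L))

lemma continuous_prim (hβ : Measurable β) (hL : ∀ t, |β t| ≤ L) : Continuous (prim β) :=
  intervalIntegral.continuous_primitive (intervalIntegrable_beta hβ hL) 0

lemma abs_prim_le (hL : ∀ t, |β t| ≤ L) {t : ℝ} (ht : t ∈ Icc 0 T) : |prim β t| ≤ L * T := by
  have hL0 : 0 ≤ L := (abs_nonneg _).trans (hL 0)
  refine (abs_integral_le ht.1 fun u _ => hL u).trans ?_
  rw [sub_zero]
  exact mul_le_mul_of_nonneg_left ht.2 hL0

lemma intervalIntegrable_kernel_mul (hβ : Measurable β) (hL : ∀ t, |β t| ≤ L)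
    (hq : IntervalIntegrable q volume 0 T) :
    IntervalIntegrable (fun u => β u * Real.exp (-prim β u) * q u) volume 0 T := by
  have h1 : IntervalIntegrable (fun u => Real.exp (-prim β u) * q u) volume 0 T :=
    hq.continuousOn_mul (by
      have := continuous_prim hβ hL
      fun_prop)
  have h2 : IntervalIntegrable (fun u => β u * (Real.exp (-prim β u) * q u)) volume 0 T := by
    rw [intervalIntegrable_iff] at h1 ⊢
    exact h1.bdd_mul (c := L) hβ.aestronglyMeasurable (ae_of_all _ hL)
  simpa only [mul_assoc] using h2

lemma absolutelyContinuous_exp_prim (hβ : Measurable β) (hL : ∀ t, |β t| ≤ L) {t : ℝ}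
    (ht : 0 ≤ t) : AbsolutelyContinuousOnInterval (fun u => Real.exp (prim β u)) 0 t := by
  have hL0 : 0 ≤ L := (abs_nonneg _).trans (hL 0)
  have h1 : LipschitzOnWith (Real.toNNReal (Real.exp (L * t) * L))
      (fun u => Real.exp (prim β u)) (uIcc 0 t) := by
    refine LipschitzOnWith.of_dist_le_mul fun u hu v hv => ?_
    rw [uIcc_of_le ht] at hu hv
    rw [Real.coe_toNNReal _ (by positivity), Real.dist_eq, Real.dist_eq]
    have h2 := (convex_Icc (-(L * t)) (L * t)).norm_image_sub_le_of_norm_hasDerivWithin_le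
      (f := Real.exp) (C := Real.exp (L * t))
      (fun z _ => (Real.hasDerivAt_exp z).hasDerivWithinAt)
      (fun z hz => by
        rw [Real.norm_eq_abs, abs_of_pos (Real.exp_pos _)]
        exact Real.exp_le_exp.2 hz.2)
      (abs_le.1 (abs_prim_le hL hv)) (abs_le.1 (abs_prim_le hL hu))
    refine h2.trans ?_
    rw [mul_assoc]
    gcongr
    rw [Real.norm_eq_abs, prim, prim, intervalIntegral.integral_interval_sub_left
      (intervalIntegrable_beta hβ hL _ _) (intervalIntegrable_beta hβ hL _ _)]
    exact intervalIntegral.norm_integral_le_of_norm_le_const (f := β) fun w _ => hL w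
  exact h1.absolutelyContinuousOnInterval

/-- Variation of constants: differentiating the product gives `β q + β (volt β q)` almost
everywhere. The product rule for absolutely continuous functions is used because `β` and `q` need
not be continuous. -/
lemma volt_eq (hβ : Measurable β) (hL : ∀ t, |β t| ≤ L) (hq : IntervalIntegrable q volume 0 T)
    {t : ℝ} (ht : t ∈ Icc 0 T) : volt β q t = ∫ u in 0..t, β u * (q u + volt β q u) := by
  have hT : 0 ≤ T := ht.1.trans ht.2
  have hi := (intervalIntegrable_kernel_mul hβ hL hq).mono_set
    (uIcc_subset_uIcc_left (by rwa [uIcc_of_le hT] : t ∈ uIcc 0 T))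
  have h1 := AbsolutelyContinuousOnInterval.integral_deriv_mul_eq_sub
    (absolutelyContinuous_exp_prim hβ hL ht.1)
    (hi.absolutelyContinuousOnInterval_intervalIntegral left_mem_uIcc)
  rw [intervalIntegral.integral_same, mul_zero, sub_zero] at h1
  rw [volt, ← h1]
  refine intervalIntegral.integral_congr_ae ?_
  filter_upwards [hi.ae_hasDerivAt_integral,
    (intervalIntegrable_beta hβ hL 0 t).ae_hasDerivAt_integral] with u hu hu' hut
  rw [(hu (uIoc_subset_uIcc hut) 0 left_mem_uIcc).deriv,
    show deriv (fun u => Real.exp (prim β u)) u = Real.exp (prim β u) * β u from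
      ((hu' (uIoc_subset_uIcc hut) 0 left_mem_uIcc).exp).deriv]
  have : Real.exp (prim β u) * (β u * Real.exp (-prim β u) * q u) = β u * q u := by
    rw [Real.exp_neg]
    field_simp
  rw [this, volt, prim]
  ring

lemma abs_volt_le (hL : ∀ t, |β t| ≤ L) {Q : ℝ} (hQ : ∀ u ∈ Icc 0 T, |q u| ≤ Q) {t : ℝ}
    (ht : t ∈ Icc 0 T) :
    |volt β q t| ≤ Real.exp (L * T) * (L * Real.exp (L * T) * Q * T) := by
  have hL0 : 0 ≤ L := (abs_nonneg _).trans (hL 0)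
  have hQ0 : 0 ≤ Q := (abs_nonneg _).trans (hQ t ht)
  have hT : 0 ≤ T := ht.1.trans ht.2
  rw [volt, abs_mul, abs_of_pos (Real.exp_pos _)]
  have h1 : prim β t ≤ L * T := (le_abs_self _).trans (abs_prim_le hL ht)
  have h2 : |∫ u in 0..t, β u * Real.exp (-prim β u) * q u| ≤ L * Real.exp (L * T) * Q * T := by
    refine (abs_integral_le (M := L * Real.exp (L * T) * Q) ht.1 fun u hu => ?_).trans ?_
    · have hu' : u ∈ Icc 0 T := ⟨hu.1.le, hu.2.trans ht.2⟩
      have h3 : -prim β u ≤ L * T := (neg_le_abs _).trans (abs_prim_le hL hu')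
      rw [abs_mul, abs_mul, abs_of_pos (Real.exp_pos _)]
      gcongr
      · exact hL u
      · exact hQ u hu'
    · rw [sub_zero]
      gcongr
      exact ht.2
  gcongr

lemma volt_congr {q' : ℝ → ℝ} {t : ℝ} (ht : 0 ≤ t) (h : ∀ u ∈ Ioc 0 t, q u = q' u) :
    volt β q t = volt β q' t := by
  rw [volt, volt]
  congr 1
  refine intervalIntegral.integral_congr_ae (ae_of_all _ fun u hu => ?_)
  rw [uIoc_of_le ht] at hu
  rw [h u hu]

lemma continuousOn_volt (hβ : Measurable β) (hL : ∀ t, |β t| ≤ L) (hT : 0 ≤ T)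
    (hq : IntervalIntegrable q volume 0 T) : ContinuousOn (volt β q) (Icc 0 T) := by
  refine ContinuousOn.mul ?_ ?_
  · exact (Real.continuous_exp.comp (continuous_prim hβ hL)).continuousOn
  · have := intervalIntegral.continuousOn_primitive_interval
      ((intervalIntegrable_iff' enorm_ne_top).1 (intervalIntegrable_kernel_mul hβ hL hq))
    rwa [uIcc_of_le hT] at this

end Volt

/-! ### Primitives as elements of `W_1^α` -/

/-- The norm of the embedding of Lipschitz functions, vanishing at `0`, into `W_1^α(0,T)`. -/
def primConst (α T : ℝ) : ℝ := T + T ^ α * (T ^ (1 - 2 * α) / (1 - 2 * α))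

lemma primConst_nonneg {α T : ℝ} (hα' : α < 1 / 2) (hT : 0 ≤ T) : 0 ≤ primConst α T := by
  have : 0 < 1 - 2 * α := by linarith
  unfold primConst
  positivity

section Primitive

variable {α T M : ℝ} {φ : ℝ → ℝ}

/-- A Lipschitz bound, weakened to order `1-α` so that the Hölder criterion for `W_1^α` applies. -/
lemma abs_primitive_sub_le (hα : 0 < α) (hφ : IntervalIntegrable φ volume 0 T)
    (hM : ∀ u ∈ Ioc 0 T, |φ u| ≤ M) (hM0 : 0 ≤ M) {s t : ℝ} (hs : 0 ≤ s) (hst : s ≤ t)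
    (htT : t ≤ T) :
    |(∫ u in 0..t, φ u) - ∫ u in 0..s, φ u| ≤ M * T ^ α * (t - s) ^ (1 - α) := by
  have hsub : ∀ {t}, 0 ≤ t → t ≤ T → IntervalIntegrable φ volume 0 t := fun h0 h1 =>
    hφ.mono_set (uIcc_subset_uIcc_left (by rw [uIcc_of_le (h0.trans h1)]; exact ⟨h0, h1⟩))
  rw [intervalIntegral.integral_interval_sub_left (hsub (hs.trans hst) htT)
    (hsub hs (hst.trans htT))]
  refine (abs_integral_le hst fun u hu => hM u ⟨hs.trans_lt hu.1, hu.2.trans htT⟩).trans ?_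
  rw [mul_assoc]
  refine mul_le_mul_of_nonneg_left ?_ hM0
  have h0 : 0 ≤ t - s := sub_nonneg.2 hst
  rcases h0.eq_or_lt with h | h
  · rw [← h]
    have : 0 ≤ T := hs.trans (hst.trans htT)
    positivity
  · calc t - s = (t - s) ^ α * (t - s) ^ (1 - α) := by
          rw [← Real.rpow_add h]; simp
      _ ≤ T ^ α * (t - s) ^ (1 - α) := by
          gcongr
          linarith

lemma eNorm1_primitive_le (hα : 0 < α) (hα' : α < 1 / 2) (hφ : IntervalIntegrable φ volume 0 T)
    (hM : ∀ u ∈ Ioc 0 T, |φ u| ≤ M) (hM0 : 0 ≤ M) (hT : 0 ≤ T) :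
    eNorm1 α 0 T (fun t => ∫ u in 0..t, φ u) ≤ ENNReal.ofReal (primConst α T * M) := by
  refine (eNorm1_le_of_holder (A := M * T ^ α) (B := M * T) hα' (by positivity) (by positivity)
    (fun t ht => ?_) fun s t hs hst htT => abs_primitive_sub_le hα hφ hM hM0 hs hst htT).trans
    (ENNReal.ofReal_le_ofReal (le_of_eq ?_))
  · refine (abs_integral_le ht.1 fun u hu => hM u ⟨hu.1, hu.2.trans ht.2⟩).trans ?_
    rw [sub_zero]
    exact mul_le_mul_of_nonneg_left ht.2 hM0
  · rw [primConst]; ring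

lemma measurable_indicator_primitive (hφ : IntervalIntegrable φ volume 0 T) (hT : 0 ≤ T) :
    Measurable ((Icc 0 T).indicator fun t => ∫ u in 0..t, φ u) := by
  have hc := intervalIntegral.continuousOn_primitive_interval
    ((intervalIntegrable_iff' enorm_ne_top).1 hφ)
  rw [uIcc_of_le hT] at hc
  rw [← piecewise_eq_indicator]
  exact hc.measurable_piecewise continuousOn_const measurableSet_Icc

end Primitive

lemma W1.intervalIntegrable {α T : ℝ} (hT : 0 ≤ T) (q : W1 α 0 T) :
    IntervalIntegrable q volume 0 T :=
  intervalIntegrable_of_bounded hT q.measurable.aestronglyMeasurable fun u _ => q.abs_le u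

section VoltOp

variable {α T L : ℝ} {β : ℝ → ℝ}

lemma intervalIntegrable_volt_integrand (hβ : Measurable β) (hL : ∀ t, |β t| ≤ L) (hT : 0 ≤ T)
    {q : ℝ → ℝ} (hq : IntervalIntegrable q volume 0 T) :
    IntervalIntegrable (fun u => β u * (q u + volt β q u)) volume 0 T := by
  have h1 : IntervalIntegrable (volt β q) volume 0 T :=
    ContinuousOn.intervalIntegrable (by
      rw [uIcc_of_le hT]; exact continuousOn_volt hβ hL hT hq)
  have h2 := hq.add h1
  rw [intervalIntegrable_iff] at h2 ⊢
  exact h2.bdd_mul (c := L) hβ.aestronglyMeasurable (ae_of_all _ hL)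

/-- The operator `volt β` on `W_1^α(0,T)`. -/
def voltOp (hα : 0 < α) (hα' : α < 1 / 2) (hT : 0 ≤ T) (hβ : Measurable β)
    (hL : ∀ t, |β t| ≤ L) : W1 α 0 T →L[ℝ] W1 α 0 T :=
  W1.mkOp (fun q => volt β q)
    (fun q => by
      rw [← piecewise_eq_indicator]
      exact (continuousOn_volt hβ hL hT (q.intervalIntegrable hT)).measurable_piecewise
        continuousOn_const measurableSet_Icc)
    (by
      have hL0 : 0 ≤ L := (abs_nonneg _).trans (hL 0)
      refine ⟨primConst α T * (L * (1 + Real.exp (L * T) * (L * Real.exp (L * T) * T))),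
        mul_nonneg (primConst_nonneg hα' hT) (by positivity), fun q => ?_⟩
      rw [eNorm1_congr fun t ht => volt_eq hβ hL (q.intervalIntegrable hT) ht]
      refine (eNorm1_primitive_le hα hα'
        (M := L * (‖q‖ + Real.exp (L * T) * (L * Real.exp (L * T) * ‖q‖ * T)))
        (intervalIntegrable_volt_integrand hβ hL hT (q.intervalIntegrable hT))
        (fun u hu => ?_) (by positivity) hT).trans (ENNReal.ofReal_le_ofReal (le_of_eq (by ring)))
      rw [abs_mul]
      refine mul_le_mul (hL u) ((abs_add_le _ _).trans (add_le_add (q.abs_le u) ?_))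
        (abs_nonneg _) hL0
      exact abs_volt_le hL (fun u _ => q.abs_le u) (Ioc_subset_Icc_self hu))
    (fun q q' t ht => by
      have h1 := intervalIntegrable_kernel_mul hβ hL (q.intervalIntegrable hT)
      have h2 := intervalIntegrable_kernel_mul hβ hL (q'.intervalIntegrable hT)
      have hs := uIcc_subset_uIcc_left (by rwa [uIcc_of_le hT] : t ∈ uIcc 0 T)
      rw [volt, volt, volt, ← mul_add, ← intervalIntegral.integral_add (h1.mono_set hs)
        (h2.mono_set hs)]
      congr 1
      refine intervalIntegral.integral_congr fun u _ => ?_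
      exact mul_add _ _ _)
    (fun c q t ht => by
      rw [volt, volt, mul_left_comm]
      congr 1
      rw [← intervalIntegral.integral_const_mul]
      refine intervalIntegral.integral_congr fun u _ => ?_
      change β u * Real.exp (-prim β u) * (c * q u) = c * (β u * Real.exp (-prim β u) * q u)
      ring)

lemma voltOp_apply (hα : 0 < α) (hα' : α < 1 / 2) (hT : 0 ≤ T) (hβ : Measurable β)
    (hL : ∀ t, |β t| ≤ L) (q : W1 α 0 T) {t : ℝ} (ht : t ∈ Icc 0 T) :
    voltOp hα hα' hT hβ hL q t = volt β q t := W1.mkOp_apply _ _ _ _ _ q ht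

end VoltOp

/-! ### Integral equations driven by an element of `W_1^α` -/

section Equation

variable {α T c : ℝ} {b : ℝ → ℝ}

/-- Bootstrapping: the primitive of the integrable `b(X)` is continuous, hence bounded on `[0,T]`,
so `X` is bounded. Then `b(X)` is bounded, its primitive is Lipschitz, and `X` is a constant plus
two elements of `W_1^α`. -/
lemma solution_mem (hα : 0 < α) (hα' : α < 1 / 2) (hT : 0 ≤ T) (hb : IsCb 2 b) {X : ℝ → ℝ}
    (q : W1 α 0 T) (hbX : IntervalIntegrable (fun s => b (X s)) volume 0 T)
    (h : ∀ t ∈ Icc 0 T, X t = c + (∫ s in 0..t, b (X s)) + q t) :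
    Measurable ((Icc 0 T).indicator X) ∧ eNorm1 α 0 T X < ∞ := by
  obtain ⟨C, hC, h1, -⟩ := hb.exists_bound
  have hcont : ContinuousOn (fun t => ∫ s in 0..t, b (X s)) (Icc 0 T) := by
    have := intervalIntegral.continuousOn_primitive_interval
      ((intervalIntegrable_iff' enorm_ne_top).1 hbX)
    rwa [uIcc_of_le hT] at this
  obtain ⟨P, hP⟩ := isCompact_Icc.exists_bound_of_continuousOn hcont
  have hX : ∀ t ∈ Icc 0 T, |X t| ≤ |c| + P + ‖q‖ := fun t ht => by
    rw [h t ht]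
    exact (abs_add_le _ _).trans (add_le_add ((abs_add_le _ _).trans
      (add_le_add le_rfl (hP t ht))) (q.abs_le t))
  have hP0 : 0 ≤ P := (norm_nonneg _).trans (hP 0 ⟨le_rfl, hT⟩)
  have hM : ∀ u ∈ Ioc 0 T, |b (X u)| ≤ C * (|c| + P + ‖q‖) + |b 0| := fun u hu => by
    have e1 := abs_sub_le_of_deriv hb.differentiable h1 (X u) 0
    have e2 := abs_add_le (b (X u) - b 0) (b 0)
    rw [sub_add_cancel] at e2
    rw [sub_zero] at e1
    have e3 := mul_le_mul_of_nonneg_left (hX u (Ioc_subset_Icc_self hu)) hC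
    linarith
  have hm := measurable_indicator_primitive hbX hT
  have hn := eNorm1_primitive_le hα hα' hbX hM (by positivity) hT
  set p : W1 α 0 T := toW1 α 0 T _ hm (hn.trans_lt ENNReal.ofReal_lt_top) with hp
  have hXp : ∀ t ∈ Icc 0 T, X t = c + p t + q t := fun t ht => by
    rw [h t ht, hp, toW1_apply ht]
  constructor
  · rw [indicator_congr hXp]
    exact ((measurable_const.add p.measurable).add q.measurable).indicator measurableSet_Icc
  · refine lt_of_le_of_lt ?_ (ENNReal.ofReal_lt_top (r := 1 * ‖p‖ + 1 * ‖q‖ + (|c| + ‖q‖)))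
    refine eNorm1_le_of_increments p q zero_le_one zero_le_one (by positivity) (fun u hu => ?_)
      fun u hu v hv => ?_
    · rw [hXp u hu]
      have := abs_add_le (c + p u) (q u)
      have := abs_add_le c (p u)
      linarith [q.abs_le u]
    · rw [hXp u hu, hXp v hv]
      have := abs_add_le (p u - p v) (q u - q v)
      rw [one_mul, one_mul]
      refine le_trans (le_of_eq ?_) this
      congr 1; ring

/-- The constant in `gronwall_integral`. -/
def gronwallConst (L T : ℝ) : ℝ := 1 + L * (T * Real.exp (L * T))

lemma one_le_gronwallConst {L T : ℝ} (hL : 0 ≤ L) (hT : 0 ≤ T) : 1 ≤ gronwallConst L T := by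
  rw [gronwallConst]
  have : 0 ≤ L * (T * Real.exp (L * T)) := by positivity
  linarith

/-- First order expansion of the solution of `X_t = c + ∫_0^t b(X_s) ds + q_t` in `q`. -/
lemma solution_expansion (hα : 0 < α) (hα' : α < 1 / 2) (hT : 0 ≤ T) (hb : IsCb 2 b) {C : ℝ}
    (h1 : ∀ x, |deriv b x| ≤ C) (h2 : ∀ x, |deriv (deriv b) x| ≤ C)
    {X X' q q' : W1 α 0 T} (hX : ∀ t ∈ Icc 0 T, X t = c + (∫ s in 0..t, b (X s)) + q t)
    (hX' : ∀ t ∈ Icc 0 T, X' t = c + (∫ s in 0..t, b (X' s)) + q' t) :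
    ‖X' - X - ((q' - q) + voltOp hα hα' hT (β := fun t => deriv b (X t))
      (hb.contDiff_deriv.continuous.measurable.comp X.measurable) (fun t => h1 (X t)) (q' - q))‖
      ≤ primConst α T * (C * gronwallConst C T ^ 3 * (T * C) + C * gronwallConst C T ^ 2)
        * ‖q' - q‖ ^ 2 := by
  have hC : 0 ≤ C := (abs_nonneg _).trans (h1 0)
  have hβ : Measurable fun t => deriv b (X t) :=
    hb.contDiff_deriv.continuous.measurable.comp X.measurable
  have hbi : ∀ Y : W1 α 0 T, IntervalIntegrable (fun s => b (Y s)) volume 0 T := fun Y =>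
    (intervalIntegrable_of_bounded (M := ‖nem hb Y‖) hT
      (hb.differentiable.continuous.measurable.comp Y.measurable).aestronglyMeasurable
      fun u hu => by
        have := (nem hb Y).abs_le u
        rwa [nem_apply hb Y (Ioc_subset_Icc_self hu)] at this)
  have hsub : ∀ {φ : ℝ → ℝ}, IntervalIntegrable φ volume 0 T → ∀ {t}, t ∈ Icc 0 T →
      IntervalIntegrable φ volume 0 t := fun h t ht =>
    h.mono_set (uIcc_subset_uIcc_left (by rwa [uIcc_of_le hT]))
  set G := gronwallConst C T with hG
  have hG1 : 1 ≤ G := one_le_gronwallConst hC hT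
  -- `D` is the true increment of the solution, `V` the candidate from the linearised equation, and
  -- `E = D - V` the error. `E` solves the linearised equation with source `ρ`, the Taylor remainder
  -- of `b`, which is quadratic in `δ` once Grönwall bounds `D` by `‖δ‖ G`.
  set δ := q' - q with hδ
  set V := δ + voltOp hα hα' hT hβ (fun t => h1 (X t)) δ with hV
  set D := X' - X with hD
  set E := D - V with hE
  have hVeq : ∀ t ∈ Icc 0 T, V t = δ t + volt (fun t => deriv b (X t)) δ t := fun t ht => by
    rw [hV, W1.add_apply, voltOp_apply hα hα' hT hβ _ δ ht]
  have hVint : ∀ t ∈ Icc 0 T, V t = δ t + ∫ u in 0..t, deriv b (X u) * V u := fun t ht => by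
    rw [hVeq t ht, volt_eq hβ (fun t => h1 (X t)) (δ.intervalIntegrable hT) ht]
    congr 1
    refine intervalIntegral.integral_congr fun u hu => ?_
    rw [uIcc_of_le ht.1] at hu
    simp only [hVeq u ⟨hu.1, hu.2.trans ht.2⟩]
  have hDint : ∀ t ∈ Icc 0 T, D t = δ t + ∫ u in 0..t, (b (X' u) - b (X u)) := fun t ht => by
    rw [intervalIntegral.integral_sub (hsub (hbi X') ht) (hsub (hbi X) ht), hD, hδ,
      W1.sub_apply, W1.sub_apply, hX t ht, hX' t ht]
    ring
  have hDG : ∀ t ∈ Icc 0 T, |D t| ≤ ‖δ‖ * G := fun t ht => by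
    have := gronwall_integral (e := D) (a := 0) (b := T) hC (norm_nonneg δ)
      (D.intervalIntegrable hT) (fun t ht => ?_) ht
    · rwa [sub_zero] at this
    · rw [hDint t ht]
      refine (abs_add_le _ _).trans (add_le_add (δ.abs_le t) ?_)
      rw [← intervalIntegral.integral_const_mul]
      refine (intervalIntegral.abs_integral_le_integral_abs ht.1).trans ?_
      refine intervalIntegral.integral_mono_on ht.1
        ((hsub (hbi X') ht).sub (hsub (hbi X) ht)).abs
        ((hsub (D.intervalIntegrable hT).abs ht).const_mul C) fun u _ => ?_
      exact abs_sub_le_of_deriv hb.differentiable h1 _ _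
  set ρ : ℝ → ℝ := fun u => b (X' u) - b (X u) - deriv b (X u) * D u with hρ
  have hρb : ∀ u ∈ Icc 0 T, |ρ u| ≤ C * G ^ 2 * ‖δ‖ ^ 2 := fun u hu => by
    have := taylor_first_order hb h2 (X u) (D u)
    rw [show X u + D u = X' u by rw [hD, W1.sub_apply]; ring] at this
    refine this.trans ?_
    calc C * |D u| * |D u| ≤ C * (‖δ‖ * G) * (‖δ‖ * G) := by
          gcongr <;> exact hDG u hu
      _ = _ := by ring
  have hEi : IntervalIntegrable (fun u => deriv b (X u) * E u) volume 0 T := by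
    have := E.intervalIntegrable hT
    rw [intervalIntegrable_iff] at this ⊢
    exact this.bdd_mul (c := C) hβ.aestronglyMeasurable (ae_of_all _ fun t => h1 (X t))
  have hVi : IntervalIntegrable (fun u => deriv b (X u) * V u) volume 0 T := by
    have := V.intervalIntegrable hT
    rw [intervalIntegrable_iff] at this ⊢
    exact this.bdd_mul (c := C) hβ.aestronglyMeasurable (ae_of_all _ fun t => h1 (X t))
  have hEint : ∀ t ∈ Icc 0 T, E t = ∫ u in 0..t, (deriv b (X u) * E u + ρ u) := fun t ht => by
    rw [hE, W1.sub_apply, hDint t ht, hVint t ht, add_sub_add_left_eq_sub,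
      ← intervalIntegral.integral_sub ((hsub (hbi X') ht).sub (hsub (hbi X) ht)) (hsub hVi ht)]
    refine intervalIntegral.integral_congr fun u _ => ?_
    simp only [hρ, W1.sub_apply]
    ring
  have hφ : IntervalIntegrable (fun u => deriv b (X u) * E u + ρ u) volume 0 T := by
    refine (((hbi X').sub (hbi X)).sub hVi).congr fun u _ => ?_
    simp only [hρ, hE, W1.sub_apply]
    ring
  have hρi : IntervalIntegrable ρ volume 0 T := by
    refine (hφ.sub hEi).congr fun u _ => ?_
    simp
  have hEG : ∀ t ∈ Icc 0 T, |E t| ≤ C * G ^ 2 * ‖δ‖ ^ 2 * T * G := fun t ht => by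
    have := gronwall_integral (e := E) (a := 0) (b := T) (A := C * G ^ 2 * ‖δ‖ ^ 2 * T) hC
      (by positivity) (E.intervalIntegrable hT) (fun t ht => ?_) ht
    · rwa [sub_zero] at this
    · rw [hEint t ht, intervalIntegral.integral_add (hsub hEi ht) (hsub hρi ht), add_comm]
      refine (abs_add_le _ _).trans (add_le_add ?_ ?_)
      · refine (abs_integral_le ht.1 fun u hu => hρb u ⟨hu.1.le, hu.2.trans ht.2⟩).trans ?_
        rw [sub_zero]
        gcongr
        exact ht.2
      · rw [← intervalIntegral.integral_const_mul]
        refine (intervalIntegral.abs_integral_le_integral_abs ht.1).trans ?_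
        refine intervalIntegral.integral_mono_on ht.1 (hsub hEi ht).abs
          ((hsub (E.intervalIntegrable hT).abs ht).const_mul C) fun u _ => ?_
        rw [abs_mul]
        gcongr
        exact h1 _
  -- From the supremum norm to the `W_1^α`-norm: `E` is a primitive, so a bound on its integrand
  -- suffices.
  have hfin := eNorm1_primitive_le (M := (C * G ^ 3 * (T * C) + C * G ^ 2) * ‖δ‖ ^ 2) hα hα' hφ
    (fun u hu => by
      have hu' := Ioc_subset_Icc_self hu
      calc |deriv b (X u) * E u + ρ u| ≤ C * (C * G ^ 2 * ‖δ‖ ^ 2 * T * G)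
            + C * G ^ 2 * ‖δ‖ ^ 2 := by
            refine (abs_add_le _ _).trans (add_le_add ?_ (hρb u hu'))
            rw [abs_mul]
            exact mul_le_mul (h1 _) (hEG u hu') (abs_nonneg _) hC
        _ = _ := by ring) (by positivity) hT
  rw [← eNorm1_congr hEint] at hfin
  have hpc := primConst_nonneg hα' hT
  exact (W1.norm_le E (by positivity) hfin).trans (le_of_eq (by ring))

end Equation

/-! ### Differential calculus on a seminormed space -/

section Seminormed

variable {E F G : Type*} [SeminormedAddCommGroup E] [NormedSpace ℝ E] [NormedAddCommGroup F]
  [NormedSpace ℝ F] [NormedAddCommGroup G] [NormedSpace ℝ G] {f : E → F} {f' : E →L[ℝ] F} {g : E}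

/-- The source space is only seminormed, since the seminorm of `W_2^{1-α}` kills constants. The
rules of this section are derived directly from the `o`-definition of the derivative. -/
lemma isBigO_sub_of_hasFDerivAt (h : HasFDerivAt f f' g) :
    (fun y => f y - f g) =O[𝓝 g] fun y => y - g := by
  have h1 := h.isLittleO.isBigO
  have h2 : (fun y => f' (y - g)) =O[𝓝 g] fun y => y - g := f'.isBigO_comp _ _
  exact (h1.add h2).congr_left fun y => by abel

lemma tendsto_of_hasFDerivAt (h : HasFDerivAt f f' g) : Tendsto f (𝓝 g) (𝓝 (f g)) := by
  have h2 := (isBigO_sub_of_hasFDerivAt h).norm_right.trans_tendsto (tendsto_norm_sub_self g)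
  simpa using h2.add_const (f g)

lemma hasFDerivAt_comp_of_seminormed {φ : F → G} {φ' : F →L[ℝ] G}
    (hφ : HasFDerivAt φ φ' (f g)) (h : HasFDerivAt f f' g) :
    HasFDerivAt (fun y => φ (f y)) (φ'.comp f') g := by
  rw [hasFDerivAt_iff_isLittleO]
  have h1 := (hφ.isLittleO.comp_tendsto (tendsto_of_hasFDerivAt h)).trans_isBigO
    (isBigO_sub_of_hasFDerivAt h)
  have h2 : (fun y => φ' (f y - f g - f' (y - g))) =o[𝓝 g] fun y => y - g :=
    (φ'.isBigO_comp _ _).trans_isLittleO h.isLittleO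
  refine (h1.add h2).congr_left fun y => ?_
  simp only [Function.comp_apply, map_sub, ContinuousLinearMap.comp_apply]
  abel

/-- The remainder is `B (f y - f g) (y - g)`, of second order, plus `B · g` applied to the remainder
of `f`. -/
lemma hasFDerivAt_bilinear_self (B : F →L[ℝ] E →L[ℝ] G) (h : HasFDerivAt f f' g) :
    HasFDerivAt (fun y => B (f y) y) (B (f g) + (B.flip g).comp f') g := by
  rw [hasFDerivAt_iff_isLittleO]
  have h1 : (fun y => B (f y - f g) (y - g)) =o[𝓝 g] fun y => y - g := by
    have e1 : (fun y => B (f y - f g) (y - g)) =O[𝓝 g] fun y => ‖f y - f g‖ * ‖y - g‖ :=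
      Asymptotics.IsBigO.of_bound ‖B‖ (Eventually.of_forall fun y => by
        rw [Real.norm_of_nonneg (by positivity), ← mul_assoc]
        exact B.le_opNorm₂ _ _)
    have e2 : (fun y => ‖f y - f g‖) =o[𝓝 g] fun _ => (1 : ℝ) := by
      rw [Asymptotics.isLittleO_one_iff]
      have := (tendsto_of_hasFDerivAt h).sub_const (f g)
      rw [sub_self] at this
      simpa using this.norm
    have e3 := e2.mul_isBigO (Asymptotics.isBigO_refl (fun y => ‖y - g‖) (𝓝 g))
    simp only [one_mul] at e3
    exact (e1.trans_isLittleO e3).trans_isBigO (Asymptotics.isBigO_norm_left.2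
      (Asymptotics.isBigO_refl _ _))
  have h2 : (fun y => B.flip g (f y - f g - f' (y - g))) =o[𝓝 g] fun y => y - g :=
    ((B.flip g).isBigO_comp _ _).trans_isLittleO h.isLittleO
  refine (h1.add h2).congr_left fun y => ?_
  simp only [map_sub, sub_apply, add_apply,
    ContinuousLinearMap.comp_apply, ContinuousLinearMap.flip_apply]
  abel

/-- A map which depends on a differentiable one up to a quadratic error is differentiable. -/
lemma hasFDerivAt_of_quadratic {X : E → G} (Λ : F →L[ℝ] G) (K : ℝ) (h : HasFDerivAt f f' g)
    (hX : ∀ y, ‖X y - X g - Λ (f y - f g)‖ ≤ K * ‖f y - f g‖ ^ 2) :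
    HasFDerivAt X (Λ.comp f') g := by
  rw [hasFDerivAt_iff_isLittleO]
  have h1 : (fun y => X y - X g - Λ (f y - f g)) =o[𝓝 g] fun y => y - g := by
    have e1 : (fun y => X y - X g - Λ (f y - f g)) =O[𝓝 g] fun y => ‖f y - f g‖ * ‖f y - f g‖ :=
      Asymptotics.IsBigO.of_bound K (Eventually.of_forall fun y => by
        rw [Real.norm_of_nonneg (by positivity), ← pow_two]
        exact hX y)
    have e2 : (fun y => ‖f y - f g‖) =o[𝓝 g] fun _ => (1 : ℝ) := by
      rw [Asymptotics.isLittleO_one_iff]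
      have := (tendsto_of_hasFDerivAt h).sub_const (f g)
      rw [sub_self] at this
      simpa using this.norm
    have e3 := e2.mul_isBigO (isBigO_sub_of_hasFDerivAt h).norm_norm
    simp only [one_mul] at e3
    exact (e1.trans_isLittleO e3).trans_isBigO (Asymptotics.isBigO_norm_left.2
      (Asymptotics.isBigO_refl _ _))
  have h2 : (fun y => Λ (f y - f g - f' (y - g))) =o[𝓝 g] fun y => y - g :=
    (Λ.isBigO_comp _ _).trans_isLittleO h.isLittleO
  refine (h1.add h2).congr_left fun y => ?_
  simp only [map_sub, ContinuousLinearMap.comp_apply]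
  abel

end Seminormed

/-! ### Differentiability of the solution map -/

section Solution

variable {α r T : ℝ} {b σ η : ℝ → ℝ}

/-- The driving term `∫_0^· σ(y_{s-r}) dg_s`. -/
def drive (hα : 0 < α) (hα' : α < 1 / 2) (hσ : IsCb 2 σ) (y : W1 α (-r) (T - r)) (g : W2 α T) :
    W1 α 0 T := intOp T hα hα' (nem hσ (shift α r T y)) g

lemma drive_apply (hα : 0 < α) (hα' : α < 1 / 2) (hσ : IsCb 2 σ) (y : W1 α (-r) (T - r))
    (g : W2 α T) {t : ℝ} (ht : t ∈ Icc 0 T) :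
    drive hα hα' hσ y g t = gsInt α 0 t (fun s => σ (y (s - r))) g := by
  rw [drive, intOp_apply hα hα' _ _ ht]
  refine gsInt_congr fun s hs => ?_
  have hs' : s ∈ Icc 0 T := ⟨hs.1.le, hs.2.trans ht.2⟩
  rw [nem_apply hσ _ hs', shift_apply y hs']

/-- The derivative of the driving term with respect to the driving path. -/
def driveDer (hα : 0 < α) (hα' : α < 1 / 2) (hσ : IsCb 2 σ) (y : W1 α (-r) (T - r)) (g : W2 α T)
    (D : W2 α T →L[ℝ] W1 α (-r) (T - r)) : W2 α T →L[ℝ] W1 α 0 T :=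
  intOp T hα hα' (nem hσ (shift α r T y)) +
    ((intOp T hα hα').flip g).comp ((nemDer hσ (shift α r T y)).comp ((shift α r T).comp D))

lemma driveDer_apply (hα : 0 < α) (hα' : α < 1 / 2) (hσ : IsCb 2 σ) (y : W1 α (-r) (T - r))
    (g : W2 α T) (D : W2 α T →L[ℝ] W1 α (-r) (T - r)) (h : W2 α T) {t : ℝ} (ht : t ∈ Icc 0 T) :
    driveDer hα hα' hσ y g D h t = gsInt α 0 t (fun s => σ (y (s - r))) h
      + gsInt α 0 t (fun u => deriv σ (y (u - r)) * D h (u - r)) g := by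
  rw [← drive_apply hα hα' hσ y h ht]
  have e : driveDer hα hα' hσ y g D h = drive hα hα' hσ y h
      + intOp T hα hα' (nemDer hσ (shift α r T y) (shift α r T (D h))) g := rfl
  rw [e, W1.add_apply, intOp_apply hα hα' _ _ ht]
  congr 1
  refine gsInt_congr fun s hs => ?_
  have hs' : s ∈ Icc 0 T := ⟨hs.1.le, hs.2.trans ht.2⟩
  rw [nemDer_apply hσ _ _ hs', shift_apply _ hs', shift_apply _ hs']

lemma hasFDerivAt_drive (hα : 0 < α) (hα' : α < 1 / 2) (hσ : IsCb 2 σ)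
    {Y : W2 α T → W1 α (-r) (T - r)} {D : W2 α T →L[ℝ] W1 α (-r) (T - r)} {g : W2 α T}
    (hY : HasFDerivAt Y D g) :
    HasFDerivAt (fun g' => drive hα hα' hσ (Y g') g') (driveDer hα hα' hσ (Y g) g D) g :=
  hasFDerivAt_bilinear_self (intOp T hα hα') (f := fun g' => nem hσ (shift α r T (Y g')))
    (hasFDerivAt_comp_of_seminormed (φ := nem hσ) (hasFDerivAt_nem hσ (shift α r T (Y g)))
      (hasFDerivAt_comp_of_seminormed (φ := shift α r T) (shift α r T).hasFDerivAt hY))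

lemma IsDelaySolution.mem (hα : 0 < α) (hα' : α < 1 / 2) (hT : 0 ≤ T) (hb : IsCb 2 b)
    (hσ : IsCb 2 σ) {y : W1 α (-r) (T - r)} {g : W2 α T} {x : ℝ → ℝ}
    (hx : IsDelaySolution α r T b σ η y g x) :
    Measurable ((Icc 0 T).indicator x) ∧ eNorm1 α 0 T x < ∞ :=
  solution_mem (c := η 0) hα hα' hT hb (drive hα hα' hσ y g) hx.integrable fun t ht => by
    rw [drive_apply hα hα' hσ y g ht]
    exact hx.eq t ht

/-- The solution of the delay equation on `[0,T]` as an element of `W_1^α`. -/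
def IsDelaySolution.toW1 (hα : 0 < α) (hα' : α < 1 / 2) (hT : 0 ≤ T) (hb : IsCb 2 b)
    (hσ : IsCb 2 σ) {y : W1 α (-r) (T - r)} {g : W2 α T} {x : ℝ → ℝ}
    (hx : IsDelaySolution α r T b σ η y g x) : W1 α 0 T :=
  FracDelay.toW1 α 0 T x (hx.mem hα hα' hT hb hσ).1 (hx.mem hα hα' hT hb hσ).2

lemma IsDelaySolution.toW1_apply (hα : 0 < α) (hα' : α < 1 / 2) (hT : 0 ≤ T) (hb : IsCb 2 b)
    (hσ : IsCb 2 σ) {y : W1 α (-r) (T - r)} {g : W2 α T} {x : ℝ → ℝ}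
    (hx : IsDelaySolution α r T b σ η y g x) {t : ℝ} (ht : t ∈ Icc 0 T) :
    hx.toW1 hα hα' hT hb hσ t = x t := FracDelay.toW1_apply ht

lemma IsDelaySolution.toW1_eq (hα : 0 < α) (hα' : α < 1 / 2) (hT : 0 ≤ T) (hb : IsCb 2 b)
    (hσ : IsCb 2 σ) {y : W1 α (-r) (T - r)} {g : W2 α T} {x : ℝ → ℝ}
    (hx : IsDelaySolution α r T b σ η y g x) {t : ℝ} (ht : t ∈ Icc 0 T) :
    hx.toW1 hα hα' hT hb hσ t = η 0 + (∫ s in 0..t, b (hx.toW1 hα hα' hT hb hσ s))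
      + drive hα hα' hσ y g t := by
  rw [hx.toW1_apply hα hα' hT hb hσ ht, hx.eq t ht, drive_apply hα hα' hσ y g ht]
  congr 2
  refine intervalIntegral.integral_congr fun s hs => ?_
  rw [uIcc_of_le ht.1] at hs
  simp only [hx.toW1_apply hα hα' hT hb hσ (⟨hs.1, hs.2.trans ht.2⟩ : s ∈ Icc 0 T)]

/-- The solution map is differentiable; its derivative solves the linearized equation. -/
lemma exists_hasFDerivAt_solution (hα : 0 < α) (hα' : α < 1 / 2) (hT : 0 ≤ T) (hb : IsCb 2 b)
    (hσ : IsCb 2 σ) {Y : W2 α T → W1 α (-r) (T - r)} {D : W2 α T →L[ℝ] W1 α (-r) (T - r)}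
    {x : W2 α T → ℝ → ℝ} (hx : ∀ g, IsDelaySolution α r T b σ η (Y g) g (x g)) {g : W2 α T}
    (hY : HasFDerivAt Y D g) {β : ℝ → ℝ} (hβ : ∀ t ∈ Icc 0 T, β t = deriv b (x g t)) :
    ∃ Dx : W2 α T →L[ℝ] W1 α 0 T,
      HasFDerivAt (fun g' => (hx g').toW1 hα hα' hT hb hσ) Dx g ∧
      ∀ h, ∀ t ∈ Icc 0 T, Dx h t = driveDer hα hα' hσ (Y g) g D h t
        + volt β (driveDer hα hα' hσ (Y g) g D h) t := by
  obtain ⟨C, hC, h1, h2⟩ := hb.exists_bound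
  set X := (hx g).toW1 hα hα' hT hb hσ with hX
  have hm : Measurable fun t => deriv b (X t) :=
    hb.contDiff_deriv.continuous.measurable.comp X.measurable
  refine ⟨(ContinuousLinearMap.id ℝ _ + voltOp hα hα' hT hm fun t => h1 (X t)).comp
    (driveDer hα hα' hσ (Y g) g D), ?_, fun h t ht => ?_⟩
  · exact hasFDerivAt_of_quadratic _ _ (hasFDerivAt_drive hα hα' hσ hY) fun g' =>
      solution_expansion hα hα' hT hb h1 h2 (fun t ht => (hx g).toW1_eq hα hα' hT hb hσ ht)
        fun t ht => (hx g').toW1_eq hα hα' hT hb hσ ht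
  · set q := driveDer hα hα' hσ (Y g) g D h
    have e : ((ContinuousLinearMap.id ℝ _ + voltOp hα hα' hT hm fun t => h1 (X t)).comp
      (driveDer hα hα' hσ (Y g) g D)) h = q + voltOp hα hα' hT hm (fun t => h1 (X t)) q := rfl
    rw [e, W1.add_apply, voltOp_apply hα hα' hT hm _ q ht]
    -- `volt` at time `t` uses its coefficient on `[0,t]` only, so agreement on `[0,T]` is enough to
    -- replace it by `β`.
    have hβX : ∀ u ∈ Icc 0 t, deriv b (X u) = β u := fun u hu => by
      have hu' : u ∈ Icc 0 T := ⟨hu.1, hu.2.trans ht.2⟩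
      rw [hβ u hu', hX, (hx g).toW1_apply hα hα' hT hb hσ hu']
    have hprim : ∀ u ∈ Icc 0 t, prim (fun t => deriv b (X t)) u = prim β u := fun u hu => by
      refine intervalIntegral.integral_congr fun w hw => ?_
      rw [uIcc_of_le hu.1] at hw
      exact hβX w ⟨hw.1, hw.2.trans hu.2⟩
    rw [volt, volt, hprim t ⟨ht.1, le_rfl⟩]
    congr 2
    refine intervalIntegral.integral_congr fun u hu => ?_
    rw [uIcc_of_le ht.1] at hu
    simp only [hβX u hu, hprim u hu]

end Solution

/-! ### Almost everywhere equal integrands -/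

section Congr

variable {α a b : ℝ} {f f' : ℝ → ℝ}

lemma gsNorm_congr_ae (h : f =ᵐ[volume.restrict (Ioc a b)] f') :
    gsNorm α a b f = gsNorm α a b f' := by
  refine lintegral_congr_ae ?_
  filter_upwards [h, ae_restrict_mem measurableSet_Ioc] with t ht hmem
  rw [ht]
  congr 1
  refine lintegral_congr_ae ?_
  filter_upwards [ae_mono (Measure.restrict_mono (Ioc_subset_Ioc_right hmem.2) le_rfl) h] with y hy
  rw [hy]

lemma gsInt_congr_ae {g : ℝ → ℝ} (h : f =ᵐ[volume.restrict (Ioc a b)] f') :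
    gsInt α a b f g = gsInt α a b f' g := by
  rw [gsInt, gsInt]
  congr 1
  refine integral_congr_ae ?_
  filter_upwards [h, ae_restrict_mem measurableSet_Ioc] with t ht hmem
  rw [weylLeft, weylLeft, ht, intervalIntegral.integral_of_le hmem.1.le,
    intervalIntegral.integral_of_le hmem.1.le]
  congr 4
  refine integral_congr_ae ?_
  filter_upwards [ae_mono (Measure.restrict_mono (Ioc_subset_Ioc_right hmem.2) le_rfl) h] with y hy
  rw [hy]

lemma fracNorm_congr_ae (h : f =ᵐ[volume] f') : fracNorm α b f = fracNorm α b f' := by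
  refine lintegral_congr_ae ?_
  filter_upwards [ae_incMeasure_fst h, ae_incMeasure_snd h] with p h1 h2
  rw [h1, h2]

lemma fracNorm_add_le (hf : Measurable f) :
    fracNorm α b (fun s => f s + f' s) ≤ fracNorm α b f + fracNorm α b f' := by
  rw [fracNorm, fracNorm, fracNorm, ← lintegral_add_left (by fun_prop)]
  refine lintegral_mono fun p => ?_
  rw [add_sub_add_comm]
  exact enorm_add_le _ _

lemma fracNorm_const_mul (c : ℝ) (f : ℝ → ℝ) :
    fracNorm α b (fun s => c * f s) = ‖c‖ₑ * fracNorm α b f := by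
  rw [fracNorm, fracNorm, ← lintegral_const_mul' _ _ enorm_ne_top]
  refine lintegral_congr fun p => ?_
  rw [← mul_sub, enorm_mul]

end Congr

/-! ### The integral against a path, in terms of increments -/

/-- The generalized Stieltjes integral over `(0,t)` of a function vanishing on `(-∞,0)`. -/
def incInt (α T : ℝ) (g : ℝ → ℝ) (t : ℝ) (f : ℝ → ℝ) : ℝ :=
  ∫ p, (f p.1 - f p.2) * gsWeight α g t p.1 ∂incMeasure α T

section IncInt

variable {α T t : ℝ} {f f' : ℝ → ℝ}

lemma incInt_congr_ae {g : ℝ → ℝ} (h : f =ᵐ[volume] f') : incInt α T g t f = incInt α T g t f' := by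
  refine integral_congr_ae ?_
  filter_upwards [ae_incMeasure_fst h, ae_incMeasure_snd h] with p h1 h2
  rw [h1, h2]

/-- The weight vanishes for `s ≥ t`, and for `s < t` both ends of the increment lie before `t`. -/
lemma incInt_eq_zero_of_vanish {g : ℝ → ℝ} (h : ∀ s < t, f s = 0) : incInt α T g t f = 0 := by
  refine (integral_congr_ae ?_).trans (integral_zero _ _)
  filter_upwards [ae_incMeasure_lt α T] with p hp
  rcases le_or_gt t p.1 with h1 | h1
  · rw [gsWeight_of_le h1, mul_zero]
  · rw [h _ h1, h _ (hp.trans h1), sub_zero, zero_mul]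

lemma incInt_eq_gsInt_of_vanish (hα : 0 < α) (hα1 : α < 1) (g : W2 α T) (htT : t ≤ T)
    (hf : Measurable f) {a : ℝ} (ha : 0 ≤ a) (h0 : ∀ s ≤ a, f s = 0) (hN : fracNorm α T f < ∞) :
    incInt α T g t f = gsInt α a t f g := by
  rw [gsInt_eq_integral hα hα1 g ha htT hf h0 ((fracNorm_mono htT f).trans_lt hN), incInt,
    integral_incMeasure_gsWeight htT]

/-- The kernels to come may be nonzero at time `0` itself, whereas the representation of the
integral wants functions vanishing on `(-∞,0]`; a null set makes up the difference. -/
lemma ae_eq_indicator_Ioi (h0 : ∀ s < 0, f s = 0) : f =ᵐ[volume] (Ioi (0 : ℝ)).indicator f := by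
  filter_upwards [Measure.ae_ne volume (0 : ℝ)] with s hs
  rcases lt_or_gt_of_ne hs with h | h
  · rw [h0 s h, indicator_of_notMem (by simpa using h.le)]
  · rw [indicator_of_mem (show s ∈ Ioi 0 from h)]

lemma incInt_eq_gsInt (hα : 0 < α) (hα1 : α < 1) (g : W2 α T) (htT : t ≤ T)
    (hf : Measurable f) (h0 : ∀ s < 0, f s = 0) (hN : fracNorm α T f < ∞) :
    incInt α T g t f = gsInt α 0 t f g := by
  rw [incInt_congr_ae (ae_eq_indicator_Ioi h0),
    incInt_eq_gsInt_of_vanish (a := 0) hα hα1 g htT (hf.indicator measurableSet_Ioi) le_rfl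
      (fun s hs => indicator_of_notMem (by simpa using hs) f)
      (by rwa [← fracNorm_congr_ae (ae_eq_indicator_Ioi h0)])]
  exact gsInt_congr fun s hs => indicator_of_mem (show s ∈ Ioi 0 from hs.1) f

lemma incInt_eq_of_vanish_right (hα : 0 < α) (hα1 : α < 1) (g : W2 α T) (ht : t ∈ Icc 0 T)
    (hf : Measurable f) (h0 : ∀ s < 0, f s = 0) (h1 : ∀ s, t < s → f s = 0)
    (hN : fracNorm α T f < ∞) : incInt α T g T f = incInt α T g t f := by
  have e := ae_eq_indicator_Ioi h0
  have hz : ∀ s ≤ 0, (Ioi (0 : ℝ)).indicator f s = 0 := fun s hs =>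
    indicator_of_notMem (by simpa using hs) f
  have hN' := hN
  rw [fracNorm_congr_ae e] at hN'
  have hm := hf.indicator (measurableSet_Ioi (a := (0 : ℝ)))
  rw [incInt_congr_ae e, incInt_congr_ae (t := t) e,
    incInt_eq_gsInt_of_vanish hα hα1 g le_rfl hm le_rfl hz hN',
    incInt_eq_gsInt_of_vanish hα hα1 g ht.2 hm le_rfl hz hN']
  refine gsInt_eq_of_vanish hα hα1 g le_rfl ht.1 ht.2 le_rfl hm hz (fun s hs => ?_) hN'
  rw [indicator_apply, h1 s hs, ite_self]

lemma incInt_add (hα : 0 < α) (hα1 : α < 1) (g : W2 α T) (htT : t ≤ T) (hf : Measurable f)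
    (hN : fracNorm α T f < ∞) (hf' : Measurable f') (hN' : fracNorm α T f' < ∞) :
    incInt α T g t (fun s => f s + f' s) = incInt α T g t f + incInt α T g t f' := by
  rw [incInt, incInt, incInt, ← integral_add
    (integrable_inc_mul_gsWeight hα hα1 g htT (integrable_inc hf hN))
    (integrable_inc_mul_gsWeight hα hα1 g htT (integrable_inc hf' hN'))]
  congr 1 with p
  ring

lemma incInt_const_mul (c : ℝ) (f g : ℝ → ℝ) :
    incInt α T g t (fun s => c * f s) = c * incInt α T g t f := by
  rw [incInt, incInt, ← integral_const_mul]
  congr 1 with p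
  ring

lemma enorm_incInt_le (hα : 0 < α) (hα1 : α < 1) (g : W2 α T) (htT : t ≤ T) (f : ℝ → ℝ) :
    ‖incInt α T g t f‖ₑ ≤ ENNReal.ofReal (gsConst α * ‖g‖) * fracNorm α T f :=
  abs_integral_gsWeight_le hα hα1 g htT _

lemma gsIntegrable_of_fracNorm (hα : 0 < α) (hα1 : α < 1) (hf : Measurable f)
    (h0 : ∀ s < 0, f s = 0) (htT : t ≤ T) (hN : fracNorm α T f < ∞) : GSIntegrable α 0 t f := by
  refine ⟨hf.aemeasurable, ?_⟩
  rw [fracNorm_congr_ae (ae_eq_indicator_Ioi h0)] at hN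
  rw [gsNorm_congr (f' := (Ioi (0 : ℝ)).indicator f) fun s hs =>
    (indicator_of_mem (show s ∈ Ioi 0 from hs.1) f).symm]
  exact (gsNorm_le_fracNorm hα hα1 (hf.indicator measurableSet_Ioi)
    fun s hs => indicator_of_notMem (by simpa using hs) f).trans_lt
    ((fracNorm_mono htT _).trans_lt hN)

end IncInt

/-! ### Products with a delayed factor -/

lemma setLIntegral_shift (H : ℝ → ℝ≥0∞) (a b r : ℝ) :
    ∫⁻ u in Ioc (a + r) (b + r), H (u - r) = ∫⁻ t in Ioc a b, H t := by
  rw [← lintegral_indicator measurableSet_Ioc, ← lintegral_indicator measurableSet_Ioc,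
    ← lintegral_sub_right_eq_self ((Ioc a b).indicator _) r]
  refine lintegral_congr fun u => ?_
  by_cases hu : u ∈ Ioc (a + r) (b + r)
  · have : u - r ∈ Ioc a b := ⟨by linarith [hu.1], by linarith [hu.2]⟩
    rw [indicator_of_mem hu, indicator_of_mem this]
  · have : u - r ∉ Ioc a b := fun h => hu ⟨by linarith [h.1], by linarith [h.2]⟩
    rw [indicator_of_notMem hu, indicator_of_notMem this]

/-- Increments of a product whose second factor is delayed by `r` and vanishes up to time `c`:
`A` and `B` dominate the size and the increments of that factor. -/
lemma lintegral_incMeasure_product_lt_top {α r T c : ℝ} (hα : 0 < α) (hc : 0 ≤ c + r)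
    (Y : W1 α 0 T) {C : ℝ≥0∞} (hC : C ≠ ∞) {A : ℝ → ℝ≥0∞} {B : ℝ → ℝ → ℝ≥0∞}
    (hfin : ∫⁻ t in Ioc c (T - r), (A t / ENNReal.ofReal ((t - c) ^ α)
      + ∫⁻ v in Ioc c t, B t v / ENNReal.ofReal ((t - v) ^ (α + 1))) < ∞)
    {Z : ℝ × ℝ → ℝ≥0∞} (hZ : Measurable Z) {A' : ℝ → ℝ≥0∞}
    (h0 : ∀ u ≤ c + r, ∀ v < u, Z (u, v) = 0) (hA : ∀ u > c + r, ∀ v ≤ c + r, Z (u, v) = A' u)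
    (hA' : ∀ u ∈ Ioc (c + r) T, A' u ≤ C * A (u - r))
    (hB : ∀ u ∈ Ioc (c + r) T, ∀ v ∈ Ioc (c + r) u,
      Z (u, v) ≤ C * B (u - r) (v - r) + C * A (u - r) * ‖Y u - Y v‖ₑ) :
    ∫⁻ p, Z p ∂incMeasure α T < ∞ := by
  have hYm := Y.measurable
  rw [lintegral_incMeasure_split hα hZ h0 hA]
  set H : ℝ → ℝ≥0∞ := fun t => A t / ENNReal.ofReal ((t - c) ^ α)
    + ∫⁻ v in Ioc c t, B t v / ENNReal.ofReal ((t - v) ^ (α + 1)) with hH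
  -- The three summands pay for the boundary term, for the increments of the delayed factor, and for
  -- the increments of `Y`.
  set C' : ℝ≥0∞ := C * ENNReal.ofReal α⁻¹ + C
    + C * (ENNReal.ofReal ((T - r - c) ^ α) * ENNReal.ofReal ‖Y‖) with hC'
  have hC'top : C' ≠ ∞ := by
    rw [hC']
    finiteness
  refine lt_of_le_of_lt (setLIntegral_mono' (g := fun u => C' * H (u - r)) measurableSet_Ioc
    fun u hu => ?_) ?_
  · set t := u - r with ht
    have htc : 0 < t - c := by rw [ht]; linarith [hu.1]
    have hpos : 0 < (t - c) ^ α := Real.rpow_pos_of_pos htc α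
    set P := A t / ENNReal.ofReal ((t - c) ^ α) with hP
    set R := ∫⁻ v in Ioc c t, B t v / ENNReal.ofReal ((t - v) ^ (α + 1)) with hR
    -- The integral of `|Y_u - Y_v|` against the kernel is at most `‖Y‖`, leaving the bare size `A
    -- t`. It is dominated by the boundary density `P`, since `(t-c)^α` is bounded.
    have hAP : A t = P * ENNReal.ofReal ((t - c) ^ α) :=
      (ENNReal.div_mul_cancel (ENNReal.ofReal_pos.2 hpos).ne' ENNReal.ofReal_ne_top).symm
    have k1 : A' u * ENNReal.ofReal (((u - (c + r)) ^ α)⁻¹ / α)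
        ≤ C * ENNReal.ofReal α⁻¹ * P := by
      have e : u - (c + r) = t - c := by rw [ht]; ring
      rw [e, div_eq_mul_inv, ENNReal.ofReal_mul (by positivity), ENNReal.ofReal_inv_of_pos hpos]
      calc _ ≤ C * A t * ((ENNReal.ofReal ((t - c) ^ α))⁻¹ * ENNReal.ofReal α⁻¹) := by
            gcongr
            exact hA' u hu
        _ = _ := by rw [hP, div_eq_mul_inv]; ring
    have k2 : ∫⁻ v in Ioc (c + r) u, B t (v - r) * ENNReal.ofReal (fracKer α (u - v)) ≤ R := by
      have e := setLIntegral_shift (fun v => B t v * ENNReal.ofReal (fracKer α (t - v))) c t r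
      have e' : t + r = u := by rw [ht]; ring
      rw [e'] at e
      have e2 : ∀ v, t - (v - r) = u - v := fun v => by rw [ht]; ring
      simp only [e2] at e
      rw [e]
      refine setLIntegral_mono' measurableSet_Ioc fun v hv => ?_
      rcases hv.2.eq_or_lt with rfl | h
      · simp [fracKer_of_nonpos]
      · have hd : 0 < t - v := sub_pos.2 h
        rw [fracKer_of_pos hd, ENNReal.ofReal_inv_of_pos (by positivity), div_eq_mul_inv]
    have k3 : ∫⁻ v in Ioc (c + r) u, ‖Y u - Y v‖ₑ * ENNReal.ofReal (fracKer α (u - v))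
        ≤ ENNReal.ofReal ‖Y‖ := by
      have hu0 : u ∈ Icc 0 T := ⟨hc.trans hu.1.le, hu.2⟩
      rw [← Y.eNorm1_eq]
      refine le_trans (le_trans (lintegral_mono_set (Ioc_subset_Ioc_left hc)) (le_trans ?_
        le_add_self)) (le_eNorm1 Y hu0)
      refine setLIntegral_mono' measurableSet_Ioc fun v hv => ?_
      rw [ofReal_div_rpow_eq _ _ (sub_nonneg.2 hv.2)
        fun h => by rw [sub_eq_zero] at h; rw [h, sub_self]]
    have k4 : ∫⁻ v in Ioc (c + r) u, Z (u, v) * ENNReal.ofReal (fracKer α (u - v))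
        ≤ C * R + C * (ENNReal.ofReal ((T - r - c) ^ α) * ENNReal.ofReal ‖Y‖) * P := by
      calc _ ≤ ∫⁻ v in Ioc (c + r) u, (C * (B t (v - r) * ENNReal.ofReal (fracKer α (u - v)))
            + C * A t * (‖Y u - Y v‖ₑ * ENNReal.ofReal (fracKer α (u - v)))) := by
            refine setLIntegral_mono' measurableSet_Ioc fun v hv => ?_
            rw [← mul_assoc, ← mul_assoc, ← add_mul]
            gcongr
            exact hB u hu v hv
        _ = C * (∫⁻ v in Ioc (c + r) u, B t (v - r) * ENNReal.ofReal (fracKer α (u - v)))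
            + C * A t * ∫⁻ v in Ioc (c + r) u,
              ‖Y u - Y v‖ₑ * ENNReal.ofReal (fracKer α (u - v)) := by
            rw [lintegral_add_right _ (by fun_prop), lintegral_const_mul' _ _ hC,
              lintegral_const_mul _ (by fun_prop)]
        _ ≤ C * R + C * A t * ENNReal.ofReal ‖Y‖ := by gcongr
        _ ≤ C * R + C * (P * ENNReal.ofReal ((T - r - c) ^ α)) * ENNReal.ofReal ‖Y‖ := by
            have : t - c ≤ T - r - c := by rw [ht]; linarith [hu.2]
            rw [hAP]
            gcongr
        _ = _ := by ring
    calc _ ≤ C * ENNReal.ofReal α⁻¹ * P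
          + (C * R + C * (ENNReal.ofReal ((T - r - c) ^ α) * ENNReal.ofReal ‖Y‖) * P) :=
          add_le_add k1 k4
      _ ≤ C' * (P + R) := by
          rw [hC', mul_add, add_mul, add_mul, add_mul, add_mul]
          calc _ ≤ _ := le_self_add (b := C * P + C * ENNReal.ofReal α⁻¹ * R
                + C * (ENNReal.ofReal ((T - r - c) ^ α) * ENNReal.ofReal ‖Y‖) * R)
            _ = _ := by ring
  · rw [lintegral_const_mul' _ _ hC'top]
    have := setLIntegral_shift H c (T - r) r
    rw [sub_add_cancel] at this
    rw [this]
    exact ENNReal.mul_lt_top hC'top.lt_top hfin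

/-! ### The delayed kernel -/

/-- The kernel `σ'(y_{u-r}) k(s,u-r)` on `{0 ≤ s, s + r < u ≤ T}`. -/
def delayKer (r T : ℝ) (σ y : ℝ → ℝ) (k : ℝ → ℝ → ℝ) (s u : ℝ) : ℝ :=
  if 0 ≤ s ∧ s + r < u ∧ u ≤ T then deriv σ (y (u - r)) * k s (u - r) else 0

section DelayKer

variable {α r T : ℝ} {σ y : ℝ → ℝ} {k : ℝ → ℝ → ℝ}

lemma delayKer_of_neg {s : ℝ} (hs : s < 0) (u : ℝ) : delayKer r T σ y k s u = 0 :=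
  if_neg fun h => hs.not_ge h.1

lemma delayKer_of_le {s u : ℝ} (h : u ≤ s + r) : delayKer r T σ y k s u = 0 :=
  if_neg fun h' => h.not_gt h'.2.1

lemma delayKer_of_le_delay {u : ℝ} (h : u ≤ r) (s : ℝ) : delayKer r T σ y k s u = 0 := by
  rcases lt_or_ge s 0 with hs | hs
  · exact delayKer_of_neg hs u
  · exact delayKer_of_le (by linarith)

lemma delayKer_of_mem {s u : ℝ} (hs : 0 ≤ s) (hu : u ∈ Ioc (s + r) T) :
    delayKer r T σ y k s u = deriv σ (y (u - r)) * k s (u - r) := if_pos ⟨hs, hu.1, hu.2⟩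

lemma measurable_delayKer (hσ : IsCb 2 σ) (hy : Measurable y)
    (hk : Measurable (Function.uncurry k)) :
    Measurable fun q : ℝ × ℝ => delayKer r T σ y k q.1 q.2 := by
  have hσ' := hσ.contDiff_deriv.continuous.measurable
  refine Measurable.ite ?_ ?_ measurable_const
  · exact (measurableSet_le measurable_const measurable_fst).inter
      ((measurableSet_lt (by fun_prop) measurable_snd).inter
        (measurableSet_le measurable_snd measurable_const))
  · exact (hσ'.comp (hy.comp (by fun_prop))).mul
      (hk.comp (measurable_fst.prodMk (measurable_snd.sub_const r)))

lemma measurable_delayKer_right (hσ : IsCb 2 σ) (hy : Measurable y)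
    (hk : Measurable (Function.uncurry k)) (s : ℝ) : Measurable (delayKer r T σ y k s) :=
  (measurable_delayKer hσ hy hk).comp (measurable_const.prodMk measurable_id)

lemma measurable_delayKer_left (hσ : IsCb 2 σ) (hy : Measurable y)
    (hk : Measurable (Function.uncurry k)) (u : ℝ) :
    Measurable fun s => delayKer r T σ y k s u :=
  (measurable_delayKer hσ hy hk).comp (measurable_id.prodMk measurable_const)

/-- The cut-off `s < u - r` is already built into `k`, which vanishes for `s > u - r`; only the
points `s = 0` and `s = u - r` can differ. -/
lemma delayKer_ae_eq (hr : 0 < r) (hk : IsRegularKernel α r T k) {u : ℝ} (hu : u ∈ Ioc r T) :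
    (fun s => delayKer r T σ y k s u) =ᵐ[volume]
      fun s => deriv σ (y (u - r)) * (Ioc 0 T).indicator (fun s => k s (u - r)) s := by
  filter_upwards [Measure.ae_ne volume (0 : ℝ), Measure.ae_ne volume (u - r)] with s h0 h1
  rcases lt_or_gt_of_ne h0 with hs | hs
  · rw [delayKer_of_neg hs, indicator_of_notMem (s := Ioc 0 T) fun h => hs.not_gt h.1, mul_zero]
  · rcases lt_or_gt_of_ne h1 with hsu | hsu
    · rw [delayKer_of_mem hs.le ⟨by linarith, hu.2⟩, indicator_of_mem]
      exact ⟨hs, by linarith [hu.2]⟩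
    · rw [delayKer_of_le (by linarith)]
      by_cases hsT : s ≤ T
      · rw [indicator_of_mem (show s ∈ Ioc 0 T from ⟨hs, hsT⟩), hk.vanish s ⟨hs.le, hsT⟩ (u - r)
          ⟨by linarith [hu.1], by linarith [hu.2]⟩ hsu, mul_zero]
      · rw [indicator_of_notMem (s := Ioc 0 T) fun h => hsT h.2, mul_zero]

lemma fracNorm_indicator_kernel_le (hα : 0 < α) (hα1 : α < 1) {f : ℝ → ℝ} (hf : Measurable f) :
    fracNorm α T ((Ioc 0 T).indicator f) ≤ ENNReal.ofReal α⁻¹ * gsNorm α 0 T f := by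
  refine (fracNorm_le_gsNorm (a := 0) hα hα1 (hf.indicator measurableSet_Ioc) fun s hs =>
    indicator_of_notMem (fun h => hs.not_gt h.1) f).trans_eq ?_
  rw [gsNorm_congr fun s hs => indicator_of_mem hs f]

end DelayKer

section Regular

variable {α r T : ℝ} {σ : ℝ → ℝ} {k : ℝ → ℝ → ℝ}

lemma enorm_le_of_abs_le {x C : ℝ} (h : |x| ≤ C) : ‖x‖ₑ ≤ ENNReal.ofReal C := by
  rw [Real.enorm_eq_ofReal_abs]
  exact ENNReal.ofReal_le_ofReal h

lemma enorm_deriv_sub_le (hσ : IsCb 2 σ) {C : ℝ} (hC : 0 ≤ C)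
    (h2 : ∀ x, |deriv (deriv σ) x| ≤ C) (x z : ℝ) :
    ‖deriv σ x - deriv σ z‖ₑ ≤ ENNReal.ofReal C * ‖x - z‖ₑ := by
  rw [Real.enorm_eq_ofReal_abs (x - z), ← ENNReal.ofReal_mul hC]
  exact enorm_le_of_abs_le (abs_sub_le_of_deriv hσ.differentiable_deriv h2 x z)

/-- The sections `u ↦ σ'(y_{u-r}) k(s,u-r)` of the delayed kernel are integrable. -/
lemma fracNorm_delayKer_right_lt_top (hα : 0 < α) (hr : 0 < r) (hσ : IsCb 2 σ)
    (y : W1 α (-r) (T - r)) (hk : IsRegularKernel α r T k) (s : ℝ) :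
    fracNorm α T (delayKer r T σ y k s) < ∞ := by
  have hm := measurable_delayKer_right (r := r) (T := T) hσ y.measurable hk.measurable s
  -- For `s` outside this interval no `u ≤ T` satisfies `0 ≤ s` and `s + r < u`, so the section is
  -- identically zero.
  by_cases hs : s ∈ Icc 0 (T - r)
  swap
  · have : delayKer r T σ y k s = fun _ => 0 := by
      ext u
      refine if_neg fun h => hs ⟨h.1, by linarith [h.2.1, h.2.2]⟩
    rw [this]
    simp [fracNorm]
  obtain ⟨C, hC, h1, h2⟩ := hσ.exists_bound
  refine lintegral_incMeasure_product_lt_top (c := s) (r := r) hα (by linarith [hs.1])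
    (shift α r T y) (C := ENNReal.ofReal C) ENNReal.ofReal_ne_top
    (A := fun t => ‖k s t‖ₑ) (B := fun t v => ‖k s t - k s v‖ₑ) ?_ (by fun_prop)
    (A' := fun u => ‖delayKer r T σ y k s u‖ₑ) (fun u hu v hv => ?_) (fun u hu v hv => ?_)
    (fun u hu => ?_) fun u hu v hv => ?_
  · refine lt_of_eq_of_lt ?_ (hk.section_right s hs).2
    refine setLIntegral_congr_fun measurableSet_Ioc fun t ht => ?_
    have htp : 0 < t - s := sub_pos.2 ht.1
    congr 1
    · rw [ENNReal.ofReal_div_of_pos (by positivity), Real.enorm_eq_ofReal_abs]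
    · refine setLIntegral_congr_fun measurableSet_Ioc fun v hv => ?_
      rcases hv.2.eq_or_lt with rfl | h
      · simp
      · have : 0 < t - v := sub_pos.2 h
        simp only
        rw [ENNReal.ofReal_div_of_pos (by positivity), Real.enorm_eq_ofReal_abs]
  · simp [delayKer_of_le hu, delayKer_of_le (hv.le.trans hu)]
  · simp [delayKer_of_le hv]
  · rw [delayKer_of_mem hs.1 hu, enorm_mul]
    gcongr
    exact enorm_le_of_abs_le (h1 _)
  · have hv' : v ∈ Ioc (s + r) T := ⟨hv.1, hv.2.trans hu.2⟩
    have hsr : 0 ≤ s + r := by linarith [hs.1]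
    simp only
    rw [delayKer_of_mem hs.1 hu, delayKer_of_mem hs.1 hv',
      shift_apply y ⟨hsr.trans hu.1.le, hu.2⟩, shift_apply y ⟨hsr.trans hv'.1.le, hv'.2⟩,
      show deriv σ (y (u - r)) * k s (u - r) - deriv σ (y (v - r)) * k s (v - r)
        = deriv σ (y (v - r)) * (k s (u - r) - k s (v - r))
          + k s (u - r) * (deriv σ (y (u - r)) - deriv σ (y (v - r))) by ring]
    refine (enorm_add_le _ _).trans ?_
    rw [enorm_mul, enorm_mul]
    refine add_le_add ?_ ?_
    · gcongr
      exact enorm_le_of_abs_le (h1 _)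
    · rw [mul_comm (ENNReal.ofReal C), mul_assoc]
      gcongr
      exact enorm_deriv_sub_le hσ hC h2 _ _

lemma measurable_fracNorm_delayKer_sub {y : ℝ → ℝ} (hσ : IsCb 2 σ) (hy : Measurable y)
    (hk : Measurable (Function.uncurry k)) : Measurable fun q : ℝ × ℝ =>
      fracNorm α T fun s => delayKer r T σ y k s q.1 - delayKer r T σ y k s q.2 := by
  refine Measurable.lintegral_prod_right' (f := fun z : (ℝ × ℝ) × (ℝ × ℝ) =>
    ‖(delayKer r T σ y k z.2.1 z.1.1 - delayKer r T σ y k z.2.1 z.1.2)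
      - (delayKer r T σ y k z.2.2 z.1.1 - delayKer r T σ y k z.2.2 z.1.2)‖ₑ) ?_
  have e : ∀ i j : (ℝ × ℝ) × (ℝ × ℝ) → ℝ, Measurable i → Measurable j →
      Measurable fun z => delayKer r T σ y k (i z) (j z) := fun i j hi hj =>
    (measurable_delayKer hσ hy hk).comp (hi.prodMk hj)
  exact (((e _ _ (by fun_prop) (by fun_prop)).sub (e _ _ (by fun_prop) (by fun_prop))).sub
    ((e _ _ (by fun_prop) (by fun_prop)).sub (e _ _ (by fun_prop) (by fun_prop)))).enorm

/-- The mixed increments of the delayed kernel are integrable. -/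
lemma lintegral_fracNorm_delayKer_lt_top (hα : 0 < α) (hα1 : α < 1) (hr : 0 < r) (hσ : IsCb 2 σ)
    (y : W1 α (-r) (T - r)) (hk : IsRegularKernel α r T k) :
    ∫⁻ q, fracNorm α T (fun s => delayKer r T σ y k s q.1 - delayKer r T σ y k s q.2)
      ∂incMeasure α T < ∞ := by
  have hkm : ∀ t, Measurable fun s => k s t := fun t =>
    hk.measurable.comp (measurable_id.prodMk measurable_const)
  obtain ⟨C, hC, h1, h2⟩ := hσ.exists_bound
  refine lintegral_incMeasure_product_lt_top (c := 0) (r := r) hα (by linarith)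
    (shift α r T y) (C := ENNReal.ofReal C * ENNReal.ofReal α⁻¹) (by finiteness)
    (A := fun t => gsNorm α 0 T (fun s => k s t))
    (B := fun t v => gsNorm α 0 T (fun s => k s t - k s v)) ?_ ?_
    (A' := fun u => fracNorm α T fun s => delayKer r T σ y k s u) (fun u hu v hv => ?_)
    (fun u hu v hv => ?_) (fun u hu => ?_) fun u hu v hv => ?_
  · simpa only [sub_zero] using hk.mixed
  · exact measurable_fracNorm_delayKer_sub hσ y.measurable hk.measurable
  · rw [zero_add] at hu
    simp [delayKer_of_le_delay hu, delayKer_of_le_delay (hv.le.trans hu), fracNorm]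
  · rw [zero_add] at hv
    change fracNorm α T (fun s => delayKer r T σ y k s u - delayKer r T σ y k s v) = _
    simp only [delayKer_of_le_delay hv, sub_zero]
  · rw [zero_add] at hu
    rw [fracNorm_congr_ae (delayKer_ae_eq hr hk hu), fracNorm_const_mul, mul_assoc]
    gcongr
    · exact enorm_le_of_abs_le (h1 _)
    · exact fracNorm_indicator_kernel_le hα hα1 (hkm _)
  · rw [zero_add] at hu hv
    have hv' : v ∈ Ioc r T := ⟨hv.1, hv.2.trans hu.2⟩
    set I := fun t => (Ioc 0 T).indicator fun s => k s t with hI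
    have hIm : ∀ t, Measurable (I t) := fun t => (hkm t).indicator measurableSet_Ioc
    -- Product rule for the increment in time: one term carries the increment of `k`, the other the
    -- increment of `σ'(y)`, which is controlled by that of the shifted path.
    have e : (fun s => delayKer r T σ y k s u - delayKer r T σ y k s v) =ᵐ[volume] fun s =>
        deriv σ (y (v - r)) * (I (u - r) s - I (v - r) s)
          + (deriv σ (y (u - r)) - deriv σ (y (v - r))) * I (u - r) s := by
      filter_upwards [delayKer_ae_eq (σ := σ) (y := y) hr hk hu,
        delayKer_ae_eq (σ := σ) (y := y) hr hk hv'] with s e1 e2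
      rw [e1, e2]
      ring
    have e3 : (fun s => I (u - r) s - I (v - r) s)
        = (Ioc 0 T).indicator fun s => k s (u - r) - k s (v - r) := by
      ext s
      by_cases hs : s ∈ Ioc 0 T <;> simp [hI, hs]
    change fracNorm α T (fun s => delayKer r T σ y k s u - delayKer r T σ y k s v) ≤ _
    rw [fracNorm_congr_ae e, shift_apply y ⟨hr.le.trans hu.1.le, hu.2⟩,
      shift_apply y ⟨hr.le.trans hv'.1.le, hv'.2⟩]
    refine (fracNorm_add_le (((hIm _).sub (hIm _)).const_mul _)).trans (add_le_add ?_ ?_)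
    · rw [fracNorm_const_mul, mul_assoc]
      refine mul_le_mul' (enorm_le_of_abs_le (h1 _)) ?_
      · change fracNorm α T (fun s => I (u - r) s - I (v - r) s) ≤ _
        rw [e3]
        exact fracNorm_indicator_kernel_le hα hα1 ((hkm _).sub (hkm _))
    · rw [fracNorm_const_mul]
      calc _ ≤ (ENNReal.ofReal C * ‖y (u - r) - y (v - r)‖ₑ)
            * (ENNReal.ofReal α⁻¹ * gsNorm α 0 T fun s => k s (u - r)) := by
            gcongr
            · exact enorm_deriv_sub_le hσ hC h2 _ _
            · exact fracNorm_indicator_kernel_le hα hα1 (hkm _)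
        _ = _ := by ring

/-- Almost all sections `s ↦ σ'(y_{u-r}) k(s,u-r)` of the delayed kernel are integrable. -/
lemma ae_fracNorm_delayKer_left_lt_top (hα : 0 < α) (hα1 : α < 1) (hr : 0 < r) (hσ : IsCb 2 σ)
    (y : W1 α (-r) (T - r)) (hk : IsRegularKernel α r T k) :
    ∀ᵐ u, fracNorm α T (fun s => delayKer r T σ y k s u) < ∞ := by
  have hm := measurable_delayKer (r := r) (T := T) hσ y.measurable hk.measurable
  have hfin := lintegral_fracNorm_delayKer_lt_top hα hα1 hr hσ y hk
  rw [lintegral_incMeasure_split (a := r) hα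
    (A := fun u => fracNorm α T fun s => delayKer r T σ y k s u)
    (measurable_fracNorm_delayKer_sub hσ y.measurable hk.measurable)
    (fun u hu v hv => by
      simp [delayKer_of_le_delay hu, delayKer_of_le_delay (hv.le.trans hu), fracNorm])
    (fun u hu v hv => by simp [delayKer_of_le_delay hv])] at hfin
  have hA : Measurable fun u => fracNorm α T fun s => delayKer r T σ y k s u :=
    Measurable.lintegral_prod_right' (f := fun z : ℝ × (ℝ × ℝ) =>
      ‖delayKer r T σ y k z.2.1 z.1 - delayKer r T σ y k z.2.2 z.1‖ₑ)
      ((hm.comp (f := fun z : ℝ × (ℝ × ℝ) => (z.2.1, z.1)) (by fun_prop)).sub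
        (hm.comp (f := fun z : ℝ × (ℝ × ℝ) => (z.2.2, z.1)) (by fun_prop))).enorm
  -- Of the finite mixed integral keep only its boundary part, the seminorm of the section times a
  -- positive factor. Finiteness of that integral makes almost every section finite.
  have h1 := (lintegral_mono fun u => le_self_add).trans_lt hfin
  have h2 := ae_lt_top (by fun_prop) h1.ne
  rw [ae_restrict_iff' measurableSet_Ioc] at h2
  filter_upwards [h2] with u hu
  by_cases hmem : u ∈ Ioc r T
  · have h3 := hu hmem
    have h4 : 0 < u - r := sub_pos.2 hmem.1
    by_contra h5
    rw [not_lt, top_le_iff] at h5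
    rw [h5, ENNReal.top_mul (ENNReal.ofReal_pos.2 (by positivity)).ne'] at h3
    exact lt_irrefl _ h3
  · have : (fun s => delayKer r T σ y k s u) = fun _ => 0 := by
      ext s
      rcases le_or_gt u r with h | h
      · exact delayKer_of_le_delay h s
      · exact if_neg fun h' => hmem ⟨h, h'.2.2⟩
    rw [this]
    simp [fracNorm]

end Regular

/-! ### Integrals of the delayed kernel -/

/-- The integral `∫_s^u σ'(y_{v-r}) k(s,v-r) dg_v`. -/
def kerInt (α r T : ℝ) (σ y : ℝ → ℝ) (k : ℝ → ℝ → ℝ) (g : ℝ → ℝ) (u s : ℝ) : ℝ :=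
  incInt α T g u (delayKer r T σ y k s)

section KerInt

variable {α r T : ℝ} {σ : ℝ → ℝ} {k : ℝ → ℝ → ℝ}

lemma kerInt_of_neg {y g : ℝ → ℝ} {s : ℝ} (hs : s < 0) (u : ℝ) :
    kerInt α r T σ y k g u s = 0 :=
  incInt_eq_zero_of_vanish fun _ _ => delayKer_of_neg hs _

lemma kerInt_of_le {y g : ℝ → ℝ} {s u : ℝ} (h : u ≤ s + r) : kerInt α r T σ y k g u s = 0 :=
  incInt_eq_zero_of_vanish fun _ hv => delayKer_of_le (hv.le.trans h)

lemma measurable_kerInt {y g : ℝ → ℝ} (hσ : IsCb 2 σ) (hy : Measurable y)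
    (hk : Measurable (Function.uncurry k)) (hg : Measurable g) :
    Measurable fun q : ℝ × ℝ => kerInt α r T σ y k g q.1 q.2 := by
  have hd := measurable_delayKer (r := r) (T := T) hσ hy hk
  have h1 : Measurable fun z : (ℝ × ℝ) × (ℝ × ℝ) =>
      (delayKer r T σ y k z.1.2 z.2.1 - delayKer r T σ y k z.1.2 z.2.2)
        * gsWeight α g z.1.1 z.2.1 :=
    ((hd.comp (f := fun z : (ℝ × ℝ) × (ℝ × ℝ) => (z.1.2, z.2.1)) (by fun_prop)).sub
      (hd.comp (f := fun z : (ℝ × ℝ) × (ℝ × ℝ) => (z.1.2, z.2.2)) (by fun_prop))).mul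
      ((measurable_gsWeight_uncurry (α := α) hg).comp
        (f := fun z : (ℝ × ℝ) × (ℝ × ℝ) => (z.1.1, z.2.1)) (by fun_prop))
  exact (h1.stronglyMeasurable.integral_prod_right' (ν := incMeasure α T)).measurable

lemma measurable_kerInt_right {y g : ℝ → ℝ} (hσ : IsCb 2 σ) (hy : Measurable y)
    (hk : Measurable (Function.uncurry k)) (hg : Measurable g) (u : ℝ) :
    Measurable (kerInt α r T σ y k g u) :=
  (measurable_kerInt hσ hy hk hg).comp (measurable_const.prodMk measurable_id)

lemma delayKer_ae_eq_right {y : ℝ → ℝ} (hk : IsRegularKernel α r T k) {s t : ℝ}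
    (hs : s ∈ Icc 0 T) (htT : t ≤ T) :
    delayKer r T σ y k s =ᵐ[volume.restrict (Ioc s t)]
      fun v => deriv σ (y (v - r)) * k s (v - r) := by
  filter_upwards [ae_restrict_mem measurableSet_Ioc,
    ae_restrict_of_ae (Measure.ae_ne volume (s + r))] with v hv hne
  rcases lt_or_gt_of_ne hne with h | h
  · rw [delayKer_of_le h.le, hk.vanish s hs (v - r) ⟨by linarith [hv.1, hs.1], by
      linarith [hv.2]⟩ (by linarith), mul_zero]
  · exact delayKer_of_mem hs.1 ⟨h, hv.2.trans htT⟩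

lemma kerInt_eq_gsInt (hα : 0 < α) (hα1 : α < 1) (hr : 0 < r) (hσ : IsCb 2 σ)
    (y : W1 α (-r) (T - r)) (hk : IsRegularKernel α r T k) (g : W2 α T) {s t : ℝ}
    (hs : s ∈ Icc 0 T) (htT : t ≤ T) : kerInt α r T σ y k g t s
      = gsInt α s t (fun v => deriv σ (y (v - r)) * k s (v - r)) g := by
  rw [kerInt, incInt_eq_gsInt_of_vanish hα hα1 g htT
    (measurable_delayKer_right hσ y.measurable hk.measurable s) hs.1
    (fun v hv => delayKer_of_le (by linarith))
    (fracNorm_delayKer_right_lt_top hα hr hσ y hk s)]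
  exact gsInt_congr_ae (delayKer_ae_eq_right hk hs htT)

lemma gsIntegrable_delay (hα : 0 < α) (hα1 : α < 1) (hr : 0 < r) (hσ : IsCb 2 σ)
    (y : W1 α (-r) (T - r)) (hk : IsRegularKernel α r T k) {s t : ℝ}
    (hs : s ∈ Icc 0 T) (htT : t ≤ T) :
    GSIntegrable α s t (fun v => deriv σ (y (v - r)) * k s (v - r)) := by
  have hm := measurable_delayKer_right (r := r) (T := T) hσ y.measurable hk.measurable s
  have he := delayKer_ae_eq_right (σ := σ) (y := y) hk hs htT
  refine ⟨hm.aemeasurable.congr he, ?_⟩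
  rw [← gsNorm_congr_ae he]
  exact (gsNorm_le_fracNorm hα hα1 hm fun v hv => delayKer_of_le (by linarith)).trans_lt
    ((fracNorm_mono htT _).trans_lt (fracNorm_delayKer_right_lt_top hα hr hσ y hk s))

/-- The bound on the weight is the same for all upper limits, hence uniformity in `u`. -/
lemma exists_abs_kerInt_le (hα : 0 < α) (hα1 : α < 1) (hr : 0 < r) (hσ : IsCb 2 σ)
    (y : W1 α (-r) (T - r)) (hk : IsRegularKernel α r T k) (g : W2 α T) (s : ℝ) :
    ∃ M, ∀ u ≤ T, |kerInt α r T σ y k g u s| ≤ M := by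
  have h1 := fracNorm_delayKer_right_lt_top hα hr hσ y hk s
  refine ⟨(ENNReal.ofReal (gsConst α * ‖g‖) * fracNorm α T (delayKer r T σ y k s)).toReal,
    fun u hu => ?_⟩
  rw [← Real.norm_eq_abs, ← toReal_enorm]
  exact ENNReal.toReal_mono (by finiteness) (enorm_incInt_le hα hα1 g hu _)

/-- Mixed increments of the delayed kernel. -/
def mixedInc (r T : ℝ) (σ y : ℝ → ℝ) (k : ℝ → ℝ → ℝ) (p q : ℝ × ℝ) : ℝ :=
  (delayKer r T σ y k p.1 q.1 - delayKer r T σ y k p.1 q.2)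
    - (delayKer r T σ y k p.2 q.1 - delayKer r T σ y k p.2 q.2)

lemma measurable_mixedInc {y : ℝ → ℝ} (hσ : IsCb 2 σ) (hy : Measurable y)
    (hk : Measurable (Function.uncurry k)) :
    Measurable fun z : (ℝ × ℝ) × (ℝ × ℝ) => mixedInc r T σ y k z.1 z.2 := by
  have e : ∀ i j : (ℝ × ℝ) × (ℝ × ℝ) → ℝ, Measurable i → Measurable j →
      Measurable fun z => delayKer r T σ y k (i z) (j z) := fun i j hi hj =>
    (measurable_delayKer hσ hy hk).comp (hi.prodMk hj)
  exact ((e _ _ (by fun_prop) (by fun_prop)).sub (e _ _ (by fun_prop) (by fun_prop))).sub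
    ((e _ _ (by fun_prop) (by fun_prop)).sub (e _ _ (by fun_prop) (by fun_prop)))

lemma lintegral_mixedInc {y : ℝ → ℝ} (hσ : IsCb 2 σ) (hy : Measurable y)
    (hk : Measurable (Function.uncurry k)) :
    ∫⁻ p, ∫⁻ q, ‖mixedInc r T σ y k p q‖ₑ ∂incMeasure α T ∂incMeasure α T
      = ∫⁻ q, fracNorm α T (fun s => delayKer r T σ y k s q.1 - delayKer r T σ y k s q.2)
        ∂incMeasure α T :=
  lintegral_lintegral_swap (measurable_mixedInc hσ hy hk).enorm.aemeasurable

/-- An increment in `s` of the integral in time is the integral of mixed increments; through this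
identity the mixed condition on the kernel enters. -/
lemma kerInt_sub_eq (hα : 0 < α) (hα1 : α < 1) (hr : 0 < r) (hσ : IsCb 2 σ)
    (y : W1 α (-r) (T - r)) (hk : IsRegularKernel α r T k) (g : W2 α T) {u : ℝ} (hu : u ≤ T)
    (p : ℝ × ℝ) : kerInt α r T σ y k g u p.1 - kerInt α r T σ y k g u p.2
      = ∫ q, mixedInc r T σ y k p q * gsWeight α g u q.1 ∂incMeasure α T := by
  have hi : ∀ s, Integrable (fun q : ℝ × ℝ => (delayKer r T σ y k s q.1
      - delayKer r T σ y k s q.2) * gsWeight α g u q.1) (incMeasure α T) := fun s =>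
    integrable_inc_mul_gsWeight hα hα1 g hu (integrable_inc
      (measurable_delayKer_right hσ y.measurable hk.measurable s)
      (fracNorm_delayKer_right_lt_top hα hr hσ y hk s))
  rw [kerInt, kerInt, incInt, incInt, ← integral_sub (hi p.1) (hi p.2)]
  refine integral_congr_ae (ae_of_all _ fun q => ?_)
  simp only [mixedInc]
  ring

lemma exists_fracNorm_kerInt_le (hα : 0 < α) (hα1 : α < 1) (hr : 0 < r) (hσ : IsCb 2 σ)
    (y : W1 α (-r) (T - r)) (hk : IsRegularKernel α r T k) (g : W2 α T) :
    ∃ M : ℝ≥0∞, M < ∞ ∧ ∀ u ≤ T, fracNorm α T (kerInt α r T σ y k g u) ≤ M := by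
  refine ⟨_, ENNReal.mul_lt_top (ENNReal.ofReal_lt_top (r := gsConst α * ‖g‖))
    (lintegral_fracNorm_delayKer_lt_top hα hα1 hr hσ y hk), fun u hu => ?_⟩
  rw [← lintegral_mixedInc hσ y.measurable hk.measurable, ← lintegral_const_mul' _ _
    ENNReal.ofReal_ne_top]
  refine lintegral_mono fun p => ?_
  rw [kerInt_sub_eq hα hα1 hr hσ y hk g hu]
  exact abs_integral_gsWeight_le hα hα1 g hu _

/-- Exchange of two generalized Stieltjes integrals of the delayed kernel. -/
lemma incInt_kerInt (hα : 0 < α) (hα1 : α < 1) (hr : 0 < r) (hσ : IsCb 2 σ)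
    (y : W1 α (-r) (T - r)) (hk : IsRegularKernel α r T k) (g h : W2 α T) {u : ℝ} (hu : u ≤ T) :
    incInt α T h T (kerInt α r T σ y k g u)
      = incInt α T g u fun v => incInt α T h T fun s => delayKer r T σ y k s v := by
  have hgm := g.measurable
  have hhm := h.measurable
  have hW : Measurable (gsWeight α h T) := measurable_gsWeight hhm T
  have hG : Measurable (gsWeight α g u) := measurable_gsWeight hgm u
  -- The mixed condition is absolute integrability on the product of the two increment measures; the
  -- bounded weights preserve it, so Fubini applies.
  have hΔ : Integrable (fun z : (ℝ × ℝ) × (ℝ × ℝ) => mixedInc r T σ y k z.1 z.2)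
      ((incMeasure α T).prod (incMeasure α T)) := by
    have hm := measurable_mixedInc (r := r) (T := T) hσ y.measurable hk.measurable
    refine ⟨hm.aestronglyMeasurable, ?_⟩
    rw [HasFiniteIntegral, lintegral_prod _ hm.enorm.aemeasurable]
    exact (lintegral_mixedInc hσ y.measurable hk.measurable).trans_lt
      (lintegral_fracNorm_delayKer_lt_top hα hα1 hr hσ y hk)
  have hI : Integrable (fun z : (ℝ × ℝ) × (ℝ × ℝ) => mixedInc r T σ y k z.1 z.2
      * gsWeight α g u z.2.1 * gsWeight α h T z.1.1)
      ((incMeasure α T).prod (incMeasure α T)) :=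
    (hΔ.mul_bdd (c := gsConst α * ‖g‖) (Measurable.aestronglyMeasurable (by fun_prop))
      (ae_of_all _ fun z => abs_gsWeight_le hα hα1 g hu z.2.1)).mul_bdd (c := gsConst α * ‖h‖)
      (Measurable.aestronglyMeasurable (by fun_prop))
      (ae_of_all _ fun z => abs_gsWeight_le hα hα1 h le_rfl z.1.1)
  have hae := ae_fracNorm_delayKer_left_lt_top hα hα1 hr hσ y hk
  have hi : ∀ v, fracNorm α T (fun s => delayKer r T σ y k s v) < ∞ →
      Integrable (fun p : ℝ × ℝ => (delayKer r T σ y k p.1 v - delayKer r T σ y k p.2 v)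
        * gsWeight α h T p.1) (incMeasure α T) := fun v hv =>
    integrable_inc_mul_gsWeight hα hα1 h le_rfl (integrable_inc
      (f := fun s => delayKer r T σ y k s v)
      (measurable_delayKer_left hσ y.measurable hk.measurable v) hv)
  calc incInt α T h T (kerInt α r T σ y k g u)
      = ∫ p, ∫ q, mixedInc r T σ y k p q * gsWeight α g u q.1 * gsWeight α h T p.1
          ∂incMeasure α T ∂incMeasure α T := by
        refine integral_congr_ae (ae_of_all _ fun p => ?_)
        simp only
        rw [kerInt_sub_eq hα hα1 hr hσ y hk g hu, integral_mul_const]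
    _ = ∫ q, ∫ p, mixedInc r T σ y k p q * gsWeight α g u q.1 * gsWeight α h T p.1
          ∂incMeasure α T ∂incMeasure α T := integral_integral_swap hI
    _ = _ := by
        refine integral_congr_ae ?_
        filter_upwards [ae_incMeasure_fst hae, ae_incMeasure_snd hae] with q h1 h2
        rw [incInt, incInt, ← integral_sub (hi _ h1) (hi _ h2), ← integral_mul_const]
        refine integral_congr_ae (ae_of_all _ fun p => ?_)
        simp only [mixedInc]
        ring

end KerInt

/-! ### The kernel of the derivative of the solution -/

/-- The inhomogeneity `σ(y_{s-r}) + ∫_s^t σ'(y_{u-r}) k(s,u-r) dg_u`, for `0 ≤ s ≤ t`. -/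
def source (α r T : ℝ) (σ y : ℝ → ℝ) (k : ℝ → ℝ → ℝ) (g : ℝ → ℝ) (t s : ℝ) : ℝ :=
  (if 0 ≤ s ∧ s ≤ t then σ (y (s - r)) else 0) + kerInt α r T σ y k g t s

/-- The solution of the linear Volterra equation with inhomogeneity `source`. -/
def resolv (α r T : ℝ) (β σ y : ℝ → ℝ) (k : ℝ → ℝ → ℝ) (g : ℝ → ℝ) (t s : ℝ) : ℝ :=
  source α r T σ y k g t s + volt β (fun u => source α r T σ y k g u s) t

section Source

variable {α r T : ℝ} {σ : ℝ → ℝ} {k : ℝ → ℝ → ℝ}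

lemma source_of_neg {y g : ℝ → ℝ} {s : ℝ} (hs : s < 0) (t : ℝ) :
    source α r T σ y k g t s = 0 := by
  rw [source, if_neg fun h => hs.not_ge h.1, kerInt_of_neg hs, add_zero]

lemma source_of_lt (hr : 0 < r) {y g : ℝ → ℝ} {s t : ℝ} (h : t < s) :
    source α r T σ y k g t s = 0 := by
  rw [source, if_neg fun h' => h.not_ge h'.2, kerInt_of_le (by linarith), add_zero]

lemma measurable_source {y g : ℝ → ℝ} (hσ : IsCb 2 σ) (hy : Measurable y)
    (hk : Measurable (Function.uncurry k)) (hg : Measurable g) :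
    Measurable fun q : ℝ × ℝ => source α r T σ y k g q.1 q.2 := by
  refine Measurable.add (Measurable.ite ?_ ?_ measurable_const) (measurable_kerInt hσ hy hk hg)
  · exact (measurableSet_le measurable_const measurable_snd).inter
      (measurableSet_le measurable_snd measurable_fst)
  · exact hσ.differentiable.continuous.measurable.comp (hy.comp (by fun_prop))

lemma measurable_source_right {y g : ℝ → ℝ} (hσ : IsCb 2 σ) (hy : Measurable y)
    (hk : Measurable (Function.uncurry k)) (hg : Measurable g) (t : ℝ) :
    Measurable (source α r T σ y k g t) :=
  (measurable_source hσ hy hk hg).comp (measurable_const.prodMk measurable_id)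

lemma intervalIntegrable_source (hα : 0 < α) (hα1 : α < 1) (hr : 0 < r) (hT : 0 ≤ T)
    (hσ : IsCb 2 σ) (y : W1 α (-r) (T - r)) (hk : IsRegularKernel α r T k) (g : W2 α T) (s : ℝ) :
    IntervalIntegrable (fun u => source α r T σ y k g u s) volume 0 T := by
  obtain ⟨M, hM⟩ := exists_abs_kerInt_le hα hα1 hr hσ y hk g s
  refine intervalIntegrable_of_bounded (M := |σ (y (s - r))| + M) hT
    ((measurable_source hσ y.measurable hk.measurable g.measurable).comp
      (measurable_id.prodMk measurable_const)).aestronglyMeasurable fun u hu => ?_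
  refine (abs_add_le _ _).trans (add_le_add ?_ (hM u hu.2))
  split_ifs
  · exact le_rfl
  · rw [abs_zero]; exact abs_nonneg _

lemma nem_shift_apply (hσ : IsCb 2 σ) (y : W1 α (-r) (T - r)) {s : ℝ} (hs : s ∈ Icc 0 T) :
    nem hσ (shift α r T y) s = σ (y (s - r)) := by
  rw [nem_apply hσ _ hs, shift_apply y hs]

lemma source_ae_eq (hσ : IsCb 2 σ) (y : W1 α (-r) (T - r)) (g : ℝ → ℝ) {t : ℝ} (htT : t ≤ T) :
    source α r T σ y k g t =ᵐ[volume]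
      fun s => (Ioc 0 t).indicator (nem hσ (shift α r T y)) s + kerInt α r T σ y k g t s := by
  filter_upwards [Measure.ae_ne volume (0 : ℝ)] with s hs
  rw [source]
  congr 1
  by_cases h : 0 ≤ s ∧ s ≤ t
  · rw [if_pos h, indicator_of_mem (show s ∈ Ioc 0 t from ⟨lt_of_le_of_ne h.1 hs.symm, h.2⟩),
      nem_shift_apply hσ y ⟨h.1, h.2.trans htT⟩]
  · rw [if_neg h, indicator_of_notMem fun h' : s ∈ Ioc 0 t => h ⟨h'.1.le, h'.2⟩]

/-- Uniformity in `t` is what allows the later exchange with a Lebesgue integral in time. -/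
lemma exists_fracNorm_source_le (hα : 0 < α) (hα1 : α < 1) (hr : 0 < r) (hσ : IsCb 2 σ)
    (y : W1 α (-r) (T - r)) (hk : IsRegularKernel α r T k) (g : W2 α T) :
    ∃ M : ℝ≥0∞, M < ∞ ∧ ∀ t ∈ Icc 0 T, fracNorm α T (source α r T σ y k g t) ≤ M := by
  obtain ⟨M, hM, h⟩ := exists_fracNorm_kerInt_le hα hα1 hr hσ y hk g
  set f := nem hσ (shift α r T y)
  refine ⟨ENNReal.ofReal ‖f‖ * (ENNReal.ofReal (α⁻¹ * (T ^ (1 - α) / (1 - α)) + T)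
    + ENNReal.ofReal (α⁻¹ * (T ^ (1 - α) / (1 - α)))) + M, by finiteness, fun t ht => ?_⟩
  rw [fracNorm_congr_ae (source_ae_eq hσ y g ht.2)]
  refine (fracNorm_add_le (measurable_indicator_Ioc f.measurable 0 t)).trans
    (add_le_add ?_ (h t ht.2))
  refine (fracNorm_indicator_le hα hα1 f.measurable (norm_nonneg f) f.eNorm1_eq.le le_rfl ht.1
    ht.2 ht.2).trans ?_
  have h1 : 0 < 1 - α := by linarith
  have h2 : 0 ≤ t - 0 := by linarith [ht.1]
  have h3 : 0 ≤ T - t := by linarith [ht.2]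
  gcongr <;> linarith [ht.1, ht.2]

/-- The integral of the inhomogeneity against a direction is the derivative of the driving term
in that direction. -/
lemma incInt_source (hα : 0 < α) (hα' : α < 1 / 2) (hr : 0 < r) (hσ : IsCb 2 σ)
    (y : W1 α (-r) (T - r)) (hk : IsRegularKernel α r T k) (g h : W2 α T)
    {D : W2 α T →L[ℝ] W1 α (-r) (T - r)}
    (hD : ∀ t ∈ Icc (-r) (T - r), D h t = gsInt α 0 t (fun s => k s t) h) {t : ℝ}
    (ht : t ∈ Icc 0 T) :
    incInt α T h T (source α r T σ y k g t) = driveDer hα hα' hσ y g D h t := by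
  have hα1 : α < 1 := by linarith
  have hT : 0 ≤ T := ht.1.trans ht.2
  obtain ⟨M, hM, hMle⟩ := exists_fracNorm_kerInt_le hα hα1 hr hσ y hk g
  set f := nem hσ (shift α r T y) with hf
  set F := nemDer hσ (shift α r T y) (shift α r T (D h)) with hF
  have hfm := measurable_indicator_Ioc f.measurable 0 t
  have hFm := measurable_indicator_Ioc F.measurable 0 T
  have hfN : fracNorm α T ((Ioc 0 t).indicator f) < ∞ :=
    fracNorm_indicator_lt_top hα hα1 f.measurable (norm_nonneg f) f.eNorm1_eq.le le_rfl ht.1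
      ht.2 ht.2
  have hFN : fracNorm α T ((Ioc 0 T).indicator F) < ∞ :=
    fracNorm_indicator_lt_top hα hα1 F.measurable (norm_nonneg F) F.eNorm1_eq.le le_rfl hT
      le_rfl le_rfl
  have hFv : ∀ v ∈ Icc 0 T, F v = deriv σ (y (v - r)) * D h (v - r) := fun v hv => by
    rw [hF, nemDer_apply hσ _ _ hv, shift_apply _ hv, shift_apply _ hv]
  rw [incInt_congr_ae (source_ae_eq hσ y g ht.2),
    incInt_add hα hα1 h le_rfl hfm hfN
      (measurable_kerInt_right hσ y.measurable hk.measurable g.measurable t)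
      ((hMle t ht.2).trans_lt hM), driveDer_apply hα hα' hσ y g D h ht]
  congr 1
  · rw [incInt_eq_of_vanish_right hα hα1 h ht hfm
      (fun s hs => indicator_of_notMem (fun h' => hs.not_gt h'.1) f)
      (fun s hs => indicator_of_notMem (fun h' => hs.not_ge h'.2) f) hfN,
      incInt_eq_gsInt hα hα1 h ht.2 hfm
      (fun s hs => indicator_of_notMem (fun h' => hs.not_gt h'.1) f) hfN]
    refine gsInt_congr fun s hs => ?_
    rw [indicator_of_mem hs, hf, nem_shift_apply hσ y ⟨hs.1.le, hs.2.trans ht.2⟩]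
  · rw [incInt_kerInt hα hα1 hr hσ y hk g h ht.2]
    -- The inner integral against `h` is `σ'(y_{v-r}) D_h x̄_{v-r}`. For `v ≤ r` both sides vanish,
    -- the right one because integrals up to a nonpositive time are zero.
    have hae : (fun v => incInt α T h T fun s => delayKer r T σ y k s v)
        =ᵐ[volume] (Ioc 0 T).indicator F := by
      filter_upwards [ae_fracNorm_delayKer_left_lt_top hα hα1 hr hσ y hk] with v hv
      rcases le_or_gt v r with hvr | hvr
      · rw [incInt_eq_zero_of_vanish fun s _ => delayKer_of_le_delay hvr s]
        by_cases hmem : v ∈ Ioc 0 T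
        · rw [indicator_of_mem hmem, hFv v (Ioc_subset_Icc_self hmem), hD (v - r)
            ⟨by linarith [hmem.1], by linarith [hmem.2]⟩, gsInt_of_le (by linarith), mul_zero]
        · rw [indicator_of_notMem hmem]
      rcases le_or_gt v T with hvT | hvT
      · have hmem : v ∈ Ioc 0 T := ⟨by linarith, hvT⟩
        have hdm := measurable_delayKer_left (r := r) (T := T) hσ y.measurable hk.measurable v
        -- Locality is used here: the section vanishes for `s ≥ v - r`, so its integral up to `T` is
        -- the one up to `v - r` that represents `D_h x̄_{v-r}`.
        rw [indicator_of_mem hmem, hFv v (Ioc_subset_Icc_self hmem), hD (v - r)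
            ⟨by linarith [hmem.1], by linarith [hmem.2]⟩, ← gsInt_smul_left,
          incInt_eq_of_vanish_right hα hα1 h (t := v - r) ⟨by linarith, by linarith⟩ hdm
            (fun s hs => delayKer_of_neg hs v) (fun s hs => delayKer_of_le (by linarith)) hv,
          incInt_eq_gsInt hα hα1 h (by linarith) hdm (fun s hs => delayKer_of_neg hs v) hv]
        refine gsInt_congr_ae ?_
        filter_upwards [ae_restrict_mem measurableSet_Ioc,
          ae_restrict_of_ae (Measure.ae_ne volume (v - r))] with s hs hne
        exact delayKer_of_mem hs.1.le ⟨by linarith [lt_of_le_of_ne hs.2 hne], hvT⟩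
      · rw [indicator_of_notMem fun h' : v ∈ Ioc 0 T => hvT.not_ge h'.2]
        exact incInt_eq_zero_of_vanish fun s _ => if_neg fun h' => hvT.not_ge h'.2.2
    rw [incInt_congr_ae hae, incInt_eq_gsInt hα hα1 g ht.2 hFm
      (fun s hs => indicator_of_notMem (fun h' => hs.not_gt h'.1) F) hFN]
    refine gsInt_congr fun s hs => ?_
    rw [indicator_of_mem (show s ∈ Ioc 0 T from ⟨hs.1, hs.2.trans ht.2⟩),
      hFv s ⟨hs.1.le, hs.2.trans ht.2⟩]

end Source

section Resolv

variable {α r T L : ℝ} {β σ : ℝ → ℝ} {k : ℝ → ℝ → ℝ}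

/-- The factor in the variation of constants formula. -/
def voltFactor (β : ℝ → ℝ) (u : ℝ) : ℝ := β u * Real.exp (-prim β u)

lemma measurable_voltFactor (hβ : Measurable β) (hL : ∀ t, |β t| ≤ L) :
    Measurable (voltFactor β) := by
  have := (continuous_prim hβ hL).measurable
  unfold voltFactor
  fun_prop

lemma abs_voltFactor_le (hL : ∀ t, |β t| ≤ L) {u : ℝ} (hu : u ∈ Icc 0 T) :
    |voltFactor β u| ≤ L * Real.exp (L * T) := by
  have hL0 : 0 ≤ L := (abs_nonneg _).trans (hL 0)
  have h3 : -prim β u ≤ L * T := (neg_le_abs _).trans (abs_prim_le hL hu)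
  rw [voltFactor, abs_mul, abs_of_pos (Real.exp_pos _)]
  gcongr
  exact hL u

/-- Exchange of a Lebesgue integral and a generalized Stieltjes integral. -/
lemma incInt_integral (hα : 0 < α) (hα1 : α < 1) {q : ℝ → ℝ → ℝ}
    (hq : Measurable fun z : ℝ × ℝ => q z.1 z.2) {γ : ℝ → ℝ} (hγ : Measurable γ) {C : ℝ}
    {a b : ℝ} (hC : ∀ u ∈ Ioc a b, |γ u| ≤ C) {M : ℝ≥0∞} (hM : M < ∞)
    (hqM : ∀ u ∈ Ioc a b, fracNorm α T (q u) ≤ M)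
    (hi : ∀ s, IntegrableOn (fun u => γ u * q u s) (Ioc a b)) (h : W2 α T) :
    fracNorm α T (fun s => ∫ u in Ioc a b, γ u * q u s) < ∞ ∧
      incInt α T h T (fun s => ∫ u in Ioc a b, γ u * q u s)
        = ∫ u in Ioc a b, γ u * incInt α T h T (q u) := by
  have hhm := h.measurable
  have hW : Measurable (gsWeight α h T) := measurable_gsWeight hhm T
  set Θ : (ℝ × ℝ) × ℝ → ℝ := fun z => γ z.2 * (q z.2 z.1.1 - q z.2 z.1.2) with hΘ
  have hΘm : Measurable Θ := (hγ.comp measurable_snd).mul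
    ((hq.comp (f := fun z : (ℝ × ℝ) × ℝ => (z.2, z.1.1)) (by fun_prop)).sub
      (hq.comp (f := fun z : (ℝ × ℝ) × ℝ => (z.2, z.1.2)) (by fun_prop)))
  -- The seminorms of the sections are bounded uniformly in `u` and the time interval is finite;
  -- this justifies Fubini.
  have hbound : ∫⁻ p, (∫⁻ u in Ioc a b, ‖Θ (p, u)‖ₑ) ∂incMeasure α T < ∞ := by
    rw [lintegral_lintegral_swap (f := fun p u => ‖Θ (p, u)‖ₑ) hΘm.enorm.aemeasurable]
    refine lt_of_le_of_lt (setLIntegral_mono' (g := fun _ => ENNReal.ofReal C * M)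
      measurableSet_Ioc fun u hu => ?_) ?_
    · have : ∫⁻ p, ‖Θ (p, u)‖ₑ ∂incMeasure α T = ‖γ u‖ₑ * fracNorm α T (q u) := by
        rw [fracNorm, ← lintegral_const_mul' _ _ enorm_ne_top]
        refine lintegral_congr fun p => ?_
        rw [← enorm_mul]
      rw [this]
      exact mul_le_mul' (enorm_le_of_abs_le (hC u hu)) (hqM u hu)
    · rw [setLIntegral_const, Real.volume_Ioc]
      finiteness
  have hsub : ∀ p : ℝ × ℝ, (∫ u in Ioc a b, γ u * q u p.1) - ∫ u in Ioc a b, γ u * q u p.2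
      = ∫ u in Ioc a b, Θ (p, u) := fun p => by
    rw [← integral_sub (hi p.1) (hi p.2)]
    refine integral_congr_ae (ae_of_all _ fun u => ?_)
    simp only [hΘ]
    ring
  have hΘi : Integrable Θ ((incMeasure α T).prod (volume.restrict (Ioc a b))) := by
    refine ⟨hΘm.aestronglyMeasurable, ?_⟩
    rw [HasFiniteIntegral, lintegral_prod _ hΘm.enorm.aemeasurable]
    exact hbound
  constructor
  · refine lt_of_le_of_lt (lintegral_mono fun p => ?_) hbound
    rw [hsub p]
    exact enorm_integral_le_lintegral_enorm _
  · have hI : Integrable (fun z : (ℝ × ℝ) × ℝ => Θ z * gsWeight α h T z.1.1)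
        ((incMeasure α T).prod (volume.restrict (Ioc a b))) :=
      hΘi.mul_bdd (c := gsConst α * ‖h‖) (Measurable.aestronglyMeasurable (by fun_prop))
        (ae_of_all _ fun z => abs_gsWeight_le hα hα1 h le_rfl z.1.1)
    calc _ = ∫ p, (∫ u in Ioc a b, Θ (p, u) * gsWeight α h T p.1) ∂incMeasure α T := by
          refine integral_congr_ae (ae_of_all _ fun p => ?_)
          simp only
          rw [hsub p, integral_mul_const]
      _ = ∫ u in Ioc a b, ∫ p, Θ (p, u) * gsWeight α h T p.1 ∂incMeasure α T :=
          integral_integral_swap hI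
      _ = _ := by
          refine integral_congr_ae (ae_of_all _ fun u => ?_)
          simp only
          rw [incInt, ← integral_const_mul]
          refine integral_congr_ae (ae_of_all _ fun p => ?_)
          simp only [hΘ]
          ring

lemma resolv_eq (y g : ℝ → ℝ) {t : ℝ} (ht : 0 ≤ t) (s : ℝ) : resolv α r T β σ y k g t s
    = source α r T σ y k g t s + Real.exp (prim β t)
      * ∫ u in Ioc 0 t, voltFactor β u * source α r T σ y k g u s := by
  rw [resolv, volt, intervalIntegral.integral_of_le ht]
  rfl

lemma measurable_resolv (hσ : IsCb 2 σ) (hβ : Measurable β) (hL : ∀ t, |β t| ≤ L)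
    (y : W1 α (-r) (T - r)) (hk : IsRegularKernel α r T k) (g : W2 α T) {t : ℝ} (ht : 0 ≤ t) :
    Measurable (resolv α r T β σ y k g t) := by
  have hs := measurable_source (α := α) (r := r) (T := T) hσ y.measurable hk.measurable
    g.measurable
  have h1 : Measurable fun z : ℝ × ℝ => voltFactor β z.2 * source α r T σ y k g z.2 z.1 :=
    ((measurable_voltFactor hβ hL).comp measurable_snd).mul
      (hs.comp (f := fun z : ℝ × ℝ => (z.2, z.1)) (by fun_prop))
  have h2 := (h1.stronglyMeasurable.integral_prod_right'
    (ν := volume.restrict (Ioc 0 t))).measurable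
  have e : resolv α r T β σ y k g t = fun s => source α r T σ y k g t s + Real.exp (prim β t)
      * ∫ u in Ioc 0 t, voltFactor β u * source α r T σ y k g u s :=
    funext fun s => resolv_eq y g ht s
  rw [e]
  exact (measurable_source_right hσ y.measurable hk.measurable g.measurable t).add
    (h2.const_mul _)

lemma resolv_of_neg {y g : ℝ → ℝ} {s : ℝ} (hs : s < 0) (t : ℝ) :
    resolv α r T β σ y k g t s = 0 := by
  simp [resolv, volt, source_of_neg hs]

lemma resolv_of_lt (hr : 0 < r) {y g : ℝ → ℝ} {s t : ℝ} (ht : 0 ≤ t) (h : t < s) :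
    resolv α r T β σ y k g t s = 0 := by
  rw [resolv, source_of_lt hr h, volt_congr (q' := fun _ => 0) ht fun u hu =>
    source_of_lt hr (hu.2.trans_lt h)]
  simp [volt]

/-- By variation of constants `volt` is, for fixed `t`, a Lebesgue integral in time with bounded
factor, so it commutes with integration against `h`. -/
lemma fracNorm_resolv_lt_top_and_incInt (hα : 0 < α) (hα1 : α < 1) (hr : 0 < r) (hσ : IsCb 2 σ)
    (hβ : Measurable β) (hL : ∀ t, |β t| ≤ L) (y : W1 α (-r) (T - r))
    (hk : IsRegularKernel α r T k) (g h : W2 α T) {t : ℝ} (ht : t ∈ Icc 0 T) :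
    fracNorm α T (resolv α r T β σ y k g t) < ∞ ∧
      incInt α T h T (resolv α r T β σ y k g t)
        = incInt α T h T (source α r T σ y k g t)
          + volt β (fun u => incInt α T h T (source α r T σ y k g u)) t := by
  have hT : 0 ≤ T := ht.1.trans ht.2
  obtain ⟨M, hM, hMle⟩ := exists_fracNorm_source_le hα hα1 hr hσ y hk g
  have hs := measurable_source (α := α) (r := r) (T := T) hσ y.measurable hk.measurable
    g.measurable
  have hsr := measurable_source_right (α := α) (r := r) (T := T) hσ y.measurable hk.measurable
    g.measurable t
  have hmem : ∀ u ∈ Ioc 0 t, u ∈ Icc 0 T := fun u hu => ⟨hu.1.le, hu.2.trans ht.2⟩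
  obtain ⟨h1, h2⟩ := incInt_integral (T := T) hα hα1 (q := source α r T σ y k g) hs
    (measurable_voltFactor hβ hL) (fun u hu => abs_voltFactor_le hL (hmem u hu)) hM
    (fun u hu => hMle u (hmem u hu)) (fun s => by
      have := intervalIntegrable_kernel_mul hβ hL
        (intervalIntegrable_source hα hα1 hr hT hσ y hk g s)
      rw [intervalIntegrable_iff_integrableOn_Ioc_of_le hT] at this
      exact this.mono_set (Ioc_subset_Ioc_right ht.2)) h
  have hJm : Measurable fun s => ∫ u in Ioc 0 t, voltFactor β u * source α r T σ y k g u s := by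
    have h3 : Measurable fun z : ℝ × ℝ => voltFactor β z.2 * source α r T σ y k g z.2 z.1 :=
      ((measurable_voltFactor hβ hL).comp measurable_snd).mul
        (hs.comp (f := fun z : ℝ × ℝ => (z.2, z.1)) (by fun_prop))
    exact (h3.stronglyMeasurable.integral_prod_right'
      (ν := volume.restrict (Ioc 0 t))).measurable
  have e : resolv α r T β σ y k g t = fun s => source α r T σ y k g t s + Real.exp (prim β t)
      * ∫ u in Ioc 0 t, voltFactor β u * source α r T σ y k g u s :=
    funext fun s => resolv_eq y g ht.1 s
  have h4 : fracNorm α T (fun s => Real.exp (prim β t)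
      * ∫ u in Ioc 0 t, voltFactor β u * source α r T σ y k g u s) < ∞ := by
    rw [fracNorm_const_mul]
    exact ENNReal.mul_lt_top enorm_lt_top h1
  have h5 := (hMle t ht).trans_lt hM
  rw [e]
  constructor
  · exact (fracNorm_add_le hsr).trans_lt (ENNReal.add_lt_top.2 ⟨h5, h4⟩)
  · rw [incInt_add hα hα1 h le_rfl hsr h5 (hJm.const_mul _) h4, incInt_const_mul, h2, volt,
      intervalIntegral.integral_of_le ht.1]
    rfl

/-- The kernel `resolv` solves the Volterra equation. -/
lemma isVolterraKernel_resolv (hα : 0 < α) (hα1 : α < 1) (hr : 0 < r) (hT : 0 ≤ T)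
    (hσ : IsCb 2 σ) (hβ : Measurable β) (hL : ∀ t, |β t| ≤ L) (y : W1 α (-r) (T - r))
    (hk : IsRegularKernel α r T k) (g : W2 α T) {b x : ℝ → ℝ}
    (hβx : ∀ t ∈ Icc 0 T, β t = deriv b (x t)) :
    IsVolterraKernel α r T b σ y g x k (resolv α r T β σ y k g) := by
  have hsi := fun s => intervalIntegrable_source hα hα1 hr hT hσ y hk g s
  have hint : ∀ s, IntervalIntegrable (fun u => resolv α r T β σ y k g u s) volume 0 T := fun s =>
    (hsi s).add (ContinuousOn.intervalIntegrable (by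
      rw [uIcc_of_le hT]
      exact continuousOn_volt hβ hL hT (hsi s)))
  refine ⟨fun s hs => (hint s).mono_set (uIcc_subset_uIcc_right (by rwa [uIcc_of_le hT])),
    fun s hs t ht hst => ?_, fun s _ t ht hts => resolv_of_lt hr ht.1 hts⟩
  have e1 : resolv α r T β σ y k g t s = source α r T σ y k g t s
      + ∫ u in 0..t, β u * resolv α r T β σ y k g u s := by
    rw [resolv, volt_eq hβ hL (hsi s) ht]
    rfl
  have hβi : IntervalIntegrable (fun u => β u * resolv α r T β σ y k g u s) volume 0 T := by
    have := hint s
    rw [intervalIntegrable_iff] at this ⊢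
    exact this.bdd_mul (c := L) hβ.aestronglyMeasurable (ae_of_all _ hL)
  -- The kernel vanishes for `u < s`, so the equation solved from time `0` is the equation from time
  -- `s`.
  have e2 : ∫ u in 0..t, β u * resolv α r T β σ y k g u s
      = ∫ u in s..t, β u * resolv α r T β σ y k g u s := by
    rw [← intervalIntegral.integral_add_adjacent_intervals (b := s)
      (hβi.mono_set (uIcc_subset_uIcc_left (by rwa [uIcc_of_le hT])))
      (hβi.mono_set (uIcc_subset_uIcc (by rwa [uIcc_of_le hT]) (by rwa [uIcc_of_le hT])))]
    rw [intervalIntegral.integral_congr_ae (g := fun _ => (0 : ℝ)),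
      intervalIntegral.integral_zero, zero_add]
    filter_upwards [Measure.ae_ne volume s] with u hne hu
    rw [uIoc_of_le hs.1] at hu
    rw [resolv_of_lt hr hu.1.le (lt_of_le_of_ne hu.2 hne), mul_zero]
  have e3 : ∫ u in s..t, β u * resolv α r T β σ y k g u s
      = ∫ u in s..t, deriv b (x u) * resolv α r T β σ y k g u s := by
    refine intervalIntegral.integral_congr fun u hu => ?_
    rw [uIcc_of_le hst] at hu
    simp only [hβx u ⟨hs.1.trans hu.1, hu.2.trans ht.2⟩]
  rw [e1, e2, e3, source, if_pos ⟨hs.1, hst⟩, kerInt_eq_gsInt hα hα1 hr hσ y hk g hs ht.2]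
  ring

end Resolv

/-- Uniqueness for the Volterra equation. -/
lemma IsVolterraKernel.unique {α r T C : ℝ} {b σ y g x : ℝ → ℝ} {k Φ Ψ : ℝ → ℝ → ℝ}
    (hC : ∀ u, |deriv b u| ≤ C)
    (hm : AEStronglyMeasurable (fun u => deriv b (x u)) (volume.restrict (Ioc 0 T)))
    (hΦ : IsVolterraKernel α r T b σ y g x k Φ)
    (hΨ : IsVolterraKernel α r T b σ y g x k Ψ) {s t : ℝ}
    (hs : s ∈ Icc 0 T) (ht : t ∈ Icc 0 T) : Ψ t s = Φ t s := by
  have hC0 : 0 ≤ C := (abs_nonneg _).trans (hC 0)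
  rcases lt_or_ge t s with hts | hst
  · rw [hΦ.vanish s hs t ht hts, hΨ.vanish s hs t ht hts]
  have hmul : ∀ {Θ : ℝ → ℝ → ℝ}, IsVolterraKernel α r T b σ y g x k Θ →
      IntervalIntegrable (fun u => deriv b (x u) * Θ u s) volume s T := fun {Θ} hΘ => by
    have := hΘ.integrable s hs
    rw [intervalIntegrable_iff_integrableOn_Ioc_of_le hs.2] at this ⊢
    exact Integrable.bdd_mul (c := C) this
      (hm.mono_measure (Measure.restrict_mono (Ioc_subset_Ioc_left hs.1) le_rfl))
      (ae_of_all _ fun u => hC _)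
  have hsub : ∀ {φ : ℝ → ℝ}, IntervalIntegrable φ volume s T → ∀ {t}, t ∈ Icc s T →
      IntervalIntegrable φ volume s t := fun h t ht =>
    h.mono_set (uIcc_subset_uIcc_left (by rwa [uIcc_of_le hs.2]))
  have hd := (hΨ.integrable s hs).sub (hΦ.integrable s hs)
  -- With `A = 0` Grönwall's inequality forces the difference to vanish at every `t`, not just
  -- almost everywhere.
  have h0 := gronwall_integral (A := 0) hC0 le_rfl hd (fun v hv => ?_) (⟨hst, ht.2⟩ : t ∈ Icc s T)
  · rw [zero_mul] at h0
    exact sub_eq_zero.1 (abs_nonpos_iff.1 h0)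
  · have hv' : v ∈ Icc 0 T := ⟨hs.1.trans hv.1, hv.2⟩
    have e : Ψ v s - Φ v s = ∫ u in s..v, deriv b (x u) * (Ψ u s - Φ u s) := by
      simp only [mul_sub]
      rw [intervalIntegral.integral_sub (hsub (hmul hΨ) hv) (hsub (hmul hΦ) hv),
        hΨ.eq s hs v hv' hv.1, hΦ.eq s hs v hv' hv.1]
      ring
    rw [zero_add, e, ← intervalIntegral.integral_const_mul]
    refine (intervalIntegral.abs_integral_le_integral_abs hv.1).trans ?_
    refine intervalIntegral.integral_mono_on hv.1 ?_ ((hsub hd hv).abs.const_mul C) fun u _ => ?_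
    · have := ((hsub (hmul hΨ) hv).sub (hsub (hmul hΦ) hv)).abs
      simpa only [mul_sub] using this
    · rw [abs_mul]
      gcongr
      exact hC _

end FracDelay

end

/-! ### The theorem -/

theorem proposition5p5 {α r T : ℝ} (hα : 0 < α) (hα' : α < 1 / 2) (hr : 0 < r) (hT : 0 < T)
    {b σ : ℝ → ℝ} (hb : FracDelay.IsCb 2 b) (hσ : FracDelay.IsCb 2 σ) (η : ℝ → ℝ)
    -- the map `g ↦ x̄^g`, continuously Fréchet differentiable
    (xbar : FracDelay.W2 α T → FracDelay.W1 α (-r) (T - r))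
    (Dxbar : FracDelay.W2 α T → FracDelay.W2 α T →L[ℝ] FracDelay.W1 α (-r) (T - r))
    (hxbar : ∀ g, HasFDerivAt xbar (Dxbar g) g) (hDxbar : Continuous Dxbar)
    -- the solutions `x^g` of the delay equation
    (x : FracDelay.W2 α T → ℝ → ℝ)
    (hx : ∀ g, FracDelay.IsDelaySolution α r T b σ η (xbar g) g (x g))
    -- a point `g` and the kernel `k s t = D_s x̄^g_t` at that point
    (g : FracDelay.W2 α T) (k : ℝ → ℝ → ℝ) (hk : FracDelay.IsRegularKernel α r T k) :
    ∃ Φ : ℝ → ℝ → ℝ,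
      FracDelay.IsVolterraKernel α r T b σ (xbar g) g (x g) k Φ ∧
      (∀ Ψ, FracDelay.IsVolterraKernel α r T b σ (xbar g) g (x g) k Ψ →
        ∀ s ∈ Set.Icc 0 T, ∀ t ∈ Set.Icc 0 T, Ψ t s = Φ t s) ∧
      (∀ s ∈ Set.Icc 0 T, ∀ t ∈ Set.Icc 0 T, s ≤ t →
        FracDelay.GSIntegrable α s t (fun u => deriv σ (xbar g (u - r)) * k s (u - r))) ∧
      (∀ t ∈ Set.Icc 0 T, FracDelay.GSIntegrable α 0 t (Φ t)) ∧
      ∃ (x' : FracDelay.W2 α T → FracDelay.W1 α 0 T)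
        (Dx : FracDelay.W2 α T →L[ℝ] FracDelay.W1 α 0 T),
        (∀ g', ∀ t ∈ Set.Icc 0 T, x' g' t = x g' t) ∧
        HasFDerivAt x' Dx g ∧
        ∀ h : FracDelay.W2 α T,
          (∀ t ∈ Set.Icc (-r) (T - r), Dxbar g h t = FracDelay.gsInt α 0 t (fun s => k s t) h) →
          ∀ t ∈ Set.Icc 0 T, Dx h t = FracDelay.gsInt α 0 t (Φ t) h := by
  have hα1 : α < 1 := by linarith
  obtain ⟨C, -, h1, -⟩ := hb.exists_bound
  set X := (hx g).toW1 hα hα' hT.le hb hσ with hX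
  -- Defined through the zero extension `X` of the solution, so that `β` is measurable and bounded
  -- on the whole line; it equals `b'(x^g)` on `[0,T]` only.
  set β : ℝ → ℝ := fun t => deriv b (X t) with hβ
  have hβm : Measurable β := hb.contDiff_deriv.continuous.measurable.comp X.measurable
  have hβL : ∀ t, |β t| ≤ C := fun t => h1 (X t)
  have hβx : ∀ t ∈ Set.Icc 0 T, β t = deriv b (x g t) := fun t ht => by
    rw [hβ, hX, ← (hx g).toW1_apply hα hα' hT.le hb hσ ht]
  have hV := FracDelay.isVolterraKernel_resolv hα hα1 hr hT.le hσ hβm hβL (xbar g) hk g hβx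
  have hΦ := fun h {t} ht => FracDelay.fracNorm_resolv_lt_top_and_incInt (t := t) hα hα1 hr hσ hβm
    hβL (xbar g) hk g h ht
  have hΦm := fun {t} (ht : 0 ≤ t) =>
    FracDelay.measurable_resolv (α := α) hσ hβm hβL (xbar g) hk g ht
  obtain ⟨Dx, hDx, hDxe⟩ := FracDelay.exists_hasFDerivAt_solution hα hα' hT.le hb hσ hx (hxbar g)
    hβx
  refine ⟨FracDelay.resolv α r T β σ (xbar g) k g, hV, fun Ψ hΨ s hs t ht => ?_,
    fun s hs t ht _ => FracDelay.gsIntegrable_delay hα hα1 hr hσ (xbar g) hk hs ht.2,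
    -- Finiteness of the seminorm does not involve the direction, so the zero direction is inserted.
    fun t ht => FracDelay.gsIntegrable_of_fracNorm hα hα1 (hΦm ht.1)
      (fun s hs => FracDelay.resolv_of_neg hs t) ht.2 (hΦ 0 ht).1,
    _, Dx, fun g' t ht => (hx g').toW1_apply hα hα' hT.le hb hσ ht, hDx, fun h hh t ht => ?_⟩
  · refine FracDelay.IsVolterraKernel.unique h1 ?_ hV hΨ hs ht
    refine hβm.aestronglyMeasurable.congr ?_
    filter_upwards [MeasureTheory.ae_restrict_mem measurableSet_Ioc] with u hu
    exact hβx u (Set.Ioc_subset_Icc_self hu)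
  · have hsrc := fun {t} ht =>
      FracDelay.incInt_source (t := t) hα hα' hr hσ (xbar g) hk g h (D := Dxbar g) hh ht
    -- Since `Φ_t(s) = 0` for `s > t`, locality replaces the upper limit `t` by the common limit
    -- `T`. Only with a limit independent of `t` can `volt` be pulled out of the integral.
    rw [hDxe h t ht, ← FracDelay.incInt_eq_gsInt hα hα1 h ht.2 (hΦm ht.1)
        (fun s hs => FracDelay.resolv_of_neg hs t) (hΦ h ht).1,
      ← FracDelay.incInt_eq_of_vanish_right hα hα1 h ht (hΦm ht.1)
        (fun s hs => FracDelay.resolv_of_neg hs t)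
        (fun s hs => FracDelay.resolv_of_lt hr ht.1 hs) (hΦ h ht).1,
      (hΦ h ht).2, hsrc ht]
    congr 1
    exact FracDelay.volt_congr ht.1 fun u hu => (hsrc ⟨hu.1.le, hu.2.trans ht.2⟩).symm
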